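/- Let $\mathcal H$ be a complex separable Hilbert space with a polarization $\mathcal H=\mathcal H_+\oplus\mathcal H_-$ into closed orthogonal subspaces, with orthogonal projectors $P_\pm$. Write $X_\pm=P_\pm XP_\pm$, $X_{+-}=P_+XP_-$, $X_{-+}=P_-XP_+$, regarded as operators between $\mathcal H_\pm$. Let $L^\infty,L^1,L^2,\mathcal K$ denote bounded, trace class, Hilbert--Schmidt and compact operators; $\|\cdot\|_\infty,\|\cdot\|_1,\|\cdot\|_2$ are the operator, trace and Hilbert--Schmidt norms. In this statement $[A,B]=AB-BA$ always denotes the commutator. Put * $\mathfrak h=L^\infty(\mathcal H,\mathcal H_+)=\{X\in L^\infty(\mathcal H): X_{+-},X_{-+}\in L^2\}$ with the commutator bracket and $\|X\|=\|X_+\|_\infty+\|X_-\|_\infty+\|X_{+-}\|_2+\|X_{-+}\|_2$; * $\mathfrak n=L^1(\mathcal H_+)$ with $\|\cdot\|_1$ and the negative commutator bracket $[\rho,\rho']_{\mathfrak n}=-[\rho,\rho']$; * $\mathfrak c=\mathcal K(\mathcal H_+)$ with $\|\cdot\|_\infty$, and $\mathfrak a=L^1(\mathcal H,\mathcal H_+)=\{\sigma\in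 L^\infty(\mathcal H):\sigma_\pm\in L^1,\ \sigma_{+-},\sigma_{-+}\in L^2\}$ with $\|\sigma\|=\|\sigma_+\|_1+\|\sigma_-\|_1+\|\sigma_{+-}\|_2+\|\sigma_{-+}\|_2$; * $\varphi(X)\rho=[X_+,\rho]$ and $\omega(X,X')=X_{+-}X'_{-+}-X'_{+-}X_{-+}$ for $X,X'\in\mathfrak h$, $\rho\in\mathfrak n$; * the pairings $\langle\varkappa,\rho\rangle=\operatorname{tr}(\varkappa\rho)$ on $\mathfrak c\times\mathfrak n$ and $\langle\sigma,X\rangle=\operatorname{tr}(\sigma_+X_++\sigma_-X_-+\sigma_{+-}X_{-+}+\sigma_{-+}X_{+-})$ on $\mathfrak a\times\mathfrak h$. A Banach Lie algebra is a Banach space with a continuous Lie bracket. A Banach Lie--Poisson space is a Banach space $\mathfrak b$ with a Lie bracket $\{\cdot,\cdot\}$ on $C^\infty(\mathfrak b)$ that satisfies the Leibniz rule, such that for each $h\in C^\infty(\mathfrak b)$ the derivation $X_h=\{\cdot,h\}$ is a smooth vector field on $\mathfrak b$, and such that $\mathfrak b^*\subset C^\infty(\mathfrak b)$ is a Banach Lie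 algebra under $\{\cdot,\cdot\}$. Here $C^\infty$ means complex-valued and smooth over $\mathbb C$. Extensions are short exact sequences of Banach spaces whose maps are continuous Lie algebra homomorphisms, respectively linear Poisson maps. Then: 1. $\mathfrak n$ and $\mathfrak h$ are Banach Lie algebras; $\varphi$ is a continuous linear map from $\mathfrak h$ into the continuous derivations of $\mathfrak n$; $\omega:\mathfrak h\times\mathfrak h\to\mathfrak n$ is continuous, bilinear and skew symmetric; and for all $X,X',X''\in\mathfrak h$, $\rho\in\mathfrak n$, $$\omega([X,X'],X'')+\omega([X',X''],X)+\omega([X'',X],X')-\varphi(X)\omega(X',X'')-\varphi(X')\omega(X'',X)-\varphi(X'')\omega(X,X')=0,$$ $$[\omega(X,X'),\rho]_{\mathfrak n}+\varphi([X,X'])\rho-\varphi(X)\varphi(X')\rho+\varphi(X')\varphi(X)\rho=0.$$ 2. $\mathfrak g=\mathfrak n\oplus\mathfrak h$ with $[(\rho,X),(\rho',X')]=\big(-[\rho,\rho']+[X_+,\rho']-[X'_+,\rho]+\omega(X,X'),\,[X,X']\big)$ is a Banach Lie algebra, and it is an extension $0\to\mathfrak n\to\mathfrak g\to\mathfrak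 h\to0$ of $\mathfrak h$ by $\mathfrak n$ (through the natural inclusion and projection). 3. Through the pairings, $\mathfrak c$ is a predual of $\mathfrak n$ and $\mathfrak a$ is a predual of $\mathfrak h$ (the maps $\mathfrak n\to\mathfrak c^*$ and $\mathfrak h\to\mathfrak a^*$ are isomorphisms of Banach spaces, not necessarily isometric), and $\varphi(X)^*\mathfrak c\subset\mathfrak c$, $(\varphi(\cdot)\rho)^*\mathfrak c\subset\mathfrak a$, $\omega(X,\cdot)^*\mathfrak c\subset\mathfrak a$ for all $X\in\mathfrak h$, $\rho\in\mathfrak n$. 4. For $f\in C^\infty(\mathfrak c\oplus\mathfrak a)$ let $\frac{\delta f}{\delta\varkappa}\in\mathfrak n$ and $\frac{\delta f}{\delta\sigma}\in\mathfrak h$ represent the partial Fréchet derivatives at $(\varkappa,\sigma)$ through the pairings. Then $\mathfrak c\oplus\mathfrak a=\mathcal K(\mathcal H_+)\oplus L^1(\mathcal H,\mathcal H_+)$ is a Banach Lie--Poisson space with the bracket $$\{f,g\}(\varkappa,\sigma)=\Big\langle\sigma,\Big[\tfrac{\delta f}{\delta\sigma},\tfrac{\delta g}{\delta\sigma}\Big]\Big\rangle+\operatorname{tr}\Big(\varkappa\Big(-\Big[\tfrac{\delta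 f}{\delta\varkappa},\tfrac{\delta g}{\delta\varkappa}\Big]-\Big[\big(\tfrac{\delta g}{\delta\sigma}\big)_+,\tfrac{\delta f}{\delta\varkappa}\Big]+\Big[\big(\tfrac{\delta f}{\delta\sigma}\big)_+,\tfrac{\delta g}{\delta\varkappa}\Big]+\omega\big(\tfrac{\delta f}{\delta\sigma},\tfrac{\delta g}{\delta\sigma}\big)\Big)\Big).$$ It is an extension $0\to\mathfrak a\to\mathfrak c\oplus\mathfrak a\to\mathfrak c\to0$ of $\mathfrak c$ by $\mathfrak a$ (through the natural inclusion and projection), where $\mathfrak a$ and $\mathfrak c$ are Banach Lie--Poisson spaces with the brackets $\langle\sigma,[\frac{\delta f}{\delta\sigma},\frac{\delta g}{\delta\sigma}]\rangle$ and $\operatorname{tr}(\varkappa[\frac{\delta f}{\delta\varkappa},\frac{\delta g}{\delta\varkappa}]_{\mathfrak n})$. 5. The Hamiltonian vector field of $h\in C^\infty(\mathfrak c\oplus\mathfrak a)$ is $$X_h(\varkappa,\sigma)=-\Big(-\Big[\varkappa,\tfrac{\delta h}{\delta\varkappa}\Big]+\Big[\varkappa,\big(\tfrac{\delta h}{\delta\sigma}\big)_+\Big],\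 \begin{pmatrix}0&\varkappa\big(\tfrac{\delta h}{\delta\sigma}\big)_{+-}\\-\big(\tfrac{\delta h}{\delta\sigma}\big)_{-+}\varkappa&0\end{pmatrix}-\begin{pmatrix}\big[\tfrac{\delta h}{\delta\varkappa},\varkappa\big]&0\\0&0\end{pmatrix}+\Big[\sigma,\tfrac{\delta h}{\delta\sigma}\Big]\Big).$$ -/

import Mathlib

set_option linter.unusedSectionVars false

open scoped InnerProductSpace ENNReal ContDiff

noncomputable section

section OperatorIdeals

variable {E : Type*} [NormedAddCommGroup E] [InnerProductSpace ℂ E] [CompleteSpace E]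
variable {F : Type*} [NormedAddCommGroup F] [InnerProductSpace ℂ F] [CompleteSpace F]
variable {G : Type*} [NormedAddCommGroup G] [InnerProductSpace ℂ G] [CompleteSpace G]

variable (E) in
/-- Index set of a fixed orthonormal (Hilbert) basis of `E`. -/
def onbIndex : Set E := (exists_hilbertBasis ℂ E).choose

variable (E) in
/-- A fixed orthonormal (Hilbert) basis of `E`. The notions below do not depend on its choice. -/
def onb : HilbertBasis (onbIndex E) ℂ E := (exists_hilbertBasis ℂ E).choose_spec.choose

/-- The square of the Hilbert-Schmidt norm, `∑ᵢ ‖A eᵢ‖²`, as an extended nonnegative number. -/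
def hsSq (A : E →L[ℂ] F) : ℝ≥0∞ := ∑' i, ‖A (onb E i)‖ₑ ^ 2

/-- `A` is a Hilbert-Schmidt operator, `A ∈ L²(E, F)`. -/
def IsHilbertSchmidt (A : E →L[ℂ] F) : Prop := hsSq A ≠ ⊤

/-- The Hilbert-Schmidt norm `‖A‖₂ = (∑ᵢ ‖A eᵢ‖²)^{1/2}`. -/
def hsNorm (A : E →L[ℂ] F) : ℝ := √(hsSq A).toReal

/-- The trace `∑ᵢ ⟪eᵢ, |A| eᵢ⟫` of `|A| = (A*A)^{1/2}`, as an extended nonnegative number. -/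
def traceAbs (A : E →L[ℂ] E) : ℝ≥0∞ :=
  ∑' i, ENNReal.ofReal (RCLike.re ⟪onb E i, CFC.abs A (onb E i)⟫_ℂ)

/-- `A` is a trace class operator, `A ∈ L¹(E)`. -/
def IsTraceClass (A : E →L[ℂ] E) : Prop := traceAbs A ≠ ⊤

/-- The trace norm `‖A‖₁ = tr |A|`. -/
def traceNorm (A : E →L[ℂ] E) : ℝ := (traceAbs A).toReal

/-- The trace `∑ᵢ ⟪eᵢ, A eᵢ⟫` of a trace class operator. -/
def opTrace (A : E →L[ℂ] E) : ℂ := ∑' i, ⟪onb E i, A (onb E i)⟫_ℂ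

theorem tsum_cauchySchwarz {ι : Type*} (f g : ι → ℝ≥0∞) :
    ∑' i, f i * g i ≤ (∑' i, f i ^ 2) ^ (1 / 2 : ℝ) * (∑' i, g i ^ 2) ^ (1 / 2 : ℝ) := by
  let _ : MeasurableSpace ι := ⊤
  have h := ENNReal.lintegral_mul_le_Lp_mul_Lq (MeasureTheory.Measure.count (α := ι))
    (Real.HolderConjugate.two_two) (f := f) (g := g) (measurable_from_top.aemeasurable)
    (measurable_from_top.aemeasurable)
  simpa [MeasureTheory.lintegral_count] using h

theorem tsum_minkowski {ι : Type*} (f g : ι → ℝ≥0∞) :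
    (∑' i, (f i + g i) ^ 2) ^ (1 / 2 : ℝ) ≤
      (∑' i, f i ^ 2) ^ (1 / 2 : ℝ) + (∑' i, g i ^ 2) ^ (1 / 2 : ℝ) := by
  let _ : MeasurableSpace ι := ⊤
  have h := ENNReal.lintegral_Lp_add_le (μ := MeasureTheory.Measure.count (α := ι))
    (f := f) (g := g) (measurable_from_top.aemeasurable)
    (measurable_from_top.aemeasurable) (one_le_two : (1 : ℝ) ≤ 2)
  simpa [MeasureTheory.lintegral_count] using h

theorem enorm_sq_eq_tsum (x : F) : ‖x‖ₑ ^ 2 = ∑' j, ‖⟪onb F j, x⟫_ℂ‖ₑ ^ 2 := by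
  have h := (onb F).hasSum_inner_mul_inner x x
  have h2 : HasSum (fun j => ‖⟪onb F j, x⟫_ℂ‖ ^ 2) (‖x‖ ^ 2) := by
    have h3 := Complex.hasSum_re h
    convert h3 using 2 with j
    · rw [← inner_conj_symm x, RCLike.conj_mul]
      simp [← Complex.ofReal_pow]
    · exact (inner_self_eq_norm_sq (𝕜 := ℂ) x).symm
  have h4 := h2.summable
  have e : ∀ r : ℝ, 0 ≤ r → ENNReal.ofReal r ^ 2 = ENNReal.ofReal (r ^ 2) := fun r hr =>
    (ENNReal.ofReal_pow hr 2).symm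
  simp only [← ofReal_norm, e _ (norm_nonneg _)]
  rw [← h2.tsum_eq, ENNReal.ofReal_tsum_of_nonneg (fun _ => by positivity) h4]

theorem hsSq_adjoint (A : E →L[ℂ] F) : hsSq (ContinuousLinearMap.adjoint A) = hsSq A := by
  unfold hsSq
  rw [tsum_congr fun i => enorm_sq_eq_tsum (ContinuousLinearMap.adjoint A (onb F i)),
    tsum_congr fun i => enorm_sq_eq_tsum (A (onb E i)), ENNReal.tsum_comm]
  refine tsum_congr fun i => tsum_congr fun j => ?_
  rw [ContinuousLinearMap.adjoint_inner_right]
  rw [← ofReal_norm, ← ofReal_norm, norm_inner_symm]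

theorem hsSq_comp_left (B : F →L[ℂ] G) (A : E →L[ℂ] F) : hsSq (B ∘L A) ≤ ‖B‖ₑ ^ 2 * hsSq A := by
  unfold hsSq
  rw [← ENNReal.tsum_mul_left]
  refine ENNReal.tsum_le_tsum fun i => ?_
  rw [← mul_pow]
  gcongr
  exact B.le_opENorm _

theorem hsSq_comp_right (A : F →L[ℂ] G) (B : E →L[ℂ] F) : hsSq (A ∘L B) ≤ ‖B‖ₑ ^ 2 * hsSq A := by
  rw [← hsSq_adjoint, ContinuousLinearMap.adjoint_comp, ← hsSq_adjoint A]
  refine (hsSq_comp_left _ _).trans (le_of_eq ?_)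
  congr 2
  simp [enorm, nnnorm]

theorem IsHilbertSchmidt.clm_comp {A : E →L[ℂ] F} (hA : IsHilbertSchmidt A) (B : F →L[ℂ] G) :
    IsHilbertSchmidt (B ∘L A) :=
  ne_top_of_le_ne_top (ENNReal.mul_ne_top (by simp) hA) (hsSq_comp_left B A)

theorem IsHilbertSchmidt.comp_clm {A : F →L[ℂ] G} (hA : IsHilbertSchmidt A) (B : E →L[ℂ] F) :
    IsHilbertSchmidt (A ∘L B) :=
  ne_top_of_le_ne_top (ENNReal.mul_ne_top (by simp) hA) (hsSq_comp_right A B)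

theorem hsSq_add_le (A B : E →L[ℂ] F) :
    hsSq (A + B) ^ (1 / 2 : ℝ) ≤ hsSq A ^ (1 / 2 : ℝ) + hsSq B ^ (1 / 2 : ℝ) := by
  refine le_trans ?_ (tsum_minkowski _ _)
  refine ENNReal.rpow_le_rpow (ENNReal.tsum_le_tsum fun i => ?_) (by norm_num)
  gcongr
  exact enorm_add_le _ _

theorem IsHilbertSchmidt.zero : IsHilbertSchmidt (0 : E →L[ℂ] F) := by
  simp [IsHilbertSchmidt, hsSq]

theorem IsHilbertSchmidt.add {A B : E →L[ℂ] F} (hA : IsHilbertSchmidt A)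
    (hB : IsHilbertSchmidt B) : IsHilbertSchmidt (A + B) := by
  intro h
  have h2 := hsSq_add_le A B
  rw [h, ENNReal.top_rpow_of_pos (by norm_num), top_le_iff, ENNReal.add_eq_top] at h2
  rcases h2 with h2 | h2
  · exact ENNReal.rpow_ne_top_of_nonneg (by norm_num) hA h2
  · exact ENNReal.rpow_ne_top_of_nonneg (by norm_num) hB h2

theorem IsHilbertSchmidt.smul {A : E →L[ℂ] F} (c : ℂ) (hA : IsHilbertSchmidt A) :
    IsHilbertSchmidt (c • A) := by
  have h := hA.clm_comp (c • ContinuousLinearMap.id ℂ F)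
  rwa [ContinuousLinearMap.smul_comp, ContinuousLinearMap.id_comp] at h

theorem IsHilbertSchmidt.sub {A B : E →L[ℂ] F} (hA : IsHilbertSchmidt A)
    (hB : IsHilbertSchmidt B) : IsHilbertSchmidt (A - B) := by
  have h := hA.add (hB.smul (-1))
  rwa [neg_one_smul, ← sub_eq_add_neg] at h

theorem hsNorm_nonneg (A : E →L[ℂ] F) : 0 ≤ hsNorm A := Real.sqrt_nonneg _

theorem hsNorm_zero : hsNorm (0 : E →L[ℂ] F) = 0 := by simp [hsNorm, hsSq]

theorem hsNorm_add_le {A B : E →L[ℂ] F} (hA : IsHilbertSchmidt A) (hB : IsHilbertSchmidt B) :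
    hsNorm (A + B) ≤ hsNorm A + hsNorm B := by
  have h := ENNReal.toReal_mono (ENNReal.add_ne_top.2
    ⟨ENNReal.rpow_ne_top_of_nonneg (by norm_num) hA,
      ENNReal.rpow_ne_top_of_nonneg (by norm_num) hB⟩) (hsSq_add_le A B)
  rw [ENNReal.toReal_add (ENNReal.rpow_ne_top_of_nonneg (by norm_num) hA)
    (ENNReal.rpow_ne_top_of_nonneg (by norm_num) hB)] at h
  simpa only [hsNorm, Real.sqrt_eq_rpow, ENNReal.toReal_rpow] using h

theorem hsNorm_smul (c : ℂ) (A : E →L[ℂ] F) : hsNorm (c • A) = ‖c‖ * hsNorm A := by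
  have : hsSq (c • A) = ‖c‖ₑ ^ 2 * hsSq A := by
    simp only [hsSq, ← ENNReal.tsum_mul_left, _root_.smul_apply, enorm_smul, mul_pow]
  simp [hsNorm, this, ENNReal.toReal_mul]

theorem eq_zero_of_hsSq {A : E →L[ℂ] F} (h : hsSq A = 0) : A = 0 := by
  rw [hsSq, ENNReal.tsum_eq_zero] at h
  have h1 : ∀ i, A (onb E i) = 0 := fun i => by simpa using h i
  have hd := (onb E).dense_span
  refine ContinuousLinearMap.ext_on (s := Set.range (onb E)) ?_ ?_
  · exact (Submodule.dense_iff_topologicalClosure_eq_top).2 hd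
  · rintro _ ⟨i, rfl⟩
    simp [h1]

theorem eq_zero_of_hsNorm {A : E →L[ℂ] F} (hA : IsHilbertSchmidt A) (h : hsNorm A = 0) :
    A = 0 := by
  apply eq_zero_of_hsSq
  rw [hsNorm, Real.sqrt_eq_zero ENNReal.toReal_nonneg, ENNReal.toReal_eq_zero_iff] at h
  exact h.resolve_right hA

/-- Factorization through an operator that dominates pointwise. -/
theorem exists_factor (S : E →L[ℂ] F) (T : E →L[ℂ] G) (h : ∀ x, ‖T x‖ ≤ ‖S x‖) :
    ∃ U : F →L[ℂ] G, ‖U‖ₑ ≤ 1 ∧ T = U ∘L S := by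
  let R := S.range.topologicalClosure
  let e : E →ₗ[ℂ] R := S.toLinearMap.codRestrict R
    (fun x => S.range.le_topologicalClosure ⟨x, rfl⟩)
  have he : DenseRange e := by
    intro y
    rw [Metric.mem_closure_iff]
    intro ε hε
    obtain ⟨z, ⟨x, rfl⟩, hz⟩ := Metric.mem_closure_iff.1 y.2 ε hε
    exact ⟨e x, ⟨x, rfl⟩, hz⟩
  have hn : ∃ C, ∀ x, ‖T.toLinearMap x‖ ≤ C * ‖e x‖ := ⟨1, fun x => by simpa [e] using h x⟩
  let U₀ : R →L[ℂ] G := T.toLinearMap.extendOfNorm e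
  have hU₀ : ∀ x, U₀ (e x) = T x := fun x => LinearMap.extendOfNorm_eq he hn x
  have hUn : ‖U₀‖ ≤ 1 := by
    refine LinearMap.opNorm_extendOfNorm_le he zero_le_one fun x => by simpa [e] using h x
  have : CompleteSpace R := S.range.isClosed_topologicalClosure.completeSpace_coe
  refine ⟨U₀ ∘L R.orthogonalProjectionOnto, ?_, ?_⟩
  · have h1 : ‖U₀ ∘L R.orthogonalProjectionOnto‖ ≤ 1 * 1 :=
      (ContinuousLinearMap.opNorm_comp_le _ _).trans
        (mul_le_mul hUn R.orthogonalProjectionOnto_norm_le (norm_nonneg _) zero_le_one)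
    rw [← ofReal_norm, ← ENNReal.ofReal_one]
    exact ENNReal.ofReal_le_ofReal (by simpa using h1)
  · ext x
    have h2 : R.orthogonalProjectionOnto (S x) = e x :=
      Submodule.orthogonalProjectionOnto_mem_subspace_eq_self (e x)
    simp [h2, hU₀]

theorem norm_abs_apply (A : E →L[ℂ] E) (x : E) : ‖CFC.abs A x‖ = ‖A x‖ := by
  have h1 : CFC.abs A * CFC.abs A = star A * A := CFC.abs_mul_abs A
  have hs : IsSelfAdjoint (CFC.abs A) := (CFC.abs_nonneg A).isSelfAdjoint
  have key : ∀ B : E →L[ℂ] E, ⟪x, (star B * B) x⟫_ℂ = ((‖B x‖ ^ 2 : ℝ) : ℂ) := fun B => by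
    rw [mul_apply_eq_comp, ContinuousLinearMap.star_eq_adjoint,
      ContinuousLinearMap.adjoint_inner_right, inner_self_eq_norm_sq_to_K]
    simp
  have h2 := key (CFC.abs A)
  rw [hs.star_eq, h1, key A] at h2
  have h3 : ‖A x‖ ^ 2 = ‖CFC.abs A x‖ ^ 2 := by exact_mod_cast h2
  exact ((sq_eq_sq₀ (norm_nonneg _) (norm_nonneg _)).1 h3).symm

/-- `|A|^{1/2}`. -/
def sqrtAbs (A : E →L[ℂ] E) : E →L[ℂ] E := CFC.sqrt (CFC.abs A)

theorem sqrtAbs_mul_self (A : E →L[ℂ] E) : sqrtAbs A * sqrtAbs A = CFC.abs A :=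
  CFC.sqrt_mul_sqrt_self _ (CFC.abs_nonneg A)

theorem adjoint_sqrtAbs (A : E →L[ℂ] E) :
    ContinuousLinearMap.adjoint (sqrtAbs A) = sqrtAbs A :=
  ((CFC.sqrt_nonneg (CFC.abs A)).isSelfAdjoint).star_eq

theorem ofReal_inner_abs (A : E →L[ℂ] E) (x : E) :
    ENNReal.ofReal (RCLike.re ⟪x, CFC.abs A x⟫_ℂ) = ‖sqrtAbs A x‖ₑ ^ 2 := by
  rw [← sqrtAbs_mul_self, mul_apply_eq_comp, ← ContinuousLinearMap.adjoint_inner_left,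
    adjoint_sqrtAbs, inner_self_eq_norm_sq, ENNReal.ofReal_pow (norm_nonneg _),
    ofReal_norm]

theorem traceAbs_eq_hsSq (A : E →L[ℂ] E) : traceAbs A = hsSq (sqrtAbs A) :=
  tsum_congr fun _ => ofReal_inner_abs A _

/-- `|A| = W A` with `‖W‖ ≤ 1`. -/
theorem exists_abs_eq (A : E →L[ℂ] E) : ∃ W : E →L[ℂ] E, ‖W‖ₑ ≤ 1 ∧ CFC.abs A = W ∘L A :=
  exists_factor A (CFC.abs A) fun x => (norm_abs_apply A x).le

/-- `A = U |A|` with `‖U‖ ≤ 1`. -/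
theorem exists_eq_abs (A : E →L[ℂ] E) : ∃ U : E →L[ℂ] E, ‖U‖ₑ ≤ 1 ∧ A = U ∘L CFC.abs A :=
  exists_factor (CFC.abs A) A fun x => (norm_abs_apply A x).ge

theorem enorm_adjoint (A : E →L[ℂ] F) : ‖ContinuousLinearMap.adjoint A‖ₑ = ‖A‖ₑ := by
  simp [enorm, nnnorm]

theorem tsum_inner_hs (A B : E →L[ℂ] F) :
    ∑' i, ‖⟪A (onb E i), B (onb E i)⟫_ℂ‖ₑ ≤ hsSq A ^ (1 / 2 : ℝ) * hsSq B ^ (1 / 2 : ℝ) := by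
  refine le_trans (ENNReal.tsum_le_tsum fun i => ?_) (tsum_cauchySchwarz _ _)
  have := ENNReal.ofReal_le_ofReal (norm_inner_le_norm (𝕜 := ℂ) (A (onb E i)) (B (onb E i)))
  rwa [ENNReal.ofReal_mul (norm_nonneg _), ofReal_norm, ofReal_norm,
    ofReal_norm] at this

theorem tsum_inner_le_traceAbs (A : E →L[ℂ] E) (C : E →L[ℂ] F) (D : F →L[ℂ] E) :
    ∑' i, ‖⟪onb F i, C (A (D (onb F i)))⟫_ℂ‖ₑ ≤ ‖C‖ₑ * ‖D‖ₑ * traceAbs A := by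
  obtain ⟨U, hU, hA⟩ := exists_eq_abs A
  set S := sqrtAbs A with hS
  let P : F →L[ℂ] E := S ∘L (ContinuousLinearMap.adjoint (C ∘L U))
  let Q : F →L[ℂ] E := S ∘L D
  have e : ∀ x, ⟪x, C (A (D x))⟫_ℂ = ⟪P x, Q x⟫_ℂ := fun x => by
    have h1 : A (D x) = U (S (S (D x))) := by
      conv_lhs => rw [hA]
      rw [ContinuousLinearMap.comp_apply, ← sqrtAbs_mul_self]; rfl
    rw [h1]
    simp only [P, Q, ContinuousLinearMap.comp_apply]
    rw [← ContinuousLinearMap.adjoint_inner_right S, adjoint_sqrtAbs,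
      ContinuousLinearMap.adjoint_inner_left]
    rfl
  simp only [e]
  refine (tsum_inner_hs P Q).trans ?_
  have hP : hsSq P ≤ ‖C‖ₑ ^ 2 * hsSq S := by
    refine (hsSq_comp_right _ _).trans ?_
    rw [enorm_adjoint]
    gcongr
    refine (ContinuousLinearMap.opENorm_comp_le C U).trans ?_
    exact mul_le_of_le_one_right' hU
  have hQ : hsSq Q ≤ ‖D‖ₑ ^ 2 * hsSq S := hsSq_comp_right _ _
  have sq : ∀ x : ℝ≥0∞, (x ^ 2) ^ (1 / 2 : ℝ) = x := fun x => by
    rw [← ENNReal.rpow_natCast, ← ENNReal.rpow_mul]; norm_num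
  calc hsSq P ^ (1 / 2 : ℝ) * hsSq Q ^ (1 / 2 : ℝ)
      ≤ (‖C‖ₑ ^ 2 * hsSq S) ^ (1 / 2 : ℝ) * (‖D‖ₑ ^ 2 * hsSq S) ^ (1 / 2 : ℝ) := by gcongr
    _ = ‖C‖ₑ * ‖D‖ₑ * traceAbs A := by
        rw [ENNReal.mul_rpow_of_nonneg _ _ (by norm_num), ENNReal.mul_rpow_of_nonneg _ _
          (by norm_num), sq, sq, traceAbs_eq_hsSq, mul_mul_mul_comm,
          ← ENNReal.mul_rpow_of_nonneg _ _ (by norm_num), ← pow_two, sq]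

theorem traceAbs_le_tsum (A W : E →L[ℂ] E) (h : CFC.abs A = W ∘L A) :
    traceAbs A ≤ ∑' i, ‖⟪onb E i, W (A (onb E i))⟫_ℂ‖ₑ := by
  refine ENNReal.tsum_le_tsum fun i => ?_
  rw [h, ← ofReal_norm]
  exact ENNReal.ofReal_le_ofReal (Complex.re_le_norm _)

theorem traceAbs_add_le (A B : E →L[ℂ] E) : traceAbs (A + B) ≤ traceAbs A + traceAbs B := by
  obtain ⟨W, hW, h⟩ := exists_abs_eq (A + B)
  refine (traceAbs_le_tsum _ W h).trans ?_
  have hA := tsum_inner_le_traceAbs A W (ContinuousLinearMap.id ℂ E)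
  have hB := tsum_inner_le_traceAbs B W (ContinuousLinearMap.id ℂ E)
  have h1 : ‖W‖ₑ * ‖ContinuousLinearMap.id ℂ E‖ₑ ≤ 1 := by
    refine mul_le_one' hW ?_
    rw [← ofReal_norm, ← ENNReal.ofReal_one]
    exact ENNReal.ofReal_le_ofReal ContinuousLinearMap.norm_id_le
  calc ∑' i, ‖⟪onb E i, W ((A + B) (onb E i))⟫_ℂ‖ₑ
      ≤ ∑' i, (‖⟪onb E i, W (A (onb E i))⟫_ℂ‖ₑ + ‖⟪onb E i, W (B (onb E i))⟫_ℂ‖ₑ) := by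
        refine ENNReal.tsum_le_tsum fun i => ?_
        rw [_root_.add_apply, map_add, inner_add_right]
        exact enorm_add_le _ _
    _ ≤ traceAbs A + traceAbs B := by
        rw [ENNReal.tsum_add]
        gcongr
        · exact hA.trans (mul_le_of_le_one_left' h1)
        · exact hB.trans (mul_le_of_le_one_left' h1)

theorem traceAbs_comp_le (C : E →L[ℂ] F) (A : E →L[ℂ] E) (D : F →L[ℂ] E) :
    traceAbs (C ∘L A ∘L D) ≤ ‖C‖ₑ * ‖D‖ₑ * traceAbs A := by
  obtain ⟨W, hW, h⟩ := exists_abs_eq (C ∘L A ∘L D)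
  refine (traceAbs_le_tsum _ W h).trans ?_
  refine (tsum_inner_le_traceAbs A (W ∘L C) D).trans ?_
  gcongr
  exact (ContinuousLinearMap.opENorm_comp_le W C).trans (mul_le_of_le_one_left' hW)

/-- The product of two Hilbert-Schmidt operators is trace class. -/
theorem IsHilbertSchmidt.comp {A : F →L[ℂ] E} {B : E →L[ℂ] F} (hA : IsHilbertSchmidt A)
    (hB : IsHilbertSchmidt B) : IsTraceClass (A ∘L B) := by
  obtain ⟨W, hW, h⟩ := exists_abs_eq (A ∘L B)
  refine ne_top_of_le_ne_top ?_ (traceAbs_le_tsum _ W h)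
  have e : ∀ x, ⟪x, W ((A ∘L B) x)⟫_ℂ = ⟪ContinuousLinearMap.adjoint (W ∘L A) x, B x⟫_ℂ :=
    fun x => by rw [ContinuousLinearMap.adjoint_inner_left]; rfl
  simp only [e]
  refine ne_top_of_le_ne_top ?_ (tsum_inner_hs _ _)
  refine ENNReal.mul_ne_top ?_ (ENNReal.rpow_ne_top_of_nonneg (by norm_num) hB)
  rw [hsSq_adjoint]
  exact ENNReal.rpow_ne_top_of_nonneg (by norm_num) (hA.clm_comp W)

theorem IsTraceClass.clm_comp {A : E →L[ℂ] E} (hA : IsTraceClass A) (C : E →L[ℂ] E) :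
    IsTraceClass (C ∘L A) :=
  ne_top_of_le_ne_top (ENNReal.mul_ne_top (by simp [ENNReal.mul_eq_top]) hA)
    (traceAbs_comp_le C A (ContinuousLinearMap.id ℂ E))

theorem IsTraceClass.comp_clm {A : E →L[ℂ] E} (hA : IsTraceClass A) (C : E →L[ℂ] E) :
    IsTraceClass (A ∘L C) :=
  ne_top_of_le_ne_top (ENNReal.mul_ne_top (by simp [ENNReal.mul_eq_top]) hA)
    (traceAbs_comp_le (ContinuousLinearMap.id ℂ E) A C)

theorem traceAbs_smul_le (c : ℂ) (A : E →L[ℂ] E) : traceAbs (c • A) ≤ ‖c‖ₑ * traceAbs A := by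
  obtain ⟨W, hW, h⟩ := exists_abs_eq (c • A)
  refine (traceAbs_le_tsum _ W h).trans ?_
  have h1 := tsum_inner_le_traceAbs A W (ContinuousLinearMap.id ℂ E)
  have h2 : ‖W‖ₑ * ‖ContinuousLinearMap.id ℂ E‖ₑ ≤ 1 := by
    refine mul_le_one' hW ?_
    rw [← ofReal_norm, ← ENNReal.ofReal_one]
    exact ENNReal.ofReal_le_ofReal ContinuousLinearMap.norm_id_le
  have h3 := h1.trans (mul_le_of_le_one_left' h2)
  simp only [_root_.smul_apply, map_smul, inner_smul_right, enorm_mul,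
    ENNReal.tsum_mul_left]
  gcongr
  exact h3

theorem traceAbs_zero : traceAbs (0 : E →L[ℂ] E) = 0 := by
  simpa using traceAbs_smul_le (0 : ℂ) (0 : E →L[ℂ] E)

theorem IsTraceClass.zero : IsTraceClass (0 : E →L[ℂ] E) := by
  simp [IsTraceClass, traceAbs_zero]

theorem IsTraceClass.add {A B : E →L[ℂ] E} (hA : IsTraceClass A) (hB : IsTraceClass B) :
    IsTraceClass (A + B) :=
  ne_top_of_le_ne_top (ENNReal.add_ne_top.2 ⟨hA, hB⟩) (traceAbs_add_le A B)

theorem IsTraceClass.smul {A : E →L[ℂ] E} (c : ℂ) (hA : IsTraceClass A) :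
    IsTraceClass (c • A) :=
  ne_top_of_le_ne_top (ENNReal.mul_ne_top (by simp) hA) (traceAbs_smul_le c A)

theorem IsTraceClass.sub {A B : E →L[ℂ] E} (hA : IsTraceClass A) (hB : IsTraceClass B) :
    IsTraceClass (A - B) := by
  have h := hA.add (hB.smul (-1))
  rwa [neg_one_smul, ← sub_eq_add_neg] at h

theorem traceNorm_nonneg (A : E →L[ℂ] E) : 0 ≤ traceNorm A := ENNReal.toReal_nonneg

theorem traceNorm_zero : traceNorm (0 : E →L[ℂ] E) = 0 := by simp [traceNorm, traceAbs_zero]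

theorem traceNorm_add_le {A B : E →L[ℂ] E} (hA : IsTraceClass A) (hB : IsTraceClass B) :
    traceNorm (A + B) ≤ traceNorm A + traceNorm B := by
  rw [traceNorm, traceNorm, traceNorm, ← ENNReal.toReal_add hA hB]
  exact ENNReal.toReal_mono (ENNReal.add_ne_top.2 ⟨hA, hB⟩) (traceAbs_add_le A B)

theorem traceNorm_smul_le {A : E →L[ℂ] E} (c : ℂ) (hA : IsTraceClass A) :
    traceNorm (c • A) ≤ ‖c‖ * traceNorm A := by
  have h := ENNReal.toReal_mono (ENNReal.mul_ne_top (by simp) hA) (traceAbs_smul_le c A)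
  simpa [ENNReal.toReal_mul, traceNorm] using h

theorem traceNorm_neg {A : E →L[ℂ] E} (hA : IsTraceClass A) : traceNorm (-A) = traceNorm A := by
  have h1 := traceNorm_smul_le (-1) hA
  have h2 := traceNorm_smul_le (-1) (hA.smul (-1))
  simp only [neg_one_smul, neg_neg, norm_neg, norm_one, one_mul] at h1 h2
  exact le_antisymm h1 h2

theorem eq_zero_of_traceNorm {A : E →L[ℂ] E} (hA : IsTraceClass A) (h : traceNorm A = 0) :
    A = 0 := by
  rw [traceNorm, ENNReal.toReal_eq_zero_iff] at h
  have h1 := h.resolve_right hA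
  rw [traceAbs_eq_hsSq] at h1
  have h2 := sqrtAbs_mul_self A
  rw [eq_zero_of_hsSq h1, zero_mul] at h2
  ext x
  have h3 := norm_abs_apply A x
  rw [← h2] at h3
  simpa using h3.symm

/-- The series defining the trace of a trace class operator converges absolutely. -/
theorem IsTraceClass.summable_inner {A : E →L[ℂ] E} (hA : IsTraceClass A) :
    Summable fun i => ‖⟪onb E i, A (onb E i)⟫_ℂ‖ := by
  have h := tsum_inner_le_traceAbs A (ContinuousLinearMap.id ℂ E) (ContinuousLinearMap.id ℂ E)
  have h2 := ne_top_of_le_ne_top (ENNReal.mul_ne_top (by simp [ENNReal.mul_eq_top]) hA) h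
  have h3 := ENNReal.summable_toReal h2
  simpa using h3

end OperatorIdeals

section TraceClassSpace

variable {E : Type*} [NormedAddCommGroup E] [InnerProductSpace ℂ E] [CompleteSpace E]

variable (E) in
/-- The linear space of trace class operators on `E`. -/
def traceClassSubmodule : Submodule ℂ (E →L[ℂ] E) where
  carrier := {A | IsTraceClass A}
  zero_mem' := IsTraceClass.zero
  add_mem' := fun hA hB => IsTraceClass.add hA hB
  smul_mem' := fun c _ hA => IsTraceClass.smul c hA

variable (E) in
/-- `L¹(E)`: the trace class operators on `E`, normed by the trace norm (not by the operator
norm). -/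
def TraceClassOp : Type _ := traceClassSubmodule E

namespace TraceClassOp

instance : AddCommGroup (TraceClassOp E) := inferInstanceAs (AddCommGroup (traceClassSubmodule E))

instance : Module ℂ (TraceClassOp E) := inferInstanceAs (Module ℂ (traceClassSubmodule E))

/-- The underlying bounded operator. -/
def op : TraceClassOp E →ₗ[ℂ] (E →L[ℂ] E) := (traceClassSubmodule E).subtype

theorem op_injective : Function.Injective (op : TraceClassOp E → (E →L[ℂ] E)) :=
  Subtype.val_injective

theorem isTraceClass (ρ : TraceClassOp E) : IsTraceClass ρ.op := ρ.2

/-- A trace class operator as an element of `L¹(E)`. -/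
def mk (A : E →L[ℂ] E) (hA : IsTraceClass A) : TraceClassOp E := ⟨A, hA⟩

@[simp] theorem op_mk (A : E →L[ℂ] E) (hA : IsTraceClass A) : (mk A hA).op = A := rfl

instance : NormedAddCommGroup (TraceClassOp E) :=
  AddGroupNorm.toNormedAddCommGroup
    { toFun := fun ρ => traceNorm ρ.op
      map_zero' := by simp [traceNorm_zero]
      add_le' := fun ρ ρ' => by
        simpa only [map_add] using traceNorm_add_le ρ.isTraceClass ρ'.isTraceClass
      neg' := fun ρ => by simpa only [map_neg] using traceNorm_neg ρ.isTraceClass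
      eq_zero_of_map_eq_zero' := fun ρ h => op_injective (by
        rw [map_zero]; exact eq_zero_of_traceNorm ρ.isTraceClass h) }

theorem norm_def (ρ : TraceClassOp E) : ‖ρ‖ = traceNorm ρ.op := rfl

instance : NormedSpace ℂ (TraceClassOp E) where
  norm_smul_le c ρ := by
    simpa only [norm_def, map_smul] using traceNorm_smul_le c ρ.isTraceClass

end TraceClassOp

end TraceClassSpace

section CompactSpace

variable {E : Type*} [NormedAddCommGroup E] [InnerProductSpace ℂ E]

variable (E) in
/-- `𝒦(E)`: the compact operators on `E`, with the operator norm. -/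
def CompactOp : Type _ := compactOperator (RingHom.id ℂ) E E

namespace CompactOp

instance : NormedAddCommGroup (CompactOp E) :=
  inferInstanceAs (NormedAddCommGroup (compactOperator (RingHom.id ℂ) E E))

instance : NormedSpace ℂ (CompactOp E) :=
  inferInstanceAs (NormedSpace ℂ (compactOperator (RingHom.id ℂ) E E))

/-- The underlying bounded operator. -/
def op : CompactOp E →ₗ[ℂ] (E →L[ℂ] E) := (compactOperator (RingHom.id ℂ) E E).subtype

theorem norm_def (ϰ : CompactOp E) : ‖ϰ‖ = ‖ϰ.op‖ := rfl

end CompactOp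

end CompactSpace

section Polarization

variable {H : Type*} [NormedAddCommGroup H] [InnerProductSpace ℂ H] [CompleteSpace H]

/-- A closed subspace of `H`, regarded as a Hilbert space in its own right. -/
def HilbertSub (U : Submodule ℂ H) : Type _ := U

namespace HilbertSub

instance (U : Submodule ℂ H) : NormedAddCommGroup (HilbertSub U) :=
  inferInstanceAs (NormedAddCommGroup U)

instance (U : Submodule ℂ H) : InnerProductSpace ℂ (HilbertSub U) :=
  inferInstanceAs (InnerProductSpace ℂ U)

instance (U : Submodule ℂ H) [CompleteSpace U] : CompleteSpace (HilbertSub U) :=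
  inferInstanceAs (CompleteSpace U)

/-- The inclusion of `U` in `H`. -/
def incl (U : Submodule ℂ H) : HilbertSub U →L[ℂ] H := U.subtypeL

/-- The orthogonal projection `P_U` of `H` onto `U`. -/
def proj (U : Submodule ℂ H) [U.HasOrthogonalProjection] : H →L[ℂ] HilbertSub U :=
  U.orthogonalProjectionOnto

theorem incl_proj_add (K : Submodule ℂ H) [CompleteSpace K] (w : H) :
    incl K (proj K w) + incl Kᗮ (proj Kᗮ w) = w :=
  K.starProjection_add_starProjection_orthogonal w

end HilbertSub

/-- The block `P_U X P_V`, regarded as an operator from `V` to `U`. -/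
def block (U V : Submodule ℂ H) [U.HasOrthogonalProjection] (X : H →L[ℂ] H) :
    HilbertSub V →L[ℂ] HilbertSub U :=
  HilbertSub.proj U ∘L X ∘L HilbertSub.incl V

/-- An operator from `V` to `U`, regarded as an operator on `H` that vanishes on `Vᗮ`. -/
def embBlock (U V : Submodule ℂ H) [V.HasOrthogonalProjection]
    (A : HilbertSub V →L[ℂ] HilbertSub U) : H →L[ℂ] H :=
  HilbertSub.incl U ∘L A ∘L HilbertSub.proj V

section BlockLemmas

variable (U V : Submodule ℂ H) [U.HasOrthogonalProjection]

theorem block_zero : block U V (0 : H →L[ℂ] H) = 0 := by ext; simp [block]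

theorem block_add (X Y : H →L[ℂ] H) : block U V (X + Y) = block U V X + block U V Y := by
  ext; simp [block]

theorem block_sub (X Y : H →L[ℂ] H) : block U V (X - Y) = block U V X - block U V Y := by
  ext; simp [block]

theorem block_neg (X : H →L[ℂ] H) : block U V (-X) = -block U V X := by
  ext; simp [block]

theorem block_smul (c : ℂ) (X : H →L[ℂ] H) : block U V (c • X) = c • block U V X := by
  ext; simp [block]

theorem block_mul (K : Submodule ℂ H) [CompleteSpace K] (X Y : H →L[ℂ] H) :
    block U V (X * Y) = block U K X ∘L block K V Y + block U Kᗮ X ∘L block Kᗮ V Y := by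
  ext v
  have h := HilbertSub.incl_proj_add K (Y (HilbertSub.incl V v))
  have h2 : X (Y (HilbertSub.incl V v)) =
      X (HilbertSub.incl K (HilbertSub.proj K (Y (HilbertSub.incl V v)))) +
      X (HilbertSub.incl Kᗮ (HilbertSub.proj Kᗮ (Y (HilbertSub.incl V v)))) := by
    rw [← map_add, h]
  simp [block, h2]

theorem eq_zero_of_blocks (K : Submodule ℂ H) [CompleteSpace K] {X : H →L[ℂ] H}
    (h1 : block K K X = 0) (h2 : block Kᗮ Kᗮ X = 0) (h3 : block K Kᗮ X = 0)
    (h4 : block Kᗮ K X = 0) : X = 0 := by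
  ext v
  have h := HilbertSub.incl_proj_add K
  have e1 := DFunLike.congr_fun h1 (HilbertSub.proj K v)
  have e2 := DFunLike.congr_fun h2 (HilbertSub.proj Kᗮ v)
  have e3 := DFunLike.congr_fun h3 (HilbertSub.proj Kᗮ v)
  have e4 := DFunLike.congr_fun h4 (HilbertSub.proj K v)
  simp only [block, ContinuousLinearMap.comp_apply, _root_.zero_apply] at e1 e2 e3 e4
  have f1 := h (X (HilbertSub.incl K (HilbertSub.proj K v)))
  have f2 := h (X (HilbertSub.incl Kᗮ (HilbertSub.proj Kᗮ v)))
  rw [e1, e4, map_zero, map_zero, add_zero] at f1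
  rw [e2, e3, map_zero, map_zero, add_zero] at f2
  have h5 := congrArg X (h v)
  rw [map_add, ← f1, ← f2, add_zero] at h5
  simpa using h5.symm

end BlockLemmas

variable (K : Submodule ℂ H) [CompleteSpace K]

/-- The linear space of all `X ∈ L^∞(H)` with Hilbert-Schmidt off-diagonal blocks with respect to
`H = K ⊕ Kᗮ`. -/
def restrictedSubmodule : Submodule ℂ (H →L[ℂ] H) where
  carrier := {X | IsHilbertSchmidt (block K Kᗮ X) ∧ IsHilbertSchmidt (block Kᗮ K X)}
  zero_mem' := by simp [block_zero, IsHilbertSchmidt.zero]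
  add_mem' := fun hX hY => by
    simp only [Set.mem_ofPred_eq, block_add]
    exact ⟨hX.1.add hY.1, hX.2.add hY.2⟩
  smul_mem' := fun c _ hX => by
    simp only [Set.mem_ofPred_eq, block_smul]
    exact ⟨hX.1.smul c, hX.2.smul c⟩

/-- The restricted algebra `𝔥 = L^∞(H, H₊)`, where `H₊ = K` and `H₋ = Kᗮ`, with the norm
`‖X‖ = ‖P₊XP₊‖_∞ + ‖P₋XP₋‖_∞ + ‖P₊XP₋‖₂ + ‖P₋XP₊‖₂`. -/
def RestrictedLie : Type _ := restrictedSubmodule K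

namespace RestrictedLie

instance : AddCommGroup (RestrictedLie K) := inferInstanceAs (AddCommGroup (restrictedSubmodule K))

instance : Module ℂ (RestrictedLie K) := inferInstanceAs (Module ℂ (restrictedSubmodule K))

variable {K}

/-- The underlying bounded operator. -/
def op : RestrictedLie K →ₗ[ℂ] (H →L[ℂ] H) := (restrictedSubmodule K).subtype

theorem op_injective : Function.Injective (op : RestrictedLie K → (H →L[ℂ] H)) :=
  Subtype.val_injective

theorem hs_pm (X : RestrictedLie K) : IsHilbertSchmidt (block K Kᗮ X.op) := X.2.1

theorem hs_mp (X : RestrictedLie K) : IsHilbertSchmidt (block Kᗮ K X.op) := X.2.2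

instance : NormedAddCommGroup (RestrictedLie K) :=
  AddGroupNorm.toNormedAddCommGroup
    { toFun := fun X => ‖block K K X.op‖ + ‖block Kᗮ Kᗮ X.op‖ + hsNorm (block K Kᗮ X.op) +
        hsNorm (block Kᗮ K X.op)
      map_zero' := by
        have h1 : ‖(0 : HilbertSub K →L[ℂ] HilbertSub K)‖ = 0 := norm_zero
        have h2 : ‖(0 : HilbertSub Kᗮ →L[ℂ] HilbertSub Kᗮ)‖ = 0 := norm_zero
        simp only [map_zero, block_zero, hsNorm_zero, h1, h2, add_zero]
      add_le' := fun X Y => by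
        simp only [map_add, block_add]
        linarith [norm_add_le (block K K X.op) (block K K Y.op),
          norm_add_le (block Kᗮ Kᗮ X.op) (block Kᗮ Kᗮ Y.op),
          hsNorm_add_le X.hs_pm Y.hs_pm, hsNorm_add_le X.hs_mp Y.hs_mp]
      neg' := fun X => by
        have h : ∀ (A : HilbertSub Kᗮ →L[ℂ] HilbertSub K), hsNorm (-A) = hsNorm A := fun A => by
          simpa using hsNorm_smul (-1) A
        have h' : ∀ (A : HilbertSub K →L[ℂ] HilbertSub Kᗮ), hsNorm (-A) = hsNorm A := fun A => by
          simpa using hsNorm_smul (-1) A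
        have h1 : ‖-block K K X.op‖ = ‖block K K X.op‖ := norm_neg _
        have h2 : ‖-block Kᗮ Kᗮ X.op‖ = ‖block Kᗮ Kᗮ X.op‖ := norm_neg _
        simp only [map_neg, block_neg, h1, h2, h, h']
      eq_zero_of_map_eq_zero' := fun X h => op_injective (by
        have n1 := norm_nonneg (block K K X.op)
        have n2 := norm_nonneg (block Kᗮ Kᗮ X.op)
        have n3 := hsNorm_nonneg (block K Kᗮ X.op)
        have n4 := hsNorm_nonneg (block Kᗮ K X.op)
        have h1 : ‖block K K X.op‖ = 0 := by linarith
        have h2 : ‖block Kᗮ Kᗮ X.op‖ = 0 := by linarith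
        rw [map_zero]
        exact eq_zero_of_blocks K (norm_eq_zero.1 h1) (norm_eq_zero.1 h2)
          (eq_zero_of_hsNorm X.hs_pm (by linarith)) (eq_zero_of_hsNorm X.hs_mp (by linarith))) }

theorem norm_def (X : RestrictedLie K) : ‖X‖ = ‖block K K X.op‖ + ‖block Kᗮ Kᗮ X.op‖ +
    hsNorm (block K Kᗮ X.op) + hsNorm (block Kᗮ K X.op) := rfl

instance : NormedSpace ℂ (RestrictedLie K) where
  norm_smul_le c X := by
    have h1 : ‖c • block K K X.op‖ = ‖c‖ * ‖block K K X.op‖ := norm_smul _ _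
    have h2 : ‖c • block Kᗮ Kᗮ X.op‖ = ‖c‖ * ‖block Kᗮ Kᗮ X.op‖ := norm_smul _ _
    simp only [norm_def, map_smul, block_smul, hsNorm_smul, h1, h2]
    exact le_of_eq (by ring)

theorem mul_mem {X Y : H →L[ℂ] H} (hX : X ∈ restrictedSubmodule K)
    (hY : Y ∈ restrictedSubmodule K) : X * Y ∈ restrictedSubmodule K := by
  refine ⟨?_, ?_⟩
  · rw [block_mul _ _ K]
    exact (hY.1.clm_comp _).add (hX.1.comp_clm _)
  · rw [block_mul _ _ K]
    exact (hX.2.comp_clm _).add (hY.2.clm_comp _)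

/-- The commutator bracket `[X, Y] = XY - YX` of `𝔥`. -/
def bracket (X Y : RestrictedLie K) : RestrictedLie K :=
  ⟨X.op * Y.op - Y.op * X.op,
    (restrictedSubmodule K).sub_mem (mul_mem X.2 Y.2) (mul_mem Y.2 X.2)⟩

end RestrictedLie

/-- The linear space of all `σ ∈ L^∞(H)` with trace class diagonal and Hilbert-Schmidt
off-diagonal blocks with respect to `H = K ⊕ Kᗮ`. -/
def restrictedPredualSubmodule : Submodule ℂ (H →L[ℂ] H) where
  carrier := {σ | IsTraceClass (block K K σ) ∧ IsTraceClass (block Kᗮ Kᗮ σ) ∧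
    IsHilbertSchmidt (block K Kᗮ σ) ∧ IsHilbertSchmidt (block Kᗮ K σ)}
  zero_mem' := by simp [block_zero, IsHilbertSchmidt.zero, IsTraceClass.zero]
  add_mem' := fun hX hY => by
    simp only [Set.mem_ofPred_eq, block_add]
    exact ⟨hX.1.add hY.1, hX.2.1.add hY.2.1, hX.2.2.1.add hY.2.2.1, hX.2.2.2.add hY.2.2.2⟩
  smul_mem' := fun c _ hX => by
    simp only [Set.mem_ofPred_eq, block_smul]
    exact ⟨hX.1.smul c, hX.2.1.smul c, hX.2.2.1.smul c, hX.2.2.2.smul c⟩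

/-- The space `𝔞 = L¹(H, H₊)`, where `H₊ = K` and `H₋ = Kᗮ`, with the norm
`‖σ‖ = ‖P₊σP₊‖₁ + ‖P₋σP₋‖₁ + ‖P₊σP₋‖₂ + ‖P₋σP₊‖₂`. -/
def RestrictedPredual : Type _ := restrictedPredualSubmodule K

namespace RestrictedPredual

instance : AddCommGroup (RestrictedPredual K) :=
  inferInstanceAs (AddCommGroup (restrictedPredualSubmodule K))

instance : Module ℂ (RestrictedPredual K) :=
  inferInstanceAs (Module ℂ (restrictedPredualSubmodule K))

variable {K}

/-- The underlying bounded operator. -/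
def op : RestrictedPredual K →ₗ[ℂ] (H →L[ℂ] H) := (restrictedPredualSubmodule K).subtype

theorem op_injective : Function.Injective (op : RestrictedPredual K → (H →L[ℂ] H)) :=
  Subtype.val_injective

theorem tc_pp (σ : RestrictedPredual K) : IsTraceClass (block K K σ.op) := σ.2.1

theorem tc_mm (σ : RestrictedPredual K) : IsTraceClass (block Kᗮ Kᗮ σ.op) := σ.2.2.1

theorem hs_pm (σ : RestrictedPredual K) : IsHilbertSchmidt (block K Kᗮ σ.op) := σ.2.2.2.1

theorem hs_mp (σ : RestrictedPredual K) : IsHilbertSchmidt (block Kᗮ K σ.op) := σ.2.2.2.2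

instance : NormedAddCommGroup (RestrictedPredual K) :=
  AddGroupNorm.toNormedAddCommGroup
    { toFun := fun σ => traceNorm (block K K σ.op) + traceNorm (block Kᗮ Kᗮ σ.op) +
        hsNorm (block K Kᗮ σ.op) + hsNorm (block Kᗮ K σ.op)
      map_zero' := by simp [block_zero, hsNorm_zero, traceNorm_zero]
      add_le' := fun X Y => by
        simp only [map_add, block_add]
        linarith [traceNorm_add_le X.tc_pp Y.tc_pp, traceNorm_add_le X.tc_mm Y.tc_mm,
          hsNorm_add_le X.hs_pm Y.hs_pm, hsNorm_add_le X.hs_mp Y.hs_mp]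
      neg' := fun X => by
        have h : ∀ (A : HilbertSub Kᗮ →L[ℂ] HilbertSub K), hsNorm (-A) = hsNorm A := fun A => by
          simpa using hsNorm_smul (-1) A
        have h' : ∀ (A : HilbertSub K →L[ℂ] HilbertSub Kᗮ), hsNorm (-A) = hsNorm A := fun A => by
          simpa using hsNorm_smul (-1) A
        simp only [map_neg, block_neg, traceNorm_neg X.tc_pp, traceNorm_neg X.tc_mm, h, h']
      eq_zero_of_map_eq_zero' := fun X h => op_injective (by
        have n1 := traceNorm_nonneg (block K K X.op)
        have n2 := traceNorm_nonneg (block Kᗮ Kᗮ X.op)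
        have n3 := hsNorm_nonneg (block K Kᗮ X.op)
        have n4 := hsNorm_nonneg (block Kᗮ K X.op)
        rw [map_zero]
        exact eq_zero_of_blocks K (eq_zero_of_traceNorm X.tc_pp (by linarith))
          (eq_zero_of_traceNorm X.tc_mm (by linarith))
          (eq_zero_of_hsNorm X.hs_pm (by linarith)) (eq_zero_of_hsNorm X.hs_mp (by linarith))) }

theorem norm_def (σ : RestrictedPredual K) : ‖σ‖ = traceNorm (block K K σ.op) +
    traceNorm (block Kᗮ Kᗮ σ.op) + hsNorm (block K Kᗮ σ.op) + hsNorm (block Kᗮ K σ.op) := rfl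

instance : NormedSpace ℂ (RestrictedPredual K) where
  norm_smul_le c X := by
    simp only [norm_def, map_smul, block_smul, hsNorm_smul]
    linarith [traceNorm_smul_le c X.tc_pp, traceNorm_smul_le c X.tc_mm]

end RestrictedPredual

variable {K}

/-- The bracket of `𝔫 = L¹(H₊)`: the negative `-(ρρ' - ρ'ρ)` of the commutator. -/
def nBracket (ρ ρ' : TraceClassOp (HilbertSub K)) : TraceClassOp (HilbertSub K) :=
  .mk (-(ρ.op ∘L ρ'.op - ρ'.op ∘L ρ.op)) (by
    rw [neg_sub]
    exact (ρ.isTraceClass.clm_comp _).sub (ρ'.isTraceClass.clm_comp _))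

/-- `φ(X) = [P₊XP₊, ·]` (commutator) on `𝔫`. -/
def phi (X : RestrictedLie K) (ρ : TraceClassOp (HilbertSub K)) : TraceClassOp (HilbertSub K) :=
  .mk (block K K X.op ∘L ρ.op - ρ.op ∘L block K K X.op)
    ((ρ.isTraceClass.clm_comp _).sub (ρ.isTraceClass.comp_clm _))

/-- `ω(X, X') = P₊XP₋X'P₊ - P₊X'P₋XP₊`. -/
def omega (X X' : RestrictedLie K) : TraceClassOp (HilbertSub K) :=
  .mk (block K Kᗮ X.op ∘L block Kᗮ K X'.op - block K Kᗮ X'.op ∘L block Kᗮ K X.op)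
    ((X.hs_pm.comp X'.hs_mp).sub (X'.hs_pm.comp X.hs_mp))

/-- The bracket of `𝔤 = 𝔫 ⊕ 𝔥`:
`[(ρ, X), (ρ', X')] = ([ρ, ρ'] + φ(X)ρ' - φ(X')ρ + ω(X, X'), [X, X'])`. -/
def gBracket (ξ ξ' : TraceClassOp (HilbertSub K) × RestrictedLie K) : TraceClassOp (HilbertSub K) × RestrictedLie K :=
  (nBracket ξ.1 ξ'.1 + phi ξ.2 ξ'.1 - phi ξ'.2 ξ.1 + omega ξ.2 ξ'.2,
    RestrictedLie.bracket ξ.2 ξ'.2)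

/-- The pairing `⟨ϰ, ρ⟩ = trace(ϰρ)` between `𝔠 = 𝒦(H₊)` and `𝔫 = L¹(H₊)`. -/
def pairC (ϰ : CompactOp (HilbertSub K)) (ρ : TraceClassOp (HilbertSub K)) : ℂ := opTrace (ϰ.op ∘L ρ.op)

/-- The pairing `⟨σ, X⟩ = trace(σ₊X₊ + σ₋X₋ + σ₊₋X₋₊ + σ₋₊X₊₋)` between `𝔞 = L¹(H, H₊)` and
`𝔥 = L^∞(H, H₊)`; the first and third summand are operators on `H₊`, the others on `H₋`. -/
def pairA (σ : RestrictedPredual K) (X : RestrictedLie K) : ℂ :=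
  opTrace (block K K σ.op ∘L block K K X.op) + opTrace (block Kᗮ Kᗮ σ.op ∘L block Kᗮ Kᗮ X.op) +
    opTrace (block K Kᗮ σ.op ∘L block Kᗮ K X.op) + opTrace (block Kᗮ K σ.op ∘L block K Kᗮ X.op)

end Polarization

section Poisson

variable {B : Type*} [NormedAddCommGroup B] [NormedSpace ℂ B]
variable {B₁ : Type*} [NormedAddCommGroup B₁] [NormedSpace ℂ B₁]
variable {B₂ : Type*} [NormedAddCommGroup B₂] [NormedSpace ℂ B₂]

/-- The operation `br` makes `B` a complex Banach Lie algebra: `B` is complete, and `br` is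
bilinear, continuous, alternating and satisfies the Jacobi identity. -/
structure IsBanachLieAlgebra (br : B → B → B) : Prop where
  complete : CompleteSpace B
  continuous_bilinear : ∃ T : B →L[ℂ] B →L[ℂ] B, ∀ x y, T x y = br x y
  alternating : ∀ x, br x x = 0
  jacobi : ∀ x y z, br (br x y) z + br (br y z) x + br (br z x) y = 0

/-- `0 → B₁ → B → B₂ → 0` is an exact sequence of Banach spaces. -/
structure IsShortExact (i : B₁ →L[ℂ] B) (p : B →L[ℂ] B₂) : Prop where
  injective : Function.Injective i
  exact : Function.Exact i p
  surjective : Function.Surjective p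

/-- `B`, with bracket `br`, is an extension of the Banach Lie algebra `B₂` by the Banach Lie algebra
`B₁` through the sequence `0 → B₁ → B → B₂ → 0`: the sequence is exact and consists of
continuous homomorphisms of Banach Lie algebras. -/
structure IsBanachLieExtension (br₁ : B₁ → B₁ → B₁) (br : B → B → B) (br₂ : B₂ → B₂ → B₂)
    (i : B₁ →L[ℂ] B) (p : B →L[ℂ] B₂) : Prop where
  lie₁ : IsBanachLieAlgebra br₁
  lie : IsBanachLieAlgebra br
  lie₂ : IsBanachLieAlgebra br₂
  shortExact : IsShortExact i p
  map_i : ∀ x y, i (br₁ x y) = br (i x) (i y)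
  map_p : ∀ x y, p (br x y) = br₂ (p x) (p y)

/-- The vector field `X` is the Hamiltonian vector field `X_h = {·, h}` of `h`, that is, it is
smooth and `{f, h} = Df(X)` for all smooth `f`. -/
def IsHamiltonianVectorField (PB : (B → ℂ) → (B → ℂ) → B → ℂ) (h : B → ℂ) (X : B → B) : Prop :=
  ContDiff ℂ ∞ X ∧ ∀ f : B → ℂ, ContDiff ℂ ∞ f → ∀ x, PB f h x = fderiv ℂ f x (X x)

/-- The operation `PB` on smooth functions makes the complex Banach space `B` a Banach Poisson
manifold. (Its values on functions that are not smooth are irrelevant.) -/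
structure IsBanachPoisson (PB : (B → ℂ) → (B → ℂ) → B → ℂ) : Prop where
  smooth : ∀ f g, ContDiff ℂ ∞ f → ContDiff ℂ ∞ g → ContDiff ℂ ∞ (PB f g)
  add_left : ∀ f g h, ContDiff ℂ ∞ f → ContDiff ℂ ∞ g → ContDiff ℂ ∞ h →
    PB (f + g) h = PB f h + PB g h
  smul_left : ∀ (c : ℂ) f g, ContDiff ℂ ∞ f → ContDiff ℂ ∞ g → PB (c • f) g = c • PB f g
  skew : ∀ f g, ContDiff ℂ ∞ f → ContDiff ℂ ∞ g → PB f g = -PB g f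
  jacobi : ∀ f g h, ContDiff ℂ ∞ f → ContDiff ℂ ∞ g → ContDiff ℂ ∞ h →
    PB (PB f g) h + PB (PB g h) f + PB (PB h f) g = 0
  leibniz : ∀ f g h, ContDiff ℂ ∞ f → ContDiff ℂ ∞ g → ContDiff ℂ ∞ h →
    PB (f * g) h = f * PB g h + PB f h * g
  hamiltonian : ∀ h, ContDiff ℂ ∞ h → ∃ X : B → B, IsHamiltonianVectorField PB h X

/-- `(B, PB)` is a Banach Lie-Poisson space: a Banach space and Banach Poisson manifold whose
dual space is closed under the Poisson bracket, and a Banach Lie algebra with respect to it. -/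
structure IsBanachLiePoisson (PB : (B → ℂ) → (B → ℂ) → B → ℂ) : Prop where
  complete : CompleteSpace B
  poisson : IsBanachPoisson PB
  dual : ∃ br : (B →L[ℂ] ℂ) → (B →L[ℂ] ℂ) → (B →L[ℂ] ℂ),
    IsBanachLieAlgebra br ∧ ∀ l m : B →L[ℂ] ℂ, PB l m = br l m

/-- The continuous linear map `L` is a linear Poisson map. -/
def IsLinearPoissonMap (PB₁ : (B₁ → ℂ) → (B₁ → ℂ) → B₁ → ℂ)
    (PB₂ : (B₂ → ℂ) → (B₂ → ℂ) → B₂ → ℂ) (L : B₁ →L[ℂ] B₂) : Prop :=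
  ∀ f g : B₂ → ℂ, ContDiff ℂ ∞ f → ContDiff ℂ ∞ g → PB₁ (f ∘ L) (g ∘ L) = PB₂ f g ∘ L

/-- `B`, with bracket `PB`, is an extension of the Banach Lie-Poisson space `B₂` by the Banach
Lie-Poisson space `B₁` through the sequence `0 → B₁ → B → B₂ → 0`: the sequence is exact and
consists of linear Poisson maps. -/
structure IsBanachLiePoissonExtension (PB₁ : (B₁ → ℂ) → (B₁ → ℂ) → B₁ → ℂ)
    (PB : (B → ℂ) → (B → ℂ) → B → ℂ) (PB₂ : (B₂ → ℂ) → (B₂ → ℂ) → B₂ → ℂ)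
    (j : B₁ →L[ℂ] B) (p : B →L[ℂ] B₂) : Prop where
  lp₁ : IsBanachLiePoisson PB₁
  lp : IsBanachLiePoisson PB
  lp₂ : IsBanachLiePoisson PB₂
  shortExact : IsShortExact j p
  map_j : IsLinearPoissonMap PB₁ PB j
  map_p : IsLinearPoissonMap PB PB₂ p

variable {L : Type*} [NormedAddCommGroup L] [NormedSpace ℂ L]

/-- `B` is a predual of `L` with respect to `pair`: the map `ξ ↦ pair (·) ξ` is an isomorphism of
Banach spaces from `L` onto the dual of `B`. -/
def IsPredual (pair : B → L → ℂ) : Prop :=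
  ∃ e : L ≃L[ℂ] (B →L[ℂ] ℂ), ∀ ξ x, e ξ x = pair x ξ

/-- The functional derivative `δf/δx ∈ L` of `f` at `x`: the element of `L` that represents the
Fréchet derivative of `f` through the duality pairing, `Df(x)(y) = ⟨y, δf/δx⟩`. -/
def funcDeriv (pair : B → L → ℂ) (f : B → ℂ) (x : B) : L :=
  Classical.epsilon fun ξ => ∀ y, fderiv ℂ f x y = pair y ξ

/-- The Lie-Poisson bracket `{f, g}(x) = ⟨x, [δf/δx, δg/δx]⟩` on a predual of `(L, br)`. -/
def liePoissonBracket (pair : B → L → ℂ) (br : L → L → L) (f g : B → ℂ) (x : B) : ℂ :=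
  pair x (br (funcDeriv pair f x) (funcDeriv pair g x))

end Poisson

section ExtensionBracket

variable {H : Type*} [NormedAddCommGroup H] [InnerProductSpace ℂ H] [CompleteSpace H]
variable {K : Submodule ℂ H} [CompleteSpace K]

/-- The partial functional derivative `δf/δϰ ∈ L¹(H₊)` at `(ϰ, σ)`. -/
def derivC (f : CompactOp (HilbertSub K) × RestrictedPredual K → ℂ) (p : CompactOp (HilbertSub K) × RestrictedPredual K) :
    TraceClassOp (HilbertSub K) :=
  funcDeriv pairC (fun ϰ => f (ϰ, p.2)) p.1

/-- The partial functional derivative `δf/δσ ∈ L^∞(H, H₊)` at `(ϰ, σ)`. -/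
def derivA (f : CompactOp (HilbertSub K) × RestrictedPredual K → ℂ) (p : CompactOp (HilbertSub K) × RestrictedPredual K) :
    RestrictedLie K :=
  funcDeriv pairA (fun σ => f (p.1, σ)) p.2

/-- The bracket on `𝒦(H₊) ⊕ L¹(H, H₊)`. -/
def extBracket (f g : CompactOp (HilbertSub K) × RestrictedPredual K → ℂ)
    (p : CompactOp (HilbertSub K) × RestrictedPredual K) : ℂ :=
  pairA p.2 (RestrictedLie.bracket (derivA f p) (derivA g p)) +
    pairC p.1 (nBracket (derivC f p) (derivC g p) - phi (derivA g p) (derivC f p) +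
      phi (derivA f p) (derivC g p) + omega (derivA f p) (derivA g p))

end ExtensionBracket

end

/-! Everything rests on one principle: if `B` is a predual of a Banach Lie algebra `L` and the
coadjoint action maps `B` into itself, then `B` is a Banach Lie--Poisson space
(`isBanachLiePoisson_liePoissonBracket`). Writing the coadjoint action as `⟨x, [η, ξ]⟩ = ⟨coad x ξ,
η⟩`, the bracket becomes `{f, g}(x) = Df(x)(coad x (δg/δx))`. Hence `x ↦ coad x (δg/δx)` is the
Hamiltonian field of `g`, and linearity and the Leibniz rule are rules for derivatives. In the
Jacobi identity the first order terms vanish by the Jacobi identity of `L`, and the Hessian terms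
cancel in pairs by symmetry of second derivatives.

Three inputs are needed for the concrete spaces. The first is duality: compact operators are a
predual of `L¹`, `L¹` of `L^∞`, and `L²` of `L²`. In each case a functional restricted to rank one
operators is a bounded sesquilinear form, hence a bounded operator; testing on suitable finite rank
operators puts it in the right class, and density of finite rank operators finishes
(`isPredual_compactOp`, `isPredual_traceClassOp`, `isPredual_hilbertSchmidtOp`). Splitting into
blocks gives the predual `𝔞` of `𝔥`.

The second is algebra. Since `[X, X']₊ = [X₊, X'₊] + ω(X, X')`, the map `ω` is the curvature of the
compression `X ↦ X₊`, which explains the cocycle and representation conditions. Equivalently, `(ρ,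
X) ↦ (X₊ - ρ, X)` carries the bracket of `𝔤` to componentwise commutators. The continuity of `ω` is
Hölder's inequality `‖AB‖₁ ≤ ‖A‖₂ ‖B‖₂`.

The third is the coadjoint action of `𝔤`. Cyclicity of the trace computes the adjoint of each term
of the bracket, and the ideal properties of the operator classes show that the results lie in `𝔠`
and `𝔞` (`pairG_gBracket`). For smooth functions the explicit bracket on `𝔠 ⊕ 𝔞` is the Lie--Poisson
bracket so obtained, because a total derivative is the sum of its partial derivatives
(`funcDeriv_pairG`); the formula for `X_h` is the coadjoint action written out. -/

noncomputable section

/-! ### Lie--Poisson structures on preduals of Banach Lie algebras. -/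

section PredualTheory

variable {B : Type*} [NormedAddCommGroup B] [NormedSpace ℂ B]
variable {L : Type*} [NormedAddCommGroup L] [NormedSpace ℂ L]
variable {B₁ : Type*} [NormedAddCommGroup B₁] [NormedSpace ℂ B₁]
variable {L₁ : Type*} [NormedAddCommGroup L₁] [NormedSpace ℂ L₁]

/-- A bilinear pairing is a predual pairing as soon as it is bounded, bounded below in the second
variable, and represents every continuous functional. -/
theorem IsPredual.of_bounds {pair : B → L → ℂ} (T : L →ₗ[ℂ] B →ₗ[ℂ] ℂ)
    (hT : ∀ ξ x, T ξ x = pair x ξ) (C D : ℝ) (hC : ∀ ξ x, ‖pair x ξ‖ ≤ C * ‖ξ‖ * ‖x‖)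
    (hi : ∀ ξ, (∀ x, pair x ξ = 0) → ξ = 0)
    (hs : ∀ l : B →L[ℂ] ℂ, ∃ ξ, (∀ x, l x = pair x ξ) ∧ ‖ξ‖ ≤ D * ‖l‖) : IsPredual pair := by
  let T' : L →L[ℂ] B →L[ℂ] ℂ := T.mkContinuous₂ C fun ξ x => by rw [hT]; exact hC ξ x
  have hT' : ∀ ξ x, T' ξ x = pair x ξ := hT
  have hinj : Function.Injective T' := by
    rw [injective_iff_map_eq_zero]
    exact fun ξ h => hi ξ fun x => by rw [← hT', h]; rfl
  have hs' : ∀ l, ∃ ξ, T' ξ = l ∧ ‖ξ‖ ≤ D * ‖l‖ := fun l => by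
    obtain ⟨ξ, hξ, hξD⟩ := hs l
    exact ⟨ξ, ContinuousLinearMap.ext fun x => (hT' ξ x).trans (hξ x).symm, hξD⟩
  -- The bound `D` on representatives bounds the inverse, so neither completeness of `L` nor the
  -- open mapping theorem is used.
  let e := LinearEquiv.ofBijective T'.toLinearMap ⟨hinj, fun l => (hs' l).imp fun _ h => h.1⟩
  refine ⟨e.toContinuousLinearEquivOfBounds ‖T'‖ D (fun ξ => T'.le_opNorm ξ) fun l => ?_, hT'⟩
  obtain ⟨ξ, rfl, hξ⟩ := hs' l
  rwa [show e.symm (T' ξ) = ξ from e.symm_apply_apply ξ]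

theorem IsBanachLieAlgebra.skew {br : L → L → L} (hL : IsBanachLieAlgebra br) (a b : L) :
    br a b = -br b a := by
  obtain ⟨T, hT⟩ := hL.continuous_bilinear
  have h1 := hL.alternating (a + b)
  rw [← hT] at h1
  simp only [map_add, _root_.add_apply] at h1
  rw [hT a a, hT b b, hL.alternating, hL.alternating, zero_add, add_zero] at h1
  rw [← hT, ← hT]
  exact eq_neg_of_add_eq_zero_left (by rw [add_comm]; exact h1)

/-- The dual of a normed space is always complete. This is how `L¹`, `L²` and `𝔥` are shown to be
Banach spaces. -/
theorem IsPredual.completeSpace {pair : B → L → ℂ} (h : IsPredual pair) : CompleteSpace L := by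
  obtain ⟨e, -⟩ := h
  exact (completeSpace_congr (e := e.toLinearEquiv.toEquiv) e.isUniformEmbedding).2 inferInstance

theorem IsPredual.prod {pair : B → L → ℂ} {pair₁ : B₁ → L₁ → ℂ} (h : IsPredual pair)
    (h₁ : IsPredual pair₁) :
    IsPredual fun (x : B × B₁) (ξ : L × L₁) => pair x.1 ξ.1 + pair₁ x.2 ξ.2 := by
  obtain ⟨e, he⟩ := h
  obtain ⟨e₁, he₁⟩ := h₁
  refine ⟨(e.prodCongr e₁).trans (ContinuousLinearMap.coprodEquivL (S := ℂ)), fun ξ x => ?_⟩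
  exact congrArg₂ (· + ·) (he _ _) (he₁ _ _)

theorem IsPredual.congr {pair : B → L → ℂ} {pair₁ : B₁ → L₁ → ℂ} (h : IsPredual pair)
    (a : B₁ ≃L[ℂ] B) (b : L₁ ≃L[ℂ] L) (hab : ∀ x ξ, pair₁ x ξ = pair (a x) (b ξ)) :
    IsPredual pair₁ := by
  obtain ⟨e, he⟩ := h
  refine ⟨(b.trans e).trans (a.symm.arrowCongr (ContinuousLinearEquiv.refl ℂ ℂ)), fun ξ x => ?_⟩
  rw [hab, ← he]
  simp

/-- Every continuous functional on `B` is given by some `ξ`, so this is Hahn--Banach separation. -/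
theorem IsPredual.eq_of_pair_eq {pair : B → L → ℂ} (h : IsPredual pair) {x y : B}
    (hxy : ∀ ξ, pair x ξ = pair y ξ) : x = y := by
  obtain ⟨e, he⟩ := h
  refine (SeparatingDual.eq_iff_forall_dual_eq (R := ℂ)).2 fun l => ?_
  rw [← e.apply_symm_apply l, he, he, hxy]

/-- A representative of the derivative exists because the pairing map is onto the dual, so the
`epsilon` choice is not a junk value. Differentiability plays no role: the derivative may be the
default value zero. -/
theorem funcDeriv_spec {pair : B → L → ℂ} (h : IsPredual pair) (f : B → ℂ) (x y : B) :
    pair y (funcDeriv pair f x) = fderiv ℂ f x y := by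
  obtain ⟨e, he⟩ := h
  exact (Classical.epsilon_spec (p := fun ξ => ∀ y, fderiv ℂ f x y = pair y ξ)
    ⟨e.symm (fderiv ℂ f x), fun y => by rw [← he, e.apply_symm_apply]⟩ y).symm

theorem funcDeriv_eq_symm {pair : B → L → ℂ} (e : L ≃L[ℂ] (B →L[ℂ] ℂ))
    (he : ∀ ξ x, e ξ x = pair x ξ) (f : B → ℂ) (x : B) :
    funcDeriv pair f x = e.symm (fderiv ℂ f x) := by
  rw [e.eq_symm_apply]
  ext y
  rw [he, funcDeriv_spec ⟨e, he⟩]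

theorem funcDeriv_eq_of_forall {pair : B → L → ℂ} (h : IsPredual pair) {f : B → ℂ} {x : B} {ξ : L}
    (hξ : ∀ y, fderiv ℂ f x y = pair y ξ) : funcDeriv pair f x = ξ := by
  obtain ⟨e, he⟩ := h
  rw [funcDeriv_eq_symm e he, e.symm_apply_eq]
  ext y
  rw [he, hξ]

variable [CompleteSpace B] {pair : B → L → ℂ} {br : L → L → L} {coad : B → L → B}

/-- The coadjoint action on a predual is bilinear and continuous. -/
theorem exists_coad_clm (h : IsPredual pair) (hL : IsBanachLieAlgebra br)
    (hc : ∀ x ξ η, pair x (br η ξ) = pair (coad x ξ) η) :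
    ∃ A : B →L[ℂ] L →L[ℂ] B, ∀ x ξ, A x ξ = coad x ξ := by
  have hp := h
  obtain ⟨e, he⟩ := h
  obtain ⟨T, hT⟩ := hL.continuous_bilinear
  have key : ∀ x ξ η, e η (coad x ξ) = e (T η ξ) x := fun x ξ η => by rw [he, he, hT, hc]
  have ext : ∀ x y : B, (∀ η, e η x = e η y) → x = y := fun x y hxy =>
    hp.eq_of_pair_eq fun ξ => by rw [← he, ← he, hxy]
  -- `coad` is an arbitrary function; its bilinearity is forced by the adjoint relation, as seen by
  -- pairing with every `η`.
  let A : B →ₗ[ℂ] L →ₗ[ℂ] B := LinearMap.mk₂ ℂ coad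
    (fun x y ξ => ext _ _ fun η => by simp [key])
    (fun c x ξ => ext _ _ fun η => by simp [key])
    (fun x ξ ξ' => ext _ _ fun η => by simp [key])
    (fun c x ξ => ext _ _ fun η => by simp [key])
  refine ⟨A.mkContinuous₂ (‖(e : L →L[ℂ] B →L[ℂ] ℂ)‖ * ‖T‖ *
    ‖(e.symm : (B →L[ℂ] ℂ) →L[ℂ] L)‖) fun x ξ => ?_, fun x ξ => rfl⟩
  -- The norm is tested on functionals: `l (coad x ξ) = ⟨x, [e⁻¹ l, ξ]⟩`, which is bounded by the
  -- norms of `e`, `T` and `e⁻¹`.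
  refine NormedSpace.norm_le_dual_bound ℂ _ (by positivity) fun l => ?_
  have h1 : l (A x ξ) = e (T (e.symm l) ξ) x := by
    rw [← key, e.apply_symm_apply]; rfl
  rw [h1]
  have h2 : ‖e (T (e.symm l) ξ)‖ ≤ ‖(e : L →L[ℂ] B →L[ℂ] ℂ)‖ * ‖T (e.symm l) ξ‖ :=
    (e : L →L[ℂ] B →L[ℂ] ℂ).le_opNorm _
  have h3 : ‖e.symm l‖ ≤ ‖(e.symm : (B →L[ℂ] ℂ) →L[ℂ] L)‖ * ‖l‖ :=
    (e.symm : (B →L[ℂ] ℂ) →L[ℂ] L).le_opNorm _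
  calc ‖e (T (e.symm l) ξ) x‖ ≤ ‖e (T (e.symm l) ξ)‖ * ‖x‖ := ContinuousLinearMap.le_opNorm _ _
    _ ≤ (‖(e : L →L[ℂ] B →L[ℂ] ℂ)‖ * (‖T‖ * (‖(e.symm : (B →L[ℂ] ℂ) →L[ℂ] L)‖ * ‖l‖) * ‖ξ‖)) *
        ‖x‖ := by
      gcongr
      refine h2.trans ?_
      gcongr
      refine (T.le_opNorm₂ _ _).trans ?_
      gcongr
    _ = _ := by ring

theorem contDiff_funcDeriv (h : IsPredual pair) {f : B → ℂ} (hf : ContDiff ℂ ∞ f) :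
    ContDiff ℂ ∞ (funcDeriv pair f) := by
  obtain ⟨e, he⟩ := h
  have : funcDeriv pair f = fun x => e.symm (fderiv ℂ f x) :=
    funext fun x => funcDeriv_eq_symm e he f x
  rw [this]
  exact e.symm.contDiff.comp (hf.fderiv_right (by simp))

/-- Moving the second argument onto the point leaves `f` only through its derivative, so the bracket
with `g` acts on `f` as a vector field. -/
theorem liePoissonBracket_eq_fderiv (h : IsPredual pair)
    (hc : ∀ x ξ η, pair x (br η ξ) = pair (coad x ξ) η) (f g : B → ℂ) (x : B) :
    liePoissonBracket pair br f g x = fderiv ℂ f x (coad x (funcDeriv pair g x)) := by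
  rw [liePoissonBracket, hc, funcDeriv_spec h]

theorem isHamiltonianVectorField_coad (h : IsPredual pair) (hL : IsBanachLieAlgebra br)
    (hc : ∀ x ξ η, pair x (br η ξ) = pair (coad x ξ) η) {f : B → ℂ} (hf : ContDiff ℂ ∞ f) :
    IsHamiltonianVectorField (liePoissonBracket pair br) f
      (fun x => coad x (funcDeriv pair f x)) := by
  refine ⟨?_, fun g _ x => liePoissonBracket_eq_fderiv h hc g f x⟩
  obtain ⟨A, hA⟩ := exists_coad_clm h hL hc
  simp only [← hA]
  exact (A.contDiff.clm_apply (contDiff_funcDeriv h hf))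

theorem contDiff_liePoissonBracket (h : IsPredual pair) (hL : IsBanachLieAlgebra br)
    (hc : ∀ x ξ η, pair x (br η ξ) = pair (coad x ξ) η) {f g : B → ℂ} (hf : ContDiff ℂ ∞ f)
    (hg : ContDiff ℂ ∞ g) : ContDiff ℂ ∞ (liePoissonBracket pair br f g) := by
  have := (isHamiltonianVectorField_coad h hL hc hg).1
  rw [funext (liePoissonBracket_eq_fderiv h hc f g)]
  exact (hf.fderiv_right (by simp)).clm_apply this

theorem liePoissonBracket_skew (h : IsPredual pair) (hL : IsBanachLieAlgebra br) (f g : B → ℂ) :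
    liePoissonBracket pair br f g = -liePoissonBracket pair br g f := by
  obtain ⟨e, he⟩ := h
  funext x
  rw [Pi.neg_apply, liePoissonBracket, liePoissonBracket, hL.skew, ← he, ← he, map_neg]
  rfl

/-- The derivative of a Lie-Poisson bracket. -/
theorem fderiv_liePoissonBracket (h : IsPredual pair) (hL : IsBanachLieAlgebra br)
    (hc : ∀ x ξ η, pair x (br η ξ) = pair (coad x ξ) η) {f g : B → ℂ} (hf : ContDiff ℂ ∞ f)
    (hg : ContDiff ℂ ∞ g) (x y : B) :
    fderiv ℂ (liePoissonBracket pair br f g) x y =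
      pair y (br (funcDeriv pair f x) (funcDeriv pair g x)) +
        fderiv ℂ (fderiv ℂ f) x y (coad x (funcDeriv pair g x)) -
        fderiv ℂ (fderiv ℂ g) x y (coad x (funcDeriv pair f x)) := by
  have hp := h
  obtain ⟨e, he⟩ := h
  obtain ⟨T, hT⟩ := hL.continuous_bilinear
  have hd : ∀ {f : B → ℂ}, ContDiff ℂ ∞ f → HasFDerivAt (funcDeriv pair f)
      ((e.symm : (B →L[ℂ] ℂ) →L[ℂ] L) ∘L fderiv ℂ (fderiv ℂ f) x) x := fun {f} hf => by
    rw [show funcDeriv pair f = fun x => e.symm (fderiv ℂ f x) from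
      funext fun x => funcDeriv_eq_symm e he f x]
    have h1 : ContDiff ℂ ∞ (fderiv ℂ f) := hf.fderiv_right (by simp)
    exact (e.symm : (B →L[ℂ] ℂ) →L[ℂ] L).hasFDerivAt.comp x
      ((h1.differentiable (by simp)) x).hasFDerivAt
  have hm := (e : L →L[ℂ] B →L[ℂ] ℂ).hasFDerivAt.comp x
    (T.hasFDerivAt_of_bilinear (hd hf) (hd hg))
  have hb := hm.clm_apply (hasFDerivAt_id x)
  -- The base point enters both the functional and its argument, hence the product rule for
  -- evaluation.
  have hF : liePoissonBracket pair br f g = fun x =>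
      ((e : L →L[ℂ] B →L[ℂ] ℂ) ∘ fun y => T (funcDeriv pair f y) (funcDeriv pair g y)) x (id x) :=
    funext fun x => by
      rw [liePoissonBracket, ← he, ← hT]; rfl
  -- The variation of a functional derivative is `e.symm` of a Hessian row `l`; pairing its bracket
  -- with `x` evaluates `l` on the coadjoint field.
  have hs : ∀ (l : B →L[ℂ] ℂ) (f : B → ℂ),
      e (br (e.symm l) (funcDeriv pair f x)) x = l (coad x (funcDeriv pair f x)) := fun l f => by
    rw [he, hc, ← he, e.apply_symm_apply]
  have hskew : ∀ a b, T a b = -T b a := fun a b => by rw [hT, hT, hL.skew]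
  rw [hF, hb.fderiv, ← he, ← hs, ← hs, ← hT, ← hT, ← hT, hskew _ (funcDeriv pair f x)]
  simp [ContinuousLinearMap.precompR, ContinuousLinearMap.precompL]
  ring

/-- The Jacobi identity for a Lie-Poisson bracket. -/
theorem liePoissonBracket_jacobi (h : IsPredual pair) (hL : IsBanachLieAlgebra br)
    (hc : ∀ x ξ η, pair x (br η ξ) = pair (coad x ξ) η) {f g k : B → ℂ} (hf : ContDiff ℂ ∞ f)
    (hg : ContDiff ℂ ∞ g) (hk : ContDiff ℂ ∞ k) :
    liePoissonBracket pair br (liePoissonBracket pair br f g) k +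
      liePoissonBracket pair br (liePoissonBracket pair br g k) f +
      liePoissonBracket pair br (liePoissonBracket pair br k f) g = 0 := by
  funext x
  have hsym : ∀ {f : B → ℂ}, ContDiff ℂ ∞ f → ∀ y z,
      fderiv ℂ (fderiv ℂ f) x y z = fderiv ℂ (fderiv ℂ f) x z y := fun {f} hf y z =>
    (hf.contDiffAt.isSymmSndFDerivAt (by
      rw [minSmoothness_of_isRCLikeNormedField]; exact WithTop.coe_le_coe.2 le_top)).eq y z
  simp only [Pi.add_apply, Pi.zero_apply, liePoissonBracket_eq_fderiv h hc _ _ x,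
    fderiv_liePoissonBracket h hL hc hf hg, fderiv_liePoissonBracket h hL hc hg hk,
    fderiv_liePoissonBracket h hL hc hk hf]
  -- This turns each first order term into `⟨x, [[·,·],·]⟩`; their cyclic sum vanishes by the Jacobi
  -- identity of `L`.
  simp only [← hc]
  -- Each of the three functions contributes its Hessian twice, with opposite signs and with the two
  -- coadjoint directions exchanged. Symmetry makes the two copies equal.
  rw [hsym hf (coad x (funcDeriv pair k x)), hsym hg (coad x (funcDeriv pair f x)),
    hsym hk (coad x (funcDeriv pair g x))]
  obtain ⟨e, he⟩ := h
  have hj := congrArg (fun ξ => e ξ x)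
    (hL.jacobi (funcDeriv pair f x) (funcDeriv pair g x) (funcDeriv pair k x))
  simp only [map_add, _root_.add_apply, he, map_zero, _root_.zero_apply] at hj
  linear_combination hj

/-- A Banach space that is predual to a Banach Lie algebra and preserved by the coadjoint action
is a Banach Lie-Poisson space. -/
theorem isBanachLiePoisson_liePoissonBracket (h : IsPredual pair) (hL : IsBanachLieAlgebra br)
    (hc : ∀ x ξ η, pair x (br η ξ) = pair (coad x ξ) η) :
    IsBanachLiePoisson (liePoissonBracket pair br) where
  complete := inferInstance
  poisson :=
    { smooth := fun _ _ hf hg => contDiff_liePoissonBracket h hL hc hf hg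
      add_left := fun f g k hf hg _ => by
        funext x
        simp only [Pi.add_apply, liePoissonBracket_eq_fderiv h hc _ _ x]
        rw [fderiv_add ((hf.differentiable (by simp)) x) ((hg.differentiable (by simp)) x)]
        rfl
      smul_left := fun c f g hf _ => by
        funext x
        simp only [Pi.smul_apply, liePoissonBracket_eq_fderiv h hc _ _ x]
        rw [fderiv_const_smul ((hf.differentiable (by simp)) x)]
        rfl
      skew := fun f g _ _ => liePoissonBracket_skew h hL f g
      jacobi := fun _ _ _ hf hg hk => liePoissonBracket_jacobi h hL hc hf hg hk
      leibniz := fun f g k hf hg _ => by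
        funext x
        simp only [Pi.add_apply, Pi.mul_apply, liePoissonBracket_eq_fderiv h hc _ _ x]
        rw [fderiv_mul ((hf.differentiable (by simp)) x) ((hg.differentiable (by simp)) x)]
        simp only [_root_.add_apply, _root_.smul_apply, smul_eq_mul]
        ring
      hamiltonian := fun _ hk => ⟨_, isHamiltonianVectorField_coad h hL hc hk⟩ }
  dual := by
    obtain ⟨e, he⟩ := h
    obtain ⟨T, hT⟩ := hL.continuous_bilinear
    -- A continuous functional has the constant functional derivative `e.symm l`, so the bracket on
    -- the dual is `br` transported along `e`.
    refine ⟨fun l m => e (br (e.symm l) (e.symm m)), ⟨inferInstance, ?_, ?_, ?_⟩, fun l m => ?_⟩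
    · refine ⟨(ContinuousLinearMap.compL ℂ (B →L[ℂ] ℂ) L (B →L[ℂ] ℂ)
        (e : L →L[ℂ] B →L[ℂ] ℂ)) ∘L (ContinuousLinearMap.flip
          (ContinuousLinearMap.compL ℂ (B →L[ℂ] ℂ) L L)
          (e.symm : (B →L[ℂ] ℂ) →L[ℂ] L)) ∘L T ∘L (e.symm : (B →L[ℂ] ℂ) →L[ℂ] L),
        fun l m => ?_⟩
      simp [← hT]
    · intro l
      rw [hL.alternating, map_zero]
    · intro l m n
      simp only [e.symm_apply_apply, ← map_add, hL.jacobi, map_zero]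
    · funext x
      rw [liePoissonBracket, funcDeriv_eq_symm e he, funcDeriv_eq_symm e he, ← he]
      simp

theorem IsHamiltonianVectorField.congr {PB PB' : (B → ℂ) → (B → ℂ) → B → ℂ}
    (hPB : ∀ f g, ContDiff ℂ ∞ f → ContDiff ℂ ∞ g → PB f g = PB' f g) {k : B → ℂ} {X : B → B}
    (hk : ContDiff ℂ ∞ k) (h : IsHamiltonianVectorField PB' k X) :
    IsHamiltonianVectorField PB k X :=
  ⟨h.1, fun f hf x => by rw [hPB f k hf hk, h.2 f hf]⟩

/-- Being a Banach Lie-Poisson space only depends on the bracket of smooth functions. -/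
theorem IsBanachLiePoisson.congr {PB PB' : (B → ℂ) → (B → ℂ) → B → ℂ}
    (hPB : ∀ f g, ContDiff ℂ ∞ f → ContDiff ℂ ∞ g → PB f g = PB' f g)
    (h : IsBanachLiePoisson PB') : IsBanachLiePoisson PB where
  complete := h.complete
  poisson :=
    { smooth := fun f g hf hg => by rw [hPB f g hf hg]; exact h.poisson.smooth f g hf hg
      add_left := fun f g k hf hg hk => by
        rw [hPB (f + g) _ (hf.add hg) hk, hPB _ _ hf hk, hPB _ _ hg hk]
        exact h.poisson.add_left f g k hf hg hk
      smul_left := fun c f g hf hg => by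
        rw [hPB (c • f) _ (hf.const_smul c) hg, hPB _ _ hf hg]
        exact h.poisson.smul_left c f g hf hg
      skew := fun f g hf hg => by
        rw [hPB _ _ hf hg, hPB _ _ hg hf]
        exact h.poisson.skew f g hf hg
      jacobi := fun f g k hf hg hk => by
        -- The inner brackets are replaced first; smoothness of the new inner bracket then allows
        -- the outer one to be replaced.
        rw [hPB _ _ hf hg, hPB _ _ hg hk, hPB _ _ hk hf, hPB _ _ (h.poisson.smooth _ _ hf hg) hk,
          hPB _ _ (h.poisson.smooth _ _ hg hk) hf, hPB _ _ (h.poisson.smooth _ _ hk hf) hg]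
        exact h.poisson.jacobi f g k hf hg hk
      leibniz := fun f g k hf hg hk => by
        rw [hPB (f * g) _ (hf.mul hg) hk, hPB _ _ hf hk, hPB _ _ hg hk]
        exact h.poisson.leibniz f g k hf hg hk
      hamiltonian := fun k hk => by
        obtain ⟨X, hX⟩ := h.poisson.hamiltonian k hk
        exact ⟨X, hX.congr hPB hk⟩ }
  dual := by
    obtain ⟨br, hbr, hd⟩ := h.dual
    exact ⟨br, hbr, fun l m => by rw [hPB _ _ l.contDiff m.contDiff, hd]⟩

end PredualTheory

/-! ### Norm inequalities, rank one operators and finite rank approximation. -/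

section TraceEstimates

variable {E : Type*} [NormedAddCommGroup E] [InnerProductSpace ℂ E] [CompleteSpace E]
variable {F : Type*} [NormedAddCommGroup F] [InnerProductSpace ℂ F] [CompleteSpace F]
variable {G : Type*} [NormedAddCommGroup G] [InnerProductSpace ℂ G] [CompleteSpace G]

open InnerProductSpace (rankOne)

theorem sq_ofReal_hsNorm {A : E →L[ℂ] F} (hA : IsHilbertSchmidt A) :
    ENNReal.ofReal (hsNorm A) ^ 2 = hsSq A := by
  rw [← ENNReal.ofReal_pow (hsNorm_nonneg A), hsNorm, Real.sq_sqrt ENNReal.toReal_nonneg,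
    ENNReal.ofReal_toReal hA]

theorem hsSq_rpow_half {A : E →L[ℂ] F} (hA : IsHilbertSchmidt A) :
    hsSq A ^ (1 / 2 : ℝ) = ENNReal.ofReal (hsNorm A) := by
  rw [← sq_ofReal_hsNorm hA, ← ENNReal.rpow_natCast, ← ENNReal.rpow_mul]
  norm_num

theorem hsNorm_le_of_hsSq_le {A : E →L[ℂ] F} {c : ℝ} (hc : 0 ≤ c)
    (h : hsSq A ≤ ENNReal.ofReal c ^ 2) : hsNorm A ≤ c := by
  rw [hsNorm]
  refine Real.sqrt_le_iff.2 ⟨hc, ?_⟩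
  have := ENNReal.toReal_mono (by simp) h
  simpa [ENNReal.toReal_ofReal hc] using this

theorem hsNorm_clm_comp_le {A : E →L[ℂ] F} (hA : IsHilbertSchmidt A) (C : F →L[ℂ] G) :
    hsNorm (C ∘L A) ≤ ‖C‖ * hsNorm A := by
  refine hsNorm_le_of_hsSq_le (mul_nonneg (norm_nonneg _) (hsNorm_nonneg _)) ?_
  rw [ENNReal.ofReal_mul (norm_nonneg _), mul_pow, sq_ofReal_hsNorm hA, ofReal_norm]
  exact hsSq_comp_left C A

theorem hsNorm_comp_clm_le {A : F →L[ℂ] G} (hA : IsHilbertSchmidt A) (C : E →L[ℂ] F) :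
    hsNorm (A ∘L C) ≤ ‖C‖ * hsNorm A := by
  refine hsNorm_le_of_hsSq_le (mul_nonneg (norm_nonneg _) (hsNorm_nonneg _)) ?_
  rw [ENNReal.ofReal_mul (norm_nonneg _), mul_pow, sq_ofReal_hsNorm hA, ofReal_norm]
  exact hsSq_comp_right A C

theorem hsNorm_adjoint (A : E →L[ℂ] F) : hsNorm (ContinuousLinearMap.adjoint A) = hsNorm A := by
  rw [hsNorm, hsSq_adjoint, hsNorm]

theorem norm_le_one_of_enorm {A : E →L[ℂ] F} (h : ‖A‖ₑ ≤ 1) : ‖A‖ ≤ 1 := by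
  rw [← ofReal_norm, ← ENNReal.ofReal_one] at h
  exact (ENNReal.ofReal_le_ofReal_iff zero_le_one).1 h

theorem traceNorm_comp_le (C : E →L[ℂ] F) {A : E →L[ℂ] E} (hA : IsTraceClass A) (D : F →L[ℂ] E) :
    traceNorm (C ∘L A ∘L D) ≤ ‖C‖ * ‖D‖ * traceNorm A := by
  have h := ENNReal.toReal_mono (ENNReal.mul_ne_top (by simp [ENNReal.mul_eq_top]) hA)
    (traceAbs_comp_le C A D)
  simpa [ENNReal.toReal_mul, traceNorm] using h

theorem traceNorm_clm_comp_le (C : E →L[ℂ] E) {A : E →L[ℂ] E} (hA : IsTraceClass A) :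
    traceNorm (C ∘L A) ≤ ‖C‖ * traceNorm A := by
  refine (traceNorm_comp_le C hA (ContinuousLinearMap.id ℂ E)).trans ?_
  have := ContinuousLinearMap.norm_id_le (𝕜 := ℂ) (E := E)
  have h := traceNorm_nonneg A
  gcongr
  exact mul_le_of_le_one_right (norm_nonneg _) this

theorem traceNorm_comp_clm_le (C : E →L[ℂ] E) {A : E →L[ℂ] E} (hA : IsTraceClass A) :
    traceNorm (A ∘L C) ≤ ‖C‖ * traceNorm A := by
  refine (traceNorm_comp_le (ContinuousLinearMap.id ℂ E) hA C).trans ?_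
  have := ContinuousLinearMap.norm_id_le (𝕜 := ℂ) (E := E)
  have h := traceNorm_nonneg A
  gcongr
  exact mul_le_of_le_one_left (norm_nonneg _) this

theorem tsum_inner_comp_le (A : F →L[ℂ] E) (B : E →L[ℂ] F) :
    ∑' i, ‖⟪onb E i, A (B (onb E i))⟫_ℂ‖ₑ ≤ hsSq A ^ (1 / 2 : ℝ) * hsSq B ^ (1 / 2 : ℝ) := by
  have h := tsum_inner_hs (ContinuousLinearMap.adjoint A) B
  rw [hsSq_adjoint] at h
  simpa only [ContinuousLinearMap.adjoint_inner_left] using h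

/-- Hölder's inequality `‖AB‖₁ ≤ ‖A‖₂ ‖B‖₂`. -/
theorem traceNorm_hs_comp_le {A : F →L[ℂ] E} {B : E →L[ℂ] F} (hA : IsHilbertSchmidt A)
    (hB : IsHilbertSchmidt B) : traceNorm (A ∘L B) ≤ hsNorm A * hsNorm B := by
  obtain ⟨W, hW, h⟩ := exists_abs_eq (A ∘L B)
  have h1 := (traceAbs_le_tsum _ W h).trans (tsum_inner_comp_le (W ∘L A) B)
  rw [hsSq_rpow_half (hA.clm_comp W), hsSq_rpow_half hB,
    ← ENNReal.ofReal_mul (hsNorm_nonneg _)] at h1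
  have h2 := ENNReal.toReal_mono ENNReal.ofReal_ne_top h1
  rw [ENNReal.toReal_ofReal (mul_nonneg (hsNorm_nonneg _) (hsNorm_nonneg _))] at h2
  refine h2.trans (mul_le_mul_of_nonneg_right ((hsNorm_clm_comp_le hA W).trans ?_)
    (hsNorm_nonneg _))
  exact mul_le_of_le_one_left (hsNorm_nonneg _) (norm_le_one_of_enorm hW)

theorem norm_opTrace_le {A : E →L[ℂ] E} {c : ℝ} (hc : 0 ≤ c)
    (h : ∑' i, ‖⟪onb E i, A (onb E i)⟫_ℂ‖ₑ ≤ ENNReal.ofReal c) : ‖opTrace A‖ ≤ c := by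
  have h1 := (enorm_tsum_le_tsum_enorm (f := fun i => ⟪onb E i, A (onb E i)⟫_ℂ)).trans h
  rw [← ofReal_norm] at h1
  exact (ENNReal.ofReal_le_ofReal_iff hc).1 h1

theorem norm_opTrace_comp_le (C : E →L[ℂ] E) {A : E →L[ℂ] E} (hA : IsTraceClass A) :
    ‖opTrace (C ∘L A)‖ ≤ ‖C‖ * traceNorm A := by
  refine norm_opTrace_le (mul_nonneg (norm_nonneg _) (traceNorm_nonneg _)) ?_
  refine (tsum_inner_le_traceAbs A C (ContinuousLinearMap.id ℂ E)).trans ?_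
  rw [ENNReal.ofReal_mul (norm_nonneg _), ofReal_norm, traceNorm, ENNReal.ofReal_toReal hA]
  gcongr
  refine mul_le_of_le_one_right' ?_
  rw [← ofReal_norm, ← ENNReal.ofReal_one]
  exact ENNReal.ofReal_le_ofReal ContinuousLinearMap.norm_id_le

theorem norm_opTrace_comp_le' {A : E →L[ℂ] E} (hA : IsTraceClass A) (C : E →L[ℂ] E) :
    ‖opTrace (A ∘L C)‖ ≤ ‖C‖ * traceNorm A := by
  refine norm_opTrace_le (mul_nonneg (norm_nonneg _) (traceNorm_nonneg _)) ?_
  refine (tsum_inner_le_traceAbs A (ContinuousLinearMap.id ℂ E) C).trans ?_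
  rw [ENNReal.ofReal_mul (norm_nonneg _), ofReal_norm, traceNorm, ENNReal.ofReal_toReal hA]
  gcongr
  refine mul_le_of_le_one_left' ?_
  rw [← ofReal_norm, ← ENNReal.ofReal_one]
  exact ENNReal.ofReal_le_ofReal ContinuousLinearMap.norm_id_le

theorem norm_opTrace_hs_comp_le {A : F →L[ℂ] E} {B : E →L[ℂ] F} (hA : IsHilbertSchmidt A)
    (hB : IsHilbertSchmidt B) : ‖opTrace (A ∘L B)‖ ≤ hsNorm A * hsNorm B := by
  refine norm_opTrace_le (mul_nonneg (hsNorm_nonneg _) (hsNorm_nonneg _)) ?_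
  rw [ENNReal.ofReal_mul (hsNorm_nonneg _), ← hsSq_rpow_half hA, ← hsSq_rpow_half hB]
  exact tsum_inner_comp_le A B

theorem opTrace_add {A B : E →L[ℂ] E} (hA : IsTraceClass A) (hB : IsTraceClass B) :
    opTrace (A + B) = opTrace A + opTrace B := by
  simp only [opTrace, _root_.add_apply, inner_add_right]
  exact hA.summable_inner.of_norm.tsum_add hB.summable_inner.of_norm

theorem opTrace_smul (c : ℂ) (A : E →L[ℂ] E) : opTrace (c • A) = c * opTrace A := by
  simp only [opTrace, _root_.smul_apply, inner_smul_right]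
  exact tsum_mul_left

theorem opTrace_zero : opTrace (0 : E →L[ℂ] E) = 0 := by simp [opTrace]

theorem opTrace_neg (A : E →L[ℂ] E) : opTrace (-A) = -opTrace A := by
  simpa using opTrace_smul (-1) A

theorem IsTraceClass.neg {A : E →L[ℂ] E} (hA : IsTraceClass A) : IsTraceClass (-A) := by
  simpa using hA.smul (-1)

theorem opTrace_sub {A B : E →L[ℂ] E} (hA : IsTraceClass A) (hB : IsTraceClass B) :
    opTrace (A - B) = opTrace A - opTrace B := by
  rw [sub_eq_add_neg, opTrace_add hA hB.neg, opTrace_neg, sub_eq_add_neg]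

theorem hsSq_rankOne (x : F) (y : E) : hsSq (rankOne ℂ x y) = (‖x‖ₑ * ‖y‖ₑ) ^ 2 := by
  simp only [hsSq, InnerProductSpace.rankOne_apply, enorm_smul, mul_pow]
  rw [ENNReal.tsum_mul_right, enorm_sq_eq_tsum y, mul_comm]
  congr 1
  refine tsum_congr fun i => ?_
  rw [← ofReal_norm, ← ofReal_norm, norm_inner_symm]

theorem isHilbertSchmidt_rankOne (x : F) (y : E) : IsHilbertSchmidt (rankOne ℂ x y) := by
  rw [IsHilbertSchmidt, hsSq_rankOne]
  simp [ENNReal.mul_eq_top]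

theorem hsNorm_rankOne (x : F) (y : E) : hsNorm (rankOne ℂ x y) = ‖x‖ * ‖y‖ := by
  rw [hsNorm, hsSq_rankOne]
  simp [ENNReal.toReal_mul, Real.sqrt_sq (mul_nonneg (norm_nonneg x) (norm_nonneg y))]

/-- Factoring through `ℂ` exhibits a rank one operator as a product of two Hilbert--Schmidt
operators, so Hölder's inequality controls its trace norm. -/
theorem rankOne_eq_comp (x : F) (y : E) :
    rankOne ℂ x y = rankOne ℂ x (1 : ℂ) ∘L rankOne ℂ (1 : ℂ) y := by
  ext; simp

theorem isTraceClass_rankOne (x y : E) : IsTraceClass (rankOne ℂ x y) := by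
  rw [rankOne_eq_comp]
  exact (isHilbertSchmidt_rankOne _ _).comp (isHilbertSchmidt_rankOne _ _)

theorem traceNorm_rankOne_le (x y : E) : traceNorm (rankOne ℂ x y) ≤ ‖x‖ * ‖y‖ := by
  rw [rankOne_eq_comp]
  refine (traceNorm_hs_comp_le (isHilbertSchmidt_rankOne _ _)
    (isHilbertSchmidt_rankOne _ _)).trans_eq ?_
  rw [hsNorm_rankOne, hsNorm_rankOne, norm_one, mul_one, one_mul]

/-- Parseval's identity in the fixed basis. Through it, traces against rank one operators are matrix
coefficients. -/
theorem opTrace_rankOne (x y : E) : opTrace (rankOne ℂ x y) = ⟪y, x⟫_ℂ := by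
  simp only [opTrace, InnerProductSpace.rankOne_apply, inner_smul_right]
  exact ((onb E).hasSum_inner_mul_inner y x).tsum_eq

theorem comp_rankOne' (T : F →L[ℂ] G) (x : F) (y : E) :
    T ∘L rankOne ℂ x y = rankOne ℂ (T x) y := by
  ext; simp

theorem rankOne_comp' (T : G →L[ℂ] E) (x : F) (y : E) :
    rankOne ℂ x y ∘L T = rankOne ℂ x (ContinuousLinearMap.adjoint T y) := by
  ext; simp [ContinuousLinearMap.adjoint_inner_left]

theorem opTrace_comp_rankOne (T : F →L[ℂ] E) (x : F) (y : E) :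
    opTrace (T ∘L rankOne ℂ x y) = ⟪y, T x⟫_ℂ := by
  rw [comp_rankOne', opTrace_rankOne]

theorem opTrace_rankOne_comp (T : F →L[ℂ] E) (x : F) (y : E) :
    opTrace (rankOne ℂ x y ∘L T) = ⟪y, T x⟫_ℂ := by
  rw [rankOne_comp', opTrace_rankOne, ContinuousLinearMap.adjoint_inner_left]

theorem norm_le_of_inner_le {A : E →L[ℂ] F} {c : ℝ} (hc : 0 ≤ c)
    (h : ∀ x y, ‖⟪y, A x⟫_ℂ‖ ≤ c * (‖x‖ * ‖y‖)) : ‖A‖ ≤ c := by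
  refine A.opNorm_le_bound hc fun x => ?_
  rcases eq_or_lt_of_le (norm_nonneg (A x)) with h0 | h0
  · rw [← h0]; positivity
  -- The choice `y = A x` gives `‖A x‖² ≤ c ‖x‖ ‖A x‖`, and the nonzero factor cancels.
  have h1 := h x (A x)
  rw [← inner_self_re_eq_norm, inner_self_eq_norm_mul_norm] at h1
  exact le_of_mul_le_mul_right (by linarith) h0

/-- A matrix coefficient is the trace against a rank one operator, whose Hilbert--Schmidt norm is
`‖x‖ ‖y‖`. -/
theorem norm_le_hsNorm {A : E →L[ℂ] F} (hA : IsHilbertSchmidt A) : ‖A‖ ≤ hsNorm A :=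
  norm_le_of_inner_le (hsNorm_nonneg _) fun x y => by
    rw [← opTrace_comp_rankOne, ← hsNorm_rankOne]
    exact norm_opTrace_hs_comp_le hA (isHilbertSchmidt_rankOne _ _)

theorem norm_le_traceNorm {A : E →L[ℂ] E} (hA : IsTraceClass A) : ‖A‖ ≤ traceNorm A :=
  norm_le_of_inner_le (traceNorm_nonneg _) fun x y => by
    rw [← opTrace_comp_rankOne, ← InnerProductSpace.norm_rankOne (𝕜 := ℂ), mul_comm]
    exact norm_opTrace_comp_le' hA _

theorem isHilbertSchmidt_sqrtAbs {A : E →L[ℂ] E} (hA : IsTraceClass A) :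
    IsHilbertSchmidt (sqrtAbs A) := by
  rwa [IsHilbertSchmidt, ← traceAbs_eq_hsSq]

/-- The restriction of `A` to the span of finitely many basis vectors, extended by zero. -/
def truncation (A : E →L[ℂ] F) (s : Finset (onbIndex E)) : E →L[ℂ] F :=
  ∑ i ∈ s, rankOne ℂ (A (onb E i)) (onb E i)

theorem truncation_apply_onb (A : E →L[ℂ] F) (s : Finset (onbIndex E)) (j : onbIndex E)
    [Decidable (j ∈ s)] : truncation A s (onb E j) = if j ∈ s then A (onb E j) else 0 := by
  classical
  have h := orthonormal_iff_ite.1 (onb E).orthonormal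
  rw [truncation, sum_apply]
  simp only [InnerProductSpace.rankOne_apply, h, ite_smul, one_smul, zero_smul]
  rw [Finset.sum_ite_eq' s j]
  congr

theorem hsSq_truncation (A : E →L[ℂ] F) (s : Finset (onbIndex E)) :
    hsSq (truncation A s) = ∑ i ∈ s, ‖A (onb E i)‖ₑ ^ 2 := by
  classical
  rw [hsSq, tsum_eq_sum (s := s)]
  · exact Finset.sum_congr rfl fun i hi => by rw [truncation_apply_onb, if_pos hi]
  · intro i hi
    rw [truncation_apply_onb, if_neg hi]
    simp

theorem comp_truncation (B : F →L[ℂ] G) (A : E →L[ℂ] F) (s : Finset (onbIndex E)) :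
    B ∘L truncation A s = truncation (B ∘L A) s := by
  ext x
  simp [truncation]

theorem isHilbertSchmidt_truncation (A : E →L[ℂ] F) (s : Finset (onbIndex E)) :
    IsHilbertSchmidt (truncation A s) := by
  rw [IsHilbertSchmidt, hsSq_truncation]
  exact (ENNReal.sum_lt_top.2 fun i _ => by simp [← ofReal_norm, ← ENNReal.ofReal_pow]).ne

/-- The square of the error is the part of a convergent series outside `s`. -/
theorem tendsto_hsNorm_sub_truncation {A : E →L[ℂ] F} (hA : IsHilbertSchmidt A) :
    Filter.Tendsto (fun s => hsNorm (A - truncation A s)) Filter.atTop (nhds 0) := by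
  classical
  have h := ENNReal.tendsto_tsum_compl_atTop_zero (f := fun i => ‖A (onb E i)‖ₑ ^ 2) hA
  have h1 : ∀ s, hsSq (A - truncation A s) = ∑' i : {x // x ∉ s}, ‖A (onb E i)‖ₑ ^ 2 := by
    intro s
    have := tsum_subtype {x | x ∉ s} fun i => ‖A (onb E i)‖ₑ ^ 2
    refine Eq.trans ?_ this.symm
    refine tsum_congr fun i => ?_
    rw [_root_.sub_apply, truncation_apply_onb]
    by_cases hi : i ∈ s <;> simp [hi, Set.indicator]
  have h2 := (ENNReal.tendsto_toReal ENNReal.zero_ne_top).comp h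
  have h3 := (Real.continuous_sqrt.tendsto _).comp h2
  simpa [hsNorm, h1, Function.comp_def] using h3

/-- Write `A = (U |A|^{1/2}) |A|^{1/2}` and truncate only the right factor; Hölder's inequality
reduces the claim to Hilbert--Schmidt convergence. -/
theorem tendsto_traceNorm_sub_truncation {A : E →L[ℂ] E} (hA : IsTraceClass A) :
    Filter.Tendsto (fun s => traceNorm (A - truncation A s)) Filter.atTop (nhds 0) := by
  obtain ⟨U, -, hU⟩ := exists_eq_abs A
  have hS := isHilbertSchmidt_sqrtAbs hA
  have h1 : A = (U ∘L sqrtAbs A) ∘L sqrtAbs A := by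
    conv_lhs => rw [hU, ← sqrtAbs_mul_self]
    rfl
  have h2 : ∀ s, A - truncation A s =
      (U ∘L sqrtAbs A) ∘L (sqrtAbs A - truncation (sqrtAbs A) s) := fun s => by
    rw [ContinuousLinearMap.comp_sub, comp_truncation, ← h1]
  refine squeeze_zero (fun s => traceNorm_nonneg _) (fun s => ?_)
    (by simpa using (tendsto_hsNorm_sub_truncation hS).const_mul (hsNorm (U ∘L sqrtAbs A)))
  rw [h2]
  exact traceNorm_hs_comp_le (hS.clm_comp U) (hS.sub (isHilbertSchmidt_truncation _ _))

/-- A bounded functional on a space of operators that contains the rank one operators determines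
a bounded operator. -/
theorem exists_clm_of_rankOne {V : Type*} [NormedAddCommGroup V] [NormedSpace ℂ V]
    (R : E →ₗ[ℂ] F →ₗ⋆[ℂ] V) (hR : ∀ x y, ‖R x y‖ ≤ ‖x‖ * ‖y‖) (l : V →L[ℂ] ℂ) :
    ∃ A : E →L[ℂ] F, (∀ x y, ⟪y, A x⟫_ℂ = l (R x y)) ∧ ‖A‖ ≤ ‖l‖ := by
  have hb : ∀ x y, ‖l (R x y)‖ ≤ ‖l‖ * (‖x‖ * ‖y‖) := fun x y =>
    (l.le_opNorm _).trans (mul_le_mul_of_nonneg_left (hR x y) (norm_nonneg _))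
  -- `R` is conjugate linear in `y`, so the conjugate of `l (R x y)` is linear in `y`; its Riesz
  -- representative is the value of the operator at `x`.
  let φ : E → (F →L[ℂ] ℂ) := fun x => LinearMap.mkContinuous
    { toFun := fun y => (starRingEnd ℂ) (l (R x y))
      map_add' := fun y z => by simp
      map_smul' := fun c y => by simp } (‖l‖ * ‖x‖) fun y => by
        simpa [mul_assoc] using hb x y
  have hφ : ∀ x y, φ x y = (starRingEnd ℂ) (l (R x y)) := fun x y => rfl
  let A₀ : E →ₗ[ℂ] F :=
    { toFun := fun x => (InnerProductSpace.toDual ℂ F).symm (φ x)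
      map_add' := fun x z => by
        rw [← map_add]; congr 1; ext y; simp [hφ]
      map_smul' := fun c x => by
        apply (InnerProductSpace.toDual ℂ F).injective
        rw [LinearIsometryEquiv.apply_symm_apply, RingHom.id_apply, map_smulₛₗ,
          LinearIsometryEquiv.apply_symm_apply]
        ext y; simp [hφ] }
  have hA₀ : ∀ x y, ⟪y, A₀ x⟫_ℂ = l (R x y) := fun x y => by
    rw [← inner_conj_symm]
    change (starRingEnd ℂ) ⟪(InnerProductSpace.toDual ℂ F).symm (φ x), y⟫_ℂ = _
    rw [InnerProductSpace.toDual_symm_apply, hφ, Complex.conj_conj]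
  let A : E →L[ℂ] F := A₀.mkContinuous ‖l‖ fun x => by
    rcases eq_or_lt_of_le (norm_nonneg (A₀ x)) with h0 | h0
    · rw [← h0]; positivity
    have h1 := hb x (A₀ x)
    rw [← hA₀, ← inner_self_re_eq_norm, inner_self_eq_norm_mul_norm] at h1
    exact le_of_mul_le_mul_right (by linarith) h0
  exact ⟨A, hA₀, A₀.mkContinuous_norm_le (norm_nonneg _) _⟩

end TraceEstimates

/-! ### Trace duality between compact, trace class, Hilbert--Schmidt and bounded operators. -/

section OperatorDuality

variable {E : Type*} [NormedAddCommGroup E] [InnerProductSpace ℂ E] [CompleteSpace E]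
variable {F : Type*} [NormedAddCommGroup F] [InnerProductSpace ℂ F] [CompleteSpace F]

variable (E F) in
/-- The linear space of Hilbert-Schmidt operators from `E` to `F`. -/
def hilbertSchmidtSubmodule : Submodule ℂ (E →L[ℂ] F) where
  carrier := {A | IsHilbertSchmidt A}
  zero_mem' := IsHilbertSchmidt.zero
  add_mem' := fun hA hB => IsHilbertSchmidt.add hA hB
  smul_mem' := fun c _ hA => IsHilbertSchmidt.smul c hA

variable (E F) in
/-- `L²(E, F)`: the Hilbert-Schmidt operators from `E` to `F`, with the Hilbert-Schmidt norm. -/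
def HilbertSchmidtOp : Type _ := hilbertSchmidtSubmodule E F

namespace HilbertSchmidtOp

instance : AddCommGroup (HilbertSchmidtOp E F) :=
  inferInstanceAs (AddCommGroup (hilbertSchmidtSubmodule E F))

instance : Module ℂ (HilbertSchmidtOp E F) :=
  inferInstanceAs (Module ℂ (hilbertSchmidtSubmodule E F))

/-- The underlying bounded operator. -/
def op : HilbertSchmidtOp E F →ₗ[ℂ] (E →L[ℂ] F) := (hilbertSchmidtSubmodule E F).subtype

theorem op_injective : Function.Injective (op : HilbertSchmidtOp E F → (E →L[ℂ] F)) :=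
  Subtype.val_injective

theorem isHilbertSchmidt (A : HilbertSchmidtOp E F) : IsHilbertSchmidt A.op := A.2

/-- A Hilbert-Schmidt operator as an element of `L²(E, F)`. -/
def mk (A : E →L[ℂ] F) (hA : IsHilbertSchmidt A) : HilbertSchmidtOp E F := ⟨A, hA⟩

@[simp] theorem op_mk (A : E →L[ℂ] F) (hA : IsHilbertSchmidt A) : (mk A hA).op = A := rfl

instance : NormedAddCommGroup (HilbertSchmidtOp E F) :=
  AddGroupNorm.toNormedAddCommGroup
    { toFun := fun A => hsNorm A.op
      map_zero' := by simp [hsNorm_zero]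
      add_le' := fun A B => by
        simpa only [map_add] using hsNorm_add_le A.isHilbertSchmidt B.isHilbertSchmidt
      neg' := fun A => by
        have h : hsNorm (-A.op) = hsNorm A.op := by simpa using hsNorm_smul (-1) A.op
        rw [map_neg, h]
      eq_zero_of_map_eq_zero' := fun A h => op_injective (by
        rw [map_zero]; exact eq_zero_of_hsNorm A.isHilbertSchmidt h) }

theorem norm_def (A : HilbertSchmidtOp E F) : ‖A‖ = hsNorm A.op := rfl

instance : NormedSpace ℂ (HilbertSchmidtOp E F) where
  norm_smul_le c A := by
    simp only [norm_def, map_smul, hsNorm_smul]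
    exact le_rfl

/-- The rank one operators `z ↦ ⟪y, z⟫ x`. -/
def rankOne : F →ₗ[ℂ] E →ₗ⋆[ℂ] HilbertSchmidtOp E F :=
  LinearMap.mk₂'ₛₗ (RingHom.id ℂ) (starRingEnd ℂ)
    (fun x y => mk (InnerProductSpace.rankOne ℂ x y) (isHilbertSchmidt_rankOne x y))
    (fun x x' y => op_injective (by simp)) (fun c x y => op_injective (by simp))
    (fun x y y' => op_injective (by simp)) (fun c x y => op_injective (by simp))

@[simp] theorem op_rankOne (x : F) (y : E) :
    (rankOne x y).op = InnerProductSpace.rankOne ℂ x y := rfl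

theorem norm_rankOne (x : F) (y : E) : ‖rankOne x y‖ = ‖x‖ * ‖y‖ := hsNorm_rankOne x y

/-- Continuous functionals on `L²(E, F)` are determined by their values on rank one operators. -/
theorem ext_rankOne {l m : HilbertSchmidtOp E F →L[ℂ] ℂ}
    (h : ∀ x y, l (rankOne x y) = m (rankOne x y)) : l = m := by
  ext A
  have hlim : Filter.Tendsto (fun s => ∑ i ∈ s, rankOne (A.op (onb E i)) (onb E i))
      Filter.atTop (nhds A) := by
    rw [tendsto_iff_norm_sub_tendsto_zero]
    refine (tendsto_hsNorm_sub_truncation A.isHilbertSchmidt).congr fun s => ?_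
    rw [norm_sub_rev, norm_def, map_sub, map_sum]
    rfl
  refine tendsto_nhds_unique ((l.continuous.tendsto A).comp hlim) ?_
  refine ((m.continuous.tendsto A).comp hlim).congr fun s => ?_
  simp [map_sum, h]

end HilbertSchmidtOp

namespace TraceClassOp

/-- The rank one operators `z ↦ ⟪y, z⟫ x`. -/
def rankOne : E →ₗ[ℂ] E →ₗ⋆[ℂ] TraceClassOp E :=
  LinearMap.mk₂'ₛₗ (RingHom.id ℂ) (starRingEnd ℂ)
    (fun x y => mk (InnerProductSpace.rankOne ℂ x y) (isTraceClass_rankOne x y))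
    (fun x x' y => op_injective (by simp)) (fun c x y => op_injective (by simp))
    (fun x y y' => op_injective (by simp)) (fun c x y => op_injective (by simp))

@[simp] theorem op_rankOne (x y : E) : (rankOne x y).op = InnerProductSpace.rankOne ℂ x y := rfl

theorem norm_rankOne_le (x y : E) : ‖rankOne x y‖ ≤ ‖x‖ * ‖y‖ := traceNorm_rankOne_le x y

/-- Continuous functionals on `L¹(E)` are determined by their values on rank one operators. -/
theorem ext_rankOne {l m : TraceClassOp E →L[ℂ] ℂ}
    (h : ∀ x y, l (rankOne x y) = m (rankOne x y)) : l = m := by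
  ext A
  have hlim : Filter.Tendsto (fun s => ∑ i ∈ s, rankOne (A.op (onb E i)) (onb E i))
      Filter.atTop (nhds A) := by
    rw [tendsto_iff_norm_sub_tendsto_zero]
    refine (tendsto_traceNorm_sub_truncation A.isTraceClass).congr fun s => ?_
    rw [norm_sub_rev, norm_def, map_sub, map_sum]
    rfl
  refine tendsto_nhds_unique ((l.continuous.tendsto A).comp hlim) ?_
  refine ((m.continuous.tendsto A).comp hlim).congr fun s => ?_
  simp [map_sum, h]

end TraceClassOp

namespace CompactOp

theorem op_injective : Function.Injective (op : CompactOp E → (E →L[ℂ] E)) :=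
  Subtype.val_injective

theorem isCompactOperator (ϰ : CompactOp E) : IsCompactOperator ϰ.op := ϰ.2

/-- A compact operator as an element of `𝒦(E)`. -/
def mk (A : E →L[ℂ] E) (hA : IsCompactOperator A) : CompactOp E := ⟨A, hA⟩

@[simp] theorem op_mk (A : E →L[ℂ] E) (hA : IsCompactOperator A) : (mk A hA).op = A := rfl

instance : CompleteSpace (CompactOp E) :=
  (isClosed_setOfPred_isCompactOperator (σ₁₂ := RingHom.id ℂ) (M₁ := E)
    (M₂ := E)).completeSpace_coe

theorem isCompactOperator_rankOne (x y : E) :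
    IsCompactOperator (InnerProductSpace.rankOne ℂ x y) := by
  have h : IsCompactOperator (innerSL ℂ y : E →L[ℂ] ℂ) :=
    isCompactOperator_of_locallyCompactSpace_dom (innerSL ℂ y : E →L[ℂ] ℂ)
  exact h.clm_comp (ContinuousLinearMap.toSpanSingleton ℂ x)

/-- The rank one operators `z ↦ ⟪y, z⟫ x`. -/
def rankOne : E →ₗ[ℂ] E →ₗ⋆[ℂ] CompactOp E :=
  LinearMap.mk₂'ₛₗ (RingHom.id ℂ) (starRingEnd ℂ)
    (fun x y => mk (InnerProductSpace.rankOne ℂ x y) (isCompactOperator_rankOne x y))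
    (fun x x' y => op_injective (by simp)) (fun c x y => op_injective (by simp))
    (fun x y y' => op_injective (by simp)) (fun c x y => op_injective (by simp))

@[simp] theorem op_rankOne (x y : E) : (rankOne x y).op = InnerProductSpace.rankOne ℂ x y := rfl

theorem norm_rankOne (x y : E) : ‖rankOne x y‖ = ‖x‖ * ‖y‖ :=
  InnerProductSpace.norm_rankOne x y

/-- Compact operators are norm limits of finite sums of rank one operators. -/
theorem exists_norm_sub_sum_rankOne_le (ϰ : CompactOp E) {ε : ℝ} (hε : 0 < ε) :
    ∃ (n : ℕ) (x y : Fin n → E), ‖ϰ - ∑ i, rankOne (x i) (y i)‖ ≤ ε := by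
  -- The image of the unit ball has a finite `ε`-net. Projecting onto its span `U` gives the
  -- approximant, written in an orthonormal basis `b` of `U` as `∑ ⟪ϰ* bᵢ, ·⟫ bᵢ`.
  have hc := ϰ.isCompactOperator.isCompact_closure_image_closedBall (f := ϰ.op.toLinearMap) 1
  obtain ⟨t, ht, htc⟩ := Metric.totallyBounded_iff.1 hc.totallyBounded ε hε
  let U : Submodule ℂ E := Submodule.span ℂ t
  have : FiniteDimensional ℂ U := FiniteDimensional.span_of_finite ℂ ht
  let b := stdOrthonormalBasis ℂ U
  refine ⟨_, fun i => (b i : E), fun i => ContinuousLinearMap.adjoint ϰ.op (b i : E), ?_⟩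
  have hop : (ϰ - ∑ i, rankOne (b i : E) (ContinuousLinearMap.adjoint ϰ.op (b i : E))).op =
      ϰ.op - U.starProjection ∘L ϰ.op := by
    rw [b.starProjection_eq_sum_rankOne, map_sub, map_sum, ContinuousLinearMap.finsetSum_comp]
    simp only [op_rankOne, rankOne_comp']
  rw [norm_def, hop]
  refine ContinuousLinearMap.opNorm_le_of_unit_norm (𝕜 := ℂ) hε.le fun v hv => ?_
  have hv' : ϰ.op v ∈ closure (ϰ.op.toLinearMap '' Metric.closedBall 0 1) :=
    subset_closure ⟨v, by simp [hv], rfl⟩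
  obtain ⟨y, hy, hyv⟩ := Set.mem_iUnion₂.1 (htc hv')
  have hyU : U.starProjection y = y :=
    Submodule.starProjection_eq_self_iff.2 (Submodule.subset_span hy)
  -- Subtracting a net point `y ∈ U` does not change the component orthogonal to `U`, so the error
  -- is at most the distance from `ϰ v` to the net.
  have e : (ϰ.op - U.starProjection ∘L ϰ.op) v = Uᗮ.starProjection (ϰ.op v - y) := by
    rw [Submodule.starProjection_orthogonal']
    simp [hyU]
  rw [e]
  refine (Uᗮ.norm_starProjection_apply_le _).trans ?_
  rw [← dist_eq_norm]
  exact (Metric.mem_ball.1 hyv).le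

/-- Continuous functionals on `𝒦(E)` are determined by their values on rank one operators. -/
theorem ext_rankOne {l m : CompactOp E →L[ℂ] ℂ}
    (h : ∀ x y, l (rankOne x y) = m (rankOne x y)) : l = m := by
  ext ϰ
  rw [← sub_eq_zero, ← norm_le_zero_iff]
  refine le_of_forall_pos_le_add fun ε hε => ?_
  -- The tolerance is `ε / (‖l - m‖ + 1)`; the added one keeps the denominator positive when `l =
  -- m`.
  obtain ⟨n, x, y, hxy⟩ := ϰ.exists_norm_sub_sum_rankOne_le
    (div_pos hε (add_pos_of_nonneg_of_pos (norm_nonneg (l - m)) one_pos))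
  have h0 : (l - m) (∑ i, rankOne (x i) (y i)) = 0 := by simp [map_sum, h]
  have h1 : l ϰ - m ϰ = (l - m) (ϰ - ∑ i, rankOne (x i) (y i)) := by
    rw [map_sub, h0, sub_zero]; rfl
  rw [h1, zero_add]
  refine ((l - m).le_opNorm _).trans ?_
  calc ‖l - m‖ * ‖ϰ - ∑ i, rankOne (x i) (y i)‖ ≤ (‖l - m‖ + 1) * (ε / (‖l - m‖ + 1)) := by
        gcongr; linarith
    _ = ε := by field_simp

end CompactOp

/-- This truncation is a coordinate projection: it keeps the Fourier coefficients indexed by `s` and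
drops the others, so Parseval's identity gives the bound. -/
theorem norm_truncation_id_le (s : Finset (onbIndex E)) :
    ‖truncation (ContinuousLinearMap.id ℂ E) s‖ ≤ 1 := by
  classical
  refine ContinuousLinearMap.opNorm_le_bound _ zero_le_one fun v => ?_
  rw [one_mul]
  have h : ∀ j, ⟪onb E j, truncation (ContinuousLinearMap.id ℂ E) s v⟫_ℂ =
      if j ∈ s then ⟪onb E j, v⟫_ℂ else 0 := fun j => by
    have ho := orthonormal_iff_ite.1 (onb E).orthonormal
    simp [truncation, ho]
  have h1 : ‖truncation (ContinuousLinearMap.id ℂ E) s v‖ₑ ^ 2 ≤ ‖v‖ₑ ^ 2 := by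
    rw [enorm_sq_eq_tsum, enorm_sq_eq_tsum v]
    refine ENNReal.tsum_le_tsum fun j => ?_
    rw [h]
    split_ifs <;> simp
  rw [← ofReal_norm, ← ofReal_norm, ← ENNReal.ofReal_pow (norm_nonneg _),
    ← ENNReal.ofReal_pow (norm_nonneg _), ENNReal.ofReal_le_ofReal_iff (by positivity)] at h1
  exact (sq_le_sq₀ (norm_nonneg _) (norm_nonneg _)).1 h1

/-- With `B` fixed, both sides are continuous in `A` for the Hilbert--Schmidt norm. On rank one
operators both are the same matrix coefficient of `B`, and finite rank operators are dense. -/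
theorem opTrace_hs_comp_comm {A : E →L[ℂ] F} {B : F →L[ℂ] E} (hA : IsHilbertSchmidt A)
    (hB : IsHilbertSchmidt B) : opTrace (A ∘L B) = opTrace (B ∘L A) := by
  let l : HilbertSchmidtOp E F →L[ℂ] ℂ := LinearMap.mkContinuous
    { toFun := fun A => opTrace (A.op ∘L B)
      map_add' := fun A A' => by
        rw [map_add, ContinuousLinearMap.add_comp]
        exact opTrace_add (A.isHilbertSchmidt.comp hB) (A'.isHilbertSchmidt.comp hB)
      map_smul' := fun c A => by
        rw [map_smul, ContinuousLinearMap.smul_comp, opTrace_smul]; rfl }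
    (hsNorm B) fun A => by
      rw [mul_comm]; exact norm_opTrace_hs_comp_le A.isHilbertSchmidt hB
  let m : HilbertSchmidtOp E F →L[ℂ] ℂ := LinearMap.mkContinuous
    { toFun := fun A => opTrace (B ∘L A.op)
      map_add' := fun A A' => by
        rw [map_add, ContinuousLinearMap.comp_add]
        exact opTrace_add (hB.comp A.isHilbertSchmidt) (hB.comp A'.isHilbertSchmidt)
      map_smul' := fun c A => by
        rw [map_smul, ContinuousLinearMap.comp_smul, opTrace_smul]; rfl }
    (hsNorm B) fun A => norm_opTrace_hs_comp_le hB A.isHilbertSchmidt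
  have h : l = m := HilbertSchmidtOp.ext_rankOne fun x y =>
    (opTrace_rankOne_comp B x y).trans (opTrace_comp_rankOne B x y).symm
  exact DFunLike.congr_fun h (.mk A hA)

/-- The same density argument, now in the trace norm and with `B` merely bounded. -/
theorem opTrace_comp_comm {A : E →L[ℂ] E} (hA : IsTraceClass A) (B : E →L[ℂ] E) :
    opTrace (A ∘L B) = opTrace (B ∘L A) := by
  let l : TraceClassOp E →L[ℂ] ℂ := LinearMap.mkContinuous
    { toFun := fun A => opTrace (A.op ∘L B)
      map_add' := fun A A' => by
        rw [map_add, ContinuousLinearMap.add_comp]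
        exact opTrace_add (A.isTraceClass.comp_clm B) (A'.isTraceClass.comp_clm B)
      map_smul' := fun c A => by
        rw [map_smul, ContinuousLinearMap.smul_comp, opTrace_smul]; rfl }
    ‖B‖ fun A => norm_opTrace_comp_le' A.isTraceClass B
  let m : TraceClassOp E →L[ℂ] ℂ := LinearMap.mkContinuous
    { toFun := fun A => opTrace (B ∘L A.op)
      map_add' := fun A A' => by
        rw [map_add, ContinuousLinearMap.comp_add]
        exact opTrace_add (A.isTraceClass.clm_comp B) (A'.isTraceClass.clm_comp B)
      map_smul' := fun c A => by
        rw [map_smul, ContinuousLinearMap.comp_smul, opTrace_smul]; rfl }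
    ‖B‖ fun A => norm_opTrace_comp_le B A.isTraceClass
  have h : l = m := TraceClassOp.ext_rankOne fun x y =>
    (opTrace_rankOne_comp B x y).trans (opTrace_comp_rankOne B x y).symm
  exact DFunLike.congr_fun h (.mk A hA)

theorem eq_zero_of_inner_eq_zero {A : E →L[ℂ] F} (h : ∀ x y, ⟪y, A x⟫_ℂ = 0) : A = 0 := by
  ext x
  exact inner_self_eq_zero.1 (h x (A x))

/-- `𝒦(E)` is a predual of `L¹(E)`. -/
theorem isPredual_compactOp :
    IsPredual fun (ϰ : CompactOp E) (ρ : TraceClassOp E) => opTrace (ϰ.op ∘L ρ.op) := by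
  refine IsPredual.of_bounds (LinearMap.mk₂ ℂ (fun ρ ϰ => opTrace (ϰ.op ∘L ρ.op))
    (fun ρ ρ' ϰ => ?_) (fun c ρ ϰ => ?_) (fun ρ ϰ ϰ' => ?_) (fun c ρ ϰ => ?_))
    (fun ρ ϰ => rfl) 1 1 (fun ρ ϰ => ?_) (fun ρ h => ?_) fun l => ?_
  · rw [map_add, ContinuousLinearMap.comp_add]
    exact opTrace_add (ρ.isTraceClass.clm_comp _) (ρ'.isTraceClass.clm_comp _)
  · rw [map_smul, ContinuousLinearMap.comp_smul, opTrace_smul]; rfl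
  · rw [map_add, ContinuousLinearMap.add_comp]
    exact opTrace_add (ρ.isTraceClass.clm_comp _) (ρ.isTraceClass.clm_comp _)
  · rw [map_smul, ContinuousLinearMap.smul_comp, opTrace_smul]; rfl
  · rw [one_mul, mul_comm]
    exact norm_opTrace_comp_le _ ρ.isTraceClass
  · refine TraceClassOp.op_injective ?_
    rw [map_zero]
    refine eq_zero_of_inner_eq_zero fun x y => ?_
    rw [← opTrace_rankOne_comp]
    exact h (CompactOp.rankOne x y)
  obtain ⟨A, hA, -⟩ := exists_clm_of_rankOne CompactOp.rankOne
    (fun x y => (CompactOp.norm_rankOne x y).le) l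
  obtain ⟨W, hW, hWA⟩ := exists_abs_eq A
  have hpos : ∀ x, 0 ≤ RCLike.re ⟪x, CFC.abs A x⟫_ℂ := fun x => by
    rw [← sqrtAbs_mul_self, mul_apply_eq_comp, ← ContinuousLinearMap.adjoint_inner_left,
      adjoint_sqrtAbs]
    exact inner_self_nonneg
  -- With `|A| = W A`, a partial sum of `tr |A|` is the real part of `l T`, where `T` is a
  -- coordinate projection times `W`. As `‖T‖ ≤ 1`, every partial sum is at most `‖l‖`.
  have hle : traceAbs A ≤ ENNReal.ofReal ‖l‖ := by
    refine ENNReal.summable.tsum_le_of_sum_le fun s => ?_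
    rw [← ENNReal.ofReal_sum_of_nonneg fun i _ => hpos _]
    refine ENNReal.ofReal_le_ofReal ?_
    let T : CompactOp E :=
      ∑ i ∈ s, CompactOp.rankOne (onb E i) (ContinuousLinearMap.adjoint W (onb E i))
    have hT : T.op = truncation (ContinuousLinearMap.id ℂ E) s ∘L W := by
      rw [map_sum, truncation, ContinuousLinearMap.finsetSum_comp]
      exact Finset.sum_congr rfl fun i _ => (rankOne_comp' _ _ _).symm
    have h1 : ∑ i ∈ s, RCLike.re ⟪onb E i, CFC.abs A (onb E i)⟫_ℂ = RCLike.re (l T) := by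
      rw [map_sum, map_sum]
      refine Finset.sum_congr rfl fun i _ => ?_
      rw [← hA, hWA, ContinuousLinearMap.adjoint_inner_left]
      rfl
    have h2 : ‖T‖ ≤ 1 := by
      rw [CompactOp.norm_def, hT]
      refine (ContinuousLinearMap.opNorm_comp_le _ _).trans ?_
      exact mul_le_one₀ (norm_truncation_id_le s) (norm_nonneg _) (norm_le_one_of_enorm hW)
    rw [h1]
    refine (RCLike.re_le_norm _).trans ((l.le_opNorm T).trans ?_)
    exact mul_le_of_le_one_right (norm_nonneg _) h2
  have hA1 : IsTraceClass A := ne_top_of_le_ne_top ENNReal.ofReal_ne_top hle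
  refine ⟨.mk A hA1, fun ϰ => ?_, ?_⟩
  · let m : CompactOp E →L[ℂ] ℂ := LinearMap.mkContinuous
      { toFun := fun ϰ => opTrace (ϰ.op ∘L A)
        map_add' := fun ϰ ϰ' => by
          rw [map_add, ContinuousLinearMap.add_comp]
          exact opTrace_add (hA1.clm_comp _) (hA1.clm_comp _)
        map_smul' := fun c ϰ => by
          rw [map_smul, ContinuousLinearMap.smul_comp, opTrace_smul]; rfl }
      (traceNorm A) fun ϰ => by
        rw [mul_comm]; exact norm_opTrace_comp_le _ hA1
    have h : l = m := CompactOp.ext_rankOne fun x y => by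
      rw [← hA]; exact (opTrace_rankOne_comp A x y).symm
    exact DFunLike.congr_fun h ϰ
  · rw [one_mul]
    have := ENNReal.toReal_mono ENNReal.ofReal_ne_top hle
    rwa [ENNReal.toReal_ofReal (norm_nonneg _)] at this

/-- `L¹(E)` is a predual of `L^∞(E)`. -/
theorem isPredual_traceClassOp :
    IsPredual fun (σ : TraceClassOp E) (X : E →L[ℂ] E) => opTrace (σ.op ∘L X) := by
  refine IsPredual.of_bounds (LinearMap.mk₂ ℂ (fun X σ => opTrace (σ.op ∘L X))
    (fun X X' σ => ?_) (fun c X σ => ?_) (fun X σ σ' => ?_) (fun c X σ => ?_))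
    (fun X σ => rfl) 1 1 (fun X σ => ?_) (fun X h => ?_) fun l => ?_
  · rw [ContinuousLinearMap.comp_add]
    exact opTrace_add (σ.isTraceClass.comp_clm _) (σ.isTraceClass.comp_clm _)
  · rw [ContinuousLinearMap.comp_smul, opTrace_smul]; rfl
  · rw [map_add, ContinuousLinearMap.add_comp]
    exact opTrace_add (σ.isTraceClass.comp_clm _) (σ'.isTraceClass.comp_clm _)
  · rw [map_smul, ContinuousLinearMap.smul_comp, opTrace_smul]; rfl
  · rw [one_mul]
    exact norm_opTrace_comp_le' σ.isTraceClass X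
  · refine eq_zero_of_inner_eq_zero fun x y => ?_
    rw [← opTrace_rankOne_comp]
    exact h (TraceClassOp.rankOne x y)
  -- Every bounded operator is admissible here, so the operator read off from rank one elements
  -- needs no further regularity.
  obtain ⟨X, hX, hle⟩ := exists_clm_of_rankOne TraceClassOp.rankOne
    TraceClassOp.norm_rankOne_le l
  refine ⟨X, fun σ => ?_, by rwa [one_mul]⟩
  let m : TraceClassOp E →L[ℂ] ℂ := LinearMap.mkContinuous
    { toFun := fun σ => opTrace (σ.op ∘L X)
      map_add' := fun σ σ' => by
        rw [map_add, ContinuousLinearMap.add_comp]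
        exact opTrace_add (σ.isTraceClass.comp_clm _) (σ'.isTraceClass.comp_clm _)
      map_smul' := fun c σ => by
        rw [map_smul, ContinuousLinearMap.smul_comp, opTrace_smul]; rfl }
    ‖X‖ fun σ => norm_opTrace_comp_le' σ.isTraceClass X
  have h : l = m := TraceClassOp.ext_rankOne fun x y => by
    rw [← hX]; exact (opTrace_rankOne_comp X x y).symm
  exact DFunLike.congr_fun h σ

/-- `L²(E, F)` is a predual of `L²(F, E)`. -/
theorem isPredual_hilbertSchmidtOp :
    IsPredual fun (A : HilbertSchmidtOp E F) (B : HilbertSchmidtOp F E) =>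
      opTrace (A.op ∘L B.op) := by
  refine IsPredual.of_bounds (LinearMap.mk₂ ℂ (fun B A => opTrace (A.op ∘L B.op))
    (fun B B' A => ?_) (fun c B A => ?_) (fun B A A' => ?_) (fun c B A => ?_))
    (fun B A => rfl) 1 1 (fun B A => ?_) (fun B h => ?_) fun l => ?_
  · rw [map_add, ContinuousLinearMap.comp_add]
    exact opTrace_add (A.isHilbertSchmidt.comp B.isHilbertSchmidt)
      (A.isHilbertSchmidt.comp B'.isHilbertSchmidt)
  · rw [map_smul, ContinuousLinearMap.comp_smul, opTrace_smul]; rfl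
  · rw [map_add, ContinuousLinearMap.add_comp]
    exact opTrace_add (A.isHilbertSchmidt.comp B.isHilbertSchmidt)
      (A'.isHilbertSchmidt.comp B.isHilbertSchmidt)
  · rw [map_smul, ContinuousLinearMap.smul_comp, opTrace_smul]; rfl
  · rw [one_mul, mul_comm]
    exact norm_opTrace_hs_comp_le A.isHilbertSchmidt B.isHilbertSchmidt
  · refine HilbertSchmidtOp.op_injective ?_
    rw [map_zero]
    refine eq_zero_of_inner_eq_zero fun x y => ?_
    rw [← opTrace_rankOne_comp]
    exact h (HilbertSchmidtOp.rankOne x y)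
  obtain ⟨B, hB, -⟩ := exists_clm_of_rankOne (HilbertSchmidtOp.rankOne (E := E) (F := F))
    (fun x y => (HilbertSchmidtOp.norm_rankOne x y).le) l
  have hle : hsSq B ≤ ENNReal.ofReal ‖l‖ ^ 2 := by
    refine ENNReal.summable.tsum_le_of_sum_le fun s => ?_
    -- `T` is the adjoint of a truncation of `B`, chosen so that `re (l T) = ‖T‖₂²`. Then `‖T‖₂² ≤
    -- ‖l‖ ‖T‖₂` bounds the partial sums of `‖B‖₂²` by `‖l‖²`.
    let T : HilbertSchmidtOp E F := ∑ i ∈ s, HilbertSchmidtOp.rankOne (onb F i) (B (onb F i))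
    have hT : T.op = ContinuousLinearMap.adjoint (truncation B s) := by
      rw [map_sum, truncation, map_sum]
      exact Finset.sum_congr rfl fun i _ => by simp
    have h1 : ∑ i ∈ s, ‖B (onb F i)‖ ^ 2 = RCLike.re (l T) := by
      rw [map_sum, map_sum]
      refine Finset.sum_congr rfl fun i _ => ?_
      rw [← hB, inner_self_eq_norm_sq]
    have h2 : ‖T‖ ^ 2 = ∑ i ∈ s, ‖B (onb F i)‖ ^ 2 := by
      rw [HilbertSchmidtOp.norm_def, hT, hsNorm_adjoint, hsNorm,
        Real.sq_sqrt ENNReal.toReal_nonneg, hsSq_truncation, ENNReal.toReal_sum]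
      · simp
      · simp
    have h3 : ‖T‖ ^ 2 ≤ ‖l‖ * ‖T‖ := by
      rw [h2, h1]
      exact (RCLike.re_le_norm _).trans (l.le_opNorm T)
    have h4 : ‖T‖ ≤ ‖l‖ := by
      rcases eq_or_lt_of_le (norm_nonneg T) with h0 | h0
      · rw [← h0]; exact norm_nonneg l
      · exact le_of_mul_le_mul_right (by linarith [sq ‖T‖]) h0
    have h5 : ∑ i ∈ s, ‖B (onb F i)‖ₑ ^ 2 = ENNReal.ofReal (‖T‖ ^ 2) := by
      rw [h2, ENNReal.ofReal_sum_of_nonneg fun i _ => by positivity]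
      exact Finset.sum_congr rfl fun i _ => by
        rw [ENNReal.ofReal_pow (norm_nonneg _), ofReal_norm]
    rw [h5, ENNReal.ofReal_pow (norm_nonneg _)]
    gcongr
  have hB1 : IsHilbertSchmidt B := ne_top_of_le_ne_top (by simp) hle
  refine ⟨.mk B hB1, fun A => ?_, ?_⟩
  · let m : HilbertSchmidtOp E F →L[ℂ] ℂ := LinearMap.mkContinuous
      { toFun := fun A => opTrace (A.op ∘L B)
        map_add' := fun A A' => by
          rw [map_add, ContinuousLinearMap.add_comp]
          exact opTrace_add (A.isHilbertSchmidt.comp hB1) (A'.isHilbertSchmidt.comp hB1)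
        map_smul' := fun c A => by
          rw [map_smul, ContinuousLinearMap.smul_comp, opTrace_smul]; rfl }
      (hsNorm B) fun A => by
        rw [mul_comm]; exact norm_opTrace_hs_comp_le A.isHilbertSchmidt hB1
    have h : l = m := HilbertSchmidtOp.ext_rankOne fun x y => by
      rw [← hB]; exact (opTrace_rankOne_comp B x y).symm
    exact DFunLike.congr_fun h A
  · rw [one_mul]
    exact hsNorm_le_of_hsSq_le (norm_nonneg _) hle

instance : CompleteSpace (TraceClassOp E) := isPredual_compactOp.completeSpace

instance : CompleteSpace (HilbertSchmidtOp E F) := isPredual_hilbertSchmidtOp.completeSpace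

end OperatorDuality

theorem exists_clm_bilinear {V W Z : Type*} [NormedAddCommGroup V] [NormedSpace ℂ V]
    [NormedAddCommGroup W] [NormedSpace ℂ W] [NormedAddCommGroup Z] [NormedSpace ℂ Z]
    (f : V → W → Z) (h1 : ∀ x x' y, f (x + x') y = f x y + f x' y)
    (h2 : ∀ (c : ℂ) x y, f (c • x) y = c • f x y)
    (h3 : ∀ x y y', f x (y + y') = f x y + f x y')
    (h4 : ∀ (c : ℂ) x y, f x (c • y) = c • f x y) (C : ℝ)
    (hC : ∀ x y, ‖f x y‖ ≤ C * ‖x‖ * ‖y‖) : ∃ T : V →L[ℂ] W →L[ℂ] Z, ∀ x y, T x y = f x y :=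
  ⟨(LinearMap.mk₂ ℂ f h1 h2 h3 h4).mkContinuous₂ C hC, fun _ _ => rfl⟩

/-! ### Block decompositions of `𝔞` and `𝔥`, and their duality. -/

section Blocks

variable {H : Type*} [NormedAddCommGroup H] [InnerProductSpace ℂ H] [CompleteSpace H]

namespace HilbertSub

@[simp] theorem proj_incl (U : Submodule ℂ H) [U.HasOrthogonalProjection] (x : HilbertSub U) :
    proj U (incl U x) = x :=
  Submodule.orthogonalProjectionOnto_mem_subspace_eq_self (K := U) x

theorem proj_eq_zero (U : Submodule ℂ H) [U.HasOrthogonalProjection] {x : H} (hx : x ∈ Uᗮ) :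
    proj U x = 0 :=
  Submodule.orthogonalProjectionOnto_eq_zero_iff.2 hx

variable (K : Submodule ℂ H) [CompleteSpace K]

@[simp] theorem proj_incl_orthogonal (x : HilbertSub Kᗮ) : proj K (incl Kᗮ x) = 0 :=
  proj_eq_zero K (show Kᗮ from x).2

@[simp] theorem proj_orthogonal_incl (x : HilbertSub K) : proj Kᗮ (incl K x) = 0 :=
  proj_eq_zero Kᗮ (K.le_orthogonal_orthogonal (show K from x).2)

end HilbertSub

variable (K : Submodule ℂ H) [CompleteSpace K]

/-- The operator on `H` with given blocks with respect to `H = K ⊕ Kᗮ`. -/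
def ofBlocks (a : HilbertSub K →L[ℂ] HilbertSub K) (d : HilbertSub Kᗮ →L[ℂ] HilbertSub Kᗮ)
    (b : HilbertSub Kᗮ →L[ℂ] HilbertSub K) (c : HilbertSub K →L[ℂ] HilbertSub Kᗮ) : H →L[ℂ] H :=
  embBlock K K a + embBlock Kᗮ Kᗮ d + embBlock K Kᗮ b + embBlock Kᗮ K c

variable (a : HilbertSub K →L[ℂ] HilbertSub K) (d : HilbertSub Kᗮ →L[ℂ] HilbertSub Kᗮ)
  (b : HilbertSub Kᗮ →L[ℂ] HilbertSub K) (c : HilbertSub K →L[ℂ] HilbertSub Kᗮ)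

@[simp] theorem block_pp_ofBlocks : block K K (ofBlocks K a d b c) = a := by
  ext x; simp [block, ofBlocks, embBlock]

@[simp] theorem block_mm_ofBlocks : block Kᗮ Kᗮ (ofBlocks K a d b c) = d := by
  ext x; simp [block, ofBlocks, embBlock]

@[simp] theorem block_pm_ofBlocks : block K Kᗮ (ofBlocks K a d b c) = b := by
  ext x; simp [block, ofBlocks, embBlock]

@[simp] theorem block_mp_ofBlocks : block Kᗮ K (ofBlocks K a d b c) = c := by
  ext x; simp [block, ofBlocks, embBlock]

variable {K} in
theorem ext_blocks {X Y : H →L[ℂ] H} (h1 : block K K X = block K K Y)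
    (h2 : block Kᗮ Kᗮ X = block Kᗮ Kᗮ Y) (h3 : block K Kᗮ X = block K Kᗮ Y)
    (h4 : block Kᗮ K X = block Kᗮ K Y) : X = Y := by
  rw [← sub_eq_zero]
  refine eq_zero_of_blocks K ?_ ?_ ?_ ?_ <;> rw [block_sub, sub_eq_zero] <;> assumption

theorem ofBlocks_block (X : H →L[ℂ] H) :
    ofBlocks K (block K K X) (block Kᗮ Kᗮ X) (block K Kᗮ X) (block Kᗮ K X) = X :=
  ext_blocks (block_pp_ofBlocks K _ _ _ _) (block_mm_ofBlocks K _ _ _ _)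
    (block_pm_ofBlocks K _ _ _ _) (block_mp_ofBlocks K _ _ _ _)

variable {K}

namespace RestrictedPredual

/-- The element of `L¹(H, H₊)` with given blocks. -/
def ofBlocks (a : TraceClassOp (HilbertSub K)) (d : TraceClassOp (HilbertSub Kᗮ))
    (b : HilbertSchmidtOp (HilbertSub Kᗮ) (HilbertSub K))
    (c : HilbertSchmidtOp (HilbertSub K) (HilbertSub Kᗮ)) : RestrictedPredual K :=
  ⟨_root_.ofBlocks K a.op d.op b.op c.op, by
    refine ⟨?_, ?_, ?_, ?_⟩ <;> simp
    exacts [a.isTraceClass, d.isTraceClass, b.isHilbertSchmidt, c.isHilbertSchmidt]⟩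

theorem op_ofBlocks (a : TraceClassOp (HilbertSub K)) (d : TraceClassOp (HilbertSub Kᗮ))
    (b : HilbertSchmidtOp (HilbertSub Kᗮ) (HilbertSub K))
    (c : HilbertSchmidtOp (HilbertSub K) (HilbertSub Kᗮ)) :
    (ofBlocks a d b c).op = _root_.ofBlocks K a.op d.op b.op c.op := rfl

variable (K) in
/-- `L¹(H, H₊)` as a product of spaces of blocks. -/
def equivBlocks : RestrictedPredual K ≃L[ℂ]
    (TraceClassOp (HilbertSub K) × TraceClassOp (HilbertSub Kᗮ)) ×
    (HilbertSchmidtOp (HilbertSub Kᗮ) (HilbertSub K) ×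
      HilbertSchmidtOp (HilbertSub K) (HilbertSub Kᗮ)) :=
  -- A product carries the maximum norm and `𝔞` the sum of four block norms, hence the constants 1
  -- and 4.
  LinearEquiv.toContinuousLinearEquivOfBounds
    { toFun := fun σ => ((.mk _ σ.tc_pp, .mk _ σ.tc_mm), (.mk _ σ.hs_pm, .mk _ σ.hs_mp))
      map_add' := fun σ τ => Prod.ext
        (Prod.ext (TraceClassOp.op_injective (by simp [block_add]))
          (TraceClassOp.op_injective (by simp [block_add])))
        (Prod.ext (HilbertSchmidtOp.op_injective (by simp [block_add]))
          (HilbertSchmidtOp.op_injective (by simp [block_add])))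
      map_smul' := fun c σ => Prod.ext
        (Prod.ext (TraceClassOp.op_injective (by simp [block_smul]))
          (TraceClassOp.op_injective (by simp [block_smul])))
        (Prod.ext (HilbertSchmidtOp.op_injective (by simp [block_smul]))
          (HilbertSchmidtOp.op_injective (by simp [block_smul])))
      invFun := fun p => ofBlocks p.1.1 p.1.2 p.2.1 p.2.2
      left_inv := fun σ => op_injective (ofBlocks_block K σ.op)
      right_inv := fun p => Prod.ext
        (Prod.ext (TraceClassOp.op_injective (by simp [op_ofBlocks]))
          (TraceClassOp.op_injective (by simp [op_ofBlocks])))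
        (Prod.ext (HilbertSchmidtOp.op_injective (by simp [op_ofBlocks]))
          (HilbertSchmidtOp.op_injective (by simp [op_ofBlocks]))) } 1 4
    (fun σ => by
      have h1 := traceNorm_nonneg (block K K σ.op)
      have h2 := traceNorm_nonneg (block Kᗮ Kᗮ σ.op)
      have h3 := hsNorm_nonneg (block K Kᗮ σ.op)
      have h4 := hsNorm_nonneg (block Kᗮ K σ.op)
      rw [one_mul, norm_def]
      refine max_le (max_le ?_ ?_) (max_le ?_ ?_)
      · change traceNorm (block K K σ.op) ≤ _
        linarith
      · change traceNorm (block Kᗮ Kᗮ σ.op) ≤ _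
        linarith
      · change hsNorm (block K Kᗮ σ.op) ≤ _
        linarith
      · change hsNorm (block Kᗮ K σ.op) ≤ _
        linarith)
    (fun p => by
      have e : ‖ofBlocks p.1.1 p.1.2 p.2.1 p.2.2‖ = ‖p.1.1‖ + ‖p.1.2‖ + ‖p.2.1‖ + ‖p.2.2‖ := by
        rw [norm_def, op_ofBlocks, block_pp_ofBlocks, block_mm_ofBlocks, block_pm_ofBlocks,
          block_mp_ofBlocks]
        rfl
      change ‖ofBlocks p.1.1 p.1.2 p.2.1 p.2.2‖ ≤ _
      rw [e]
      linarith [(norm_fst_le p.1).trans (norm_fst_le p), (norm_snd_le p.1).trans (norm_fst_le p),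
        (norm_fst_le p.2).trans (norm_snd_le p), (norm_snd_le p.2).trans (norm_snd_le p)])

instance : CompleteSpace (RestrictedPredual K) :=
  (completeSpace_congr (e := (equivBlocks K).toLinearEquiv.toEquiv)
    (equivBlocks K).isUniformEmbedding).2 inferInstance

end RestrictedPredual

namespace RestrictedLie

variable (K) in
/-- `L^∞(H, H₊)` as a product of spaces of blocks. -/
def equivBlocks : RestrictedLie K ≃L[ℂ]
    ((HilbertSub K →L[ℂ] HilbertSub K) × (HilbertSub Kᗮ →L[ℂ] HilbertSub Kᗮ)) ×
    (HilbertSchmidtOp (HilbertSub K) (HilbertSub Kᗮ) ×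
      HilbertSchmidtOp (HilbertSub Kᗮ) (HilbertSub K)) :=
  LinearEquiv.toContinuousLinearEquivOfBounds
    -- The off-diagonal blocks are listed in the opposite order to those of `𝔞`, because `σ₊₋` pairs
    -- with `X₋₊`.
    { toFun := fun X => ((block K K X.op, block Kᗮ Kᗮ X.op), (.mk _ X.hs_mp, .mk _ X.hs_pm))
      map_add' := fun X Y => Prod.ext
        (Prod.ext (by simp [block_add]) (by simp [block_add]))
        (Prod.ext (HilbertSchmidtOp.op_injective (by simp [block_add]))
          (HilbertSchmidtOp.op_injective (by simp [block_add])))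
      map_smul' := fun c X => Prod.ext
        (Prod.ext (by simp [block_smul]) (by simp [block_smul]))
        (Prod.ext (HilbertSchmidtOp.op_injective (by simp [block_smul]))
          (HilbertSchmidtOp.op_injective (by simp [block_smul])))
      invFun := fun p => ⟨ofBlocks K p.1.1 p.1.2 p.2.2.op p.2.1.op, by
        refine ⟨?_, ?_⟩ <;> simp
        exacts [p.2.2.isHilbertSchmidt, p.2.1.isHilbertSchmidt]⟩
      left_inv := fun X => op_injective (ofBlocks_block K X.op)
      right_inv := fun p => Prod.ext
        (Prod.ext (block_pp_ofBlocks K _ _ _ _) (block_mm_ofBlocks K _ _ _ _))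
        (Prod.ext (HilbertSchmidtOp.op_injective (block_mp_ofBlocks K _ _ _ _))
          (HilbertSchmidtOp.op_injective (block_pm_ofBlocks K _ _ _ _))) } 1 4
    (fun X => by
      have h1 := norm_nonneg (block K K X.op)
      have h2 := norm_nonneg (block Kᗮ Kᗮ X.op)
      have h3 := hsNorm_nonneg (block K Kᗮ X.op)
      have h4 := hsNorm_nonneg (block Kᗮ K X.op)
      rw [one_mul, norm_def]
      refine max_le (max_le ?_ ?_) (max_le ?_ ?_)
      · change ‖block K K X.op‖ ≤ _
        linarith
      · change ‖block Kᗮ Kᗮ X.op‖ ≤ _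
        linarith
      · change hsNorm (block Kᗮ K X.op) ≤ _
        linarith
      · change hsNorm (block K Kᗮ X.op) ≤ _
        linarith)
    (fun p => by
      have e : ∀ X : RestrictedLie K, X.op = ofBlocks K p.1.1 p.1.2 p.2.2.op p.2.1.op →
          ‖X‖ = ‖p.1.1‖ + ‖p.1.2‖ + ‖p.2.2‖ + ‖p.2.1‖ := fun X hX => by
        rw [norm_def, hX, block_pp_ofBlocks, block_mm_ofBlocks, block_pm_ofBlocks,
          block_mp_ofBlocks]
        rfl
      rw [e _ rfl]
      linarith [(norm_fst_le p.1).trans (norm_fst_le p), (norm_snd_le p.1).trans (norm_fst_le p),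
        (norm_fst_le p.2).trans (norm_snd_le p), (norm_snd_le p.2).trans (norm_snd_le p)])

end RestrictedLie

theorem isPredual_pairC : IsPredual (pairC (K := K)) := isPredual_compactOp

/-- In block coordinates the pairing is a sum of four trace pairings: two of type `L¹`--`L^∞` on the
diagonal, two of type `L²`--`L²` off it. -/
theorem isPredual_pairA : IsPredual (pairA (K := K)) :=
  ((isPredual_traceClassOp.prod isPredual_traceClassOp).prod
    (isPredual_hilbertSchmidtOp.prod isPredual_hilbertSchmidtOp)).congr
    (RestrictedPredual.equivBlocks K) (RestrictedLie.equivBlocks K) fun σ X => by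
      rw [pairA, add_assoc]
      rfl

instance : CompleteSpace (RestrictedLie K) := isPredual_pairA.completeSpace

end Blocks

/-! ### The Banach Lie algebras `𝔫`, `𝔥`, `𝔤` and the cocycle identities. -/

section LieAlgebras

variable {H : Type*} [NormedAddCommGroup H] [InnerProductSpace ℂ H] [CompleteSpace H]
variable {K : Submodule ℂ H} [CompleteSpace K]

theorem op_nBracket (ρ ρ' : TraceClassOp (HilbertSub K)) :
    (nBracket ρ ρ').op = -(ρ.op ∘L ρ'.op - ρ'.op ∘L ρ.op) := rfl

theorem op_phi (X : RestrictedLie K) (ρ : TraceClassOp (HilbertSub K)) :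
    (phi X ρ).op = block K K X.op ∘L ρ.op - ρ.op ∘L block K K X.op := rfl

theorem op_omega (X X' : RestrictedLie K) : (omega X X').op =
    block K Kᗮ X.op ∘L block Kᗮ K X'.op - block K Kᗮ X'.op ∘L block Kᗮ K X.op := rfl

namespace RestrictedLie

theorem op_bracket (X Y : RestrictedLie K) :
    (X.bracket Y).op = X.op * Y.op - Y.op * X.op := rfl

/-- The product of `L^∞(H, H₊)`. -/
def mul (X Y : RestrictedLie K) : RestrictedLie K := ⟨X.op * Y.op, mul_mem X.2 Y.2⟩

theorem op_mul (X Y : RestrictedLie K) : (X.mul Y).op = X.op * Y.op := rfl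

theorem bracket_eq (X Y : RestrictedLie K) : X.bracket Y = X.mul Y - Y.mul X :=
  op_injective (by rw [map_sub]; rfl)

theorem norm_block_pp_le (X : RestrictedLie K) : ‖block K K X.op‖ ≤ ‖X‖ := by
  rw [norm_def]
  linarith [norm_nonneg (block Kᗮ Kᗮ X.op), hsNorm_nonneg (block K Kᗮ X.op),
    hsNorm_nonneg (block Kᗮ K X.op)]

theorem hsNorm_block_pm_le (X : RestrictedLie K) : hsNorm (block K Kᗮ X.op) ≤ ‖X‖ := by
  rw [norm_def]
  linarith [norm_nonneg (block K K X.op), norm_nonneg (block Kᗮ Kᗮ X.op),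
    hsNorm_nonneg (block Kᗮ K X.op)]

theorem hsNorm_block_mp_le (X : RestrictedLie K) : hsNorm (block Kᗮ K X.op) ≤ ‖X‖ := by
  rw [norm_def]
  linarith [norm_nonneg (block K K X.op), norm_nonneg (block Kᗮ Kᗮ X.op),
    hsNorm_nonneg (block K Kᗮ X.op)]

/-- Block multiplication, with `‖·‖_∞ ≤ ‖·‖₂` used where two off-diagonal blocks contribute to a
diagonal one. Continuity of the commutator follows. -/
theorem norm_mul_le (X Y : RestrictedLie K) : ‖X.mul Y‖ ≤ ‖X‖ * ‖Y‖ := by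
  have h1 : ‖block K K (X.mul Y).op‖ ≤ ‖block K K X.op‖ * ‖block K K Y.op‖ +
      hsNorm (block K Kᗮ X.op) * hsNorm (block Kᗮ K Y.op) := by
    rw [op_mul, block_mul K K K]
    refine (norm_add_le _ _).trans (add_le_add (ContinuousLinearMap.opNorm_comp_le _ _)
      ((ContinuousLinearMap.opNorm_comp_le _ _).trans ?_))
    exact mul_le_mul (norm_le_hsNorm X.hs_pm) (norm_le_hsNorm Y.hs_mp) (norm_nonneg _)
      (hsNorm_nonneg _)
  have h2 : ‖block Kᗮ Kᗮ (X.mul Y).op‖ ≤ hsNorm (block Kᗮ K X.op) * hsNorm (block K Kᗮ Y.op) +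
      ‖block Kᗮ Kᗮ X.op‖ * ‖block Kᗮ Kᗮ Y.op‖ := by
    rw [op_mul, block_mul Kᗮ Kᗮ K]
    refine (norm_add_le _ _).trans (add_le_add ((ContinuousLinearMap.opNorm_comp_le _ _).trans ?_)
      (ContinuousLinearMap.opNorm_comp_le _ _))
    exact mul_le_mul (norm_le_hsNorm X.hs_mp) (norm_le_hsNorm Y.hs_pm) (norm_nonneg _)
      (hsNorm_nonneg _)
  have h3 : hsNorm (block K Kᗮ (X.mul Y).op) ≤ ‖block K K X.op‖ * hsNorm (block K Kᗮ Y.op) +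
      ‖block Kᗮ Kᗮ Y.op‖ * hsNorm (block K Kᗮ X.op) := by
    rw [op_mul, block_mul K Kᗮ K]
    exact (hsNorm_add_le (Y.hs_pm.clm_comp _) (X.hs_pm.comp_clm _)).trans
      (add_le_add (hsNorm_clm_comp_le Y.hs_pm _) (hsNorm_comp_clm_le X.hs_pm _))
  have h4 : hsNorm (block Kᗮ K (X.mul Y).op) ≤ ‖block K K Y.op‖ * hsNorm (block Kᗮ K X.op) +
      ‖block Kᗮ Kᗮ X.op‖ * hsNorm (block Kᗮ K Y.op) := by
    rw [op_mul, block_mul Kᗮ K K]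
    exact (hsNorm_add_le (X.hs_mp.comp_clm _) (Y.hs_mp.clm_comp _)).trans
      (add_le_add (hsNorm_comp_clm_le X.hs_mp _) (hsNorm_clm_comp_le Y.hs_mp _))
  have a := norm_nonneg (block K K X.op)
  have d := norm_nonneg (block Kᗮ Kᗮ X.op)
  have b := hsNorm_nonneg (block K Kᗮ X.op)
  have c := hsNorm_nonneg (block Kᗮ K X.op)
  have a' := norm_nonneg (block K K Y.op)
  have d' := norm_nonneg (block Kᗮ Kᗮ Y.op)
  have b' := hsNorm_nonneg (block K Kᗮ Y.op)
  have c' := hsNorm_nonneg (block Kᗮ K Y.op)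
  rw [norm_def, norm_def X, norm_def Y]
  -- Of the sixteen products of block norms in `‖X‖ ‖Y‖`, the four estimates use eight; the other
  -- eight are nonnegative.
  linarith [mul_nonneg a d', mul_nonneg a c', mul_nonneg d a', mul_nonneg d b', mul_nonneg b a',
    mul_nonneg b b', mul_nonneg c c', mul_nonneg c d']

theorem exists_bracket_clm : ∃ T : RestrictedLie K →L[ℂ] RestrictedLie K →L[ℂ] RestrictedLie K,
    ∀ X Y, T X Y = X.bracket Y := by
  refine exists_clm_bilinear _ (fun X X' Y => op_injective ?_) (fun c X Y => op_injective ?_)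
    (fun X Y Y' => op_injective ?_) (fun c X Y => op_injective ?_) 2 fun X Y => ?_
  · simp only [op_bracket, map_add]; noncomm_ring
  · simp only [op_bracket, map_smul, smul_mul_assoc, mul_smul_comm, smul_sub]
  · simp only [op_bracket, map_add]; noncomm_ring
  · simp only [op_bracket, map_smul, smul_mul_assoc, mul_smul_comm, smul_sub]
  · rw [bracket_eq]
    linarith [norm_sub_le (X.mul Y) (Y.mul X), norm_mul_le X Y, norm_mul_le Y X]

theorem isBanachLieAlgebra : IsBanachLieAlgebra (bracket (K := K)) where
  complete := inferInstance
  continuous_bilinear := exists_bracket_clm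
  alternating X := op_injective (by simp [op_bracket])
  jacobi X Y Z := op_injective (by simp only [op_bracket, map_add, map_zero]; noncomm_ring)

end RestrictedLie

/-- A commutator with a trace class operator is bounded in the trace norm. -/
theorem traceNorm_commutator_le {E : Type*} [NormedAddCommGroup E] [InnerProductSpace ℂ E]
    [CompleteSpace E] (a : E →L[ℂ] E) {A : E →L[ℂ] E} (hA : IsTraceClass A) :
    traceNorm (a ∘L A - A ∘L a) ≤ 2 * ‖a‖ * traceNorm A := by
  rw [sub_eq_add_neg]
  refine (traceNorm_add_le (hA.clm_comp a) (hA.comp_clm a).neg).trans ?_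
  rw [traceNorm_neg (hA.comp_clm a)]
  linarith [traceNorm_clm_comp_le a hA, traceNorm_comp_clm_le a hA]

theorem exists_nBracket_clm : ∃ T : TraceClassOp (HilbertSub K) →L[ℂ]
    TraceClassOp (HilbertSub K) →L[ℂ] TraceClassOp (HilbertSub K),
    ∀ ρ ρ', T ρ ρ' = nBracket ρ ρ' := by
  refine exists_clm_bilinear _ (fun ρ ρ' τ => TraceClassOp.op_injective ?_)
    (fun c ρ τ => TraceClassOp.op_injective ?_) (fun ρ τ τ' => TraceClassOp.op_injective ?_)
    (fun c ρ τ => TraceClassOp.op_injective ?_) 2 fun ρ ρ' => ?_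
  · simp only [op_nBracket, map_add, ContinuousLinearMap.add_comp, ContinuousLinearMap.comp_add]
    abel
  · simp only [op_nBracket, map_smul, ContinuousLinearMap.smul_comp,
      ContinuousLinearMap.comp_smul, smul_sub, smul_neg]
  · simp only [op_nBracket, map_add, ContinuousLinearMap.add_comp, ContinuousLinearMap.comp_add]
    abel
  · simp only [op_nBracket, map_smul, ContinuousLinearMap.smul_comp,
      ContinuousLinearMap.comp_smul, smul_sub, smul_neg]
  · rw [TraceClassOp.norm_def, TraceClassOp.norm_def, TraceClassOp.norm_def, op_nBracket,
      traceNorm_neg ((ρ'.isTraceClass.clm_comp _).sub (ρ'.isTraceClass.comp_clm _))]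
    have h := traceNorm_nonneg ρ'.op
    refine (traceNorm_commutator_le ρ.op ρ'.isTraceClass).trans ?_
    gcongr
    exact norm_le_traceNorm ρ.isTraceClass

theorem isBanachLieAlgebra_nBracket : IsBanachLieAlgebra (nBracket (K := K)) where
  complete := inferInstance
  continuous_bilinear := exists_nBracket_clm
  alternating ρ := TraceClassOp.op_injective (by simp [op_nBracket])
  jacobi ρ ρ' ρ'' := TraceClassOp.op_injective (by
    simp only [op_nBracket, map_add, map_zero, ContinuousLinearMap.neg_comp,
      ContinuousLinearMap.comp_neg, ContinuousLinearMap.sub_comp, ContinuousLinearMap.comp_sub,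
      ContinuousLinearMap.comp_assoc]
    abel)

theorem exists_phi_clm : ∃ Φ : RestrictedLie K →L[ℂ] TraceClassOp (HilbertSub K) →L[ℂ]
    TraceClassOp (HilbertSub K), ∀ X ρ, Φ X ρ = phi X ρ := by
  refine exists_clm_bilinear _ (fun ρ ρ' τ => TraceClassOp.op_injective ?_)
    (fun c ρ τ => TraceClassOp.op_injective ?_) (fun ρ τ τ' => TraceClassOp.op_injective ?_)
    (fun c ρ τ => TraceClassOp.op_injective ?_) 2 fun X ρ => ?_
  · simp only [op_phi, map_add, block_add, ContinuousLinearMap.add_comp,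
      ContinuousLinearMap.comp_add]
    abel
  · simp only [op_phi, map_smul, block_smul, ContinuousLinearMap.smul_comp,
      ContinuousLinearMap.comp_smul, smul_sub]
  · simp only [op_phi, map_add, ContinuousLinearMap.add_comp, ContinuousLinearMap.comp_add]
    abel
  · simp only [op_phi, map_smul, ContinuousLinearMap.smul_comp,
      ContinuousLinearMap.comp_smul, smul_sub]
  · rw [TraceClassOp.norm_def, TraceClassOp.norm_def, op_phi]
    have h := traceNorm_nonneg ρ.op
    refine (traceNorm_commutator_le (block K K X.op) ρ.isTraceClass).trans ?_
    gcongr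
    exact X.norm_block_pp_le

/-- The norm of `𝔥` controls off-diagonal blocks in `L²`, which by Hölder's inequality is exactly
what bounds their products in `L¹`. -/
theorem exists_omega_clm : ∃ Ω : RestrictedLie K →L[ℂ] RestrictedLie K →L[ℂ]
    TraceClassOp (HilbertSub K), ∀ X X', Ω X X' = omega X X' := by
  refine exists_clm_bilinear _ (fun ρ ρ' τ => TraceClassOp.op_injective ?_)
    (fun c ρ τ => TraceClassOp.op_injective ?_) (fun ρ τ τ' => TraceClassOp.op_injective ?_)
    (fun c ρ τ => TraceClassOp.op_injective ?_) 2 fun X Y => ?_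
  · simp only [op_omega, map_add, block_add, ContinuousLinearMap.add_comp,
      ContinuousLinearMap.comp_add]
    abel
  · simp only [op_omega, map_smul, block_smul, ContinuousLinearMap.smul_comp,
      ContinuousLinearMap.comp_smul, smul_sub]
  · simp only [op_omega, map_add, block_add, ContinuousLinearMap.add_comp,
      ContinuousLinearMap.comp_add]
    abel
  · simp only [op_omega, map_smul, block_smul, ContinuousLinearMap.smul_comp,
      ContinuousLinearMap.comp_smul, smul_sub]
  · rw [TraceClassOp.norm_def, op_omega, sub_eq_add_neg]
    refine (traceNorm_add_le (X.hs_pm.comp Y.hs_mp) (Y.hs_pm.comp X.hs_mp).neg).trans ?_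
    rw [traceNorm_neg (Y.hs_pm.comp X.hs_mp)]
    have h1 := (traceNorm_hs_comp_le X.hs_pm Y.hs_mp).trans (mul_le_mul X.hsNorm_block_pm_le
      Y.hsNorm_block_mp_le (hsNorm_nonneg _) (norm_nonneg _))
    have h2 := (traceNorm_hs_comp_le Y.hs_pm X.hs_mp).trans (mul_le_mul Y.hsNorm_block_pm_le
      X.hsNorm_block_mp_le (hsNorm_nonneg _) (norm_nonneg _))
    linarith

theorem phi_nBracket (X : RestrictedLie K) (ρ ρ' : TraceClassOp (HilbertSub K)) :
    phi X (nBracket ρ ρ') = nBracket (phi X ρ) ρ' + nBracket ρ (phi X ρ') :=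
  TraceClassOp.op_injective (by
    simp only [op_nBracket, op_phi, map_add, ContinuousLinearMap.neg_comp,
      ContinuousLinearMap.comp_neg, ContinuousLinearMap.sub_comp, ContinuousLinearMap.comp_sub,
      ContinuousLinearMap.comp_assoc]
    abel)

theorem omega_skew (X X' : RestrictedLie K) : omega X X' = -omega X' X :=
  TraceClassOp.op_injective (by rw [map_neg, op_omega, op_omega]; abel)

/-- A Bianchi identity: `ω(X, X') = [X, X']₊ - [X₊, X'₊]` is the curvature of `X ↦ X₊`, and the
Jacobi identities on `H` and `H₊` make its cyclic derivative vanish. The verification expands all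
products into blocks. -/
theorem omega_cocycle (X X' X'' : RestrictedLie K) :
    omega (X.bracket X') X'' + omega (X'.bracket X'') X + omega (X''.bracket X) X' -
      phi X (omega X' X'') - phi X' (omega X'' X) - phi X'' (omega X X') = 0 :=
  TraceClassOp.op_injective (by
    simp only [op_omega, op_phi, RestrictedLie.op_bracket, map_add, map_sub, map_zero, block_sub,
      block_mul _ _ K, ContinuousLinearMap.add_comp, ContinuousLinearMap.comp_add,
      ContinuousLinearMap.sub_comp, ContinuousLinearMap.comp_sub, ContinuousLinearMap.comp_assoc]
    abel)

/-- Since `φ(X) = [X₊, ·]`, its failure to be a representation is the commutator with `[X, X']₊ -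
[X₊, X'₊] = ω(X, X')`, which the negative bracket of `𝔫` cancels. -/
theorem phi_bracket (X X' : RestrictedLie K) (ρ : TraceClassOp (HilbertSub K)) :
    nBracket (omega X X') ρ + phi (X.bracket X') ρ -
      (phi X (phi X' ρ) - phi X' (phi X ρ)) = 0 :=
  TraceClassOp.op_injective (by
    simp only [op_omega, op_phi, op_nBracket, RestrictedLie.op_bracket, map_add, map_sub,
      map_zero, block_sub, block_mul _ _ K, ContinuousLinearMap.add_comp,
      ContinuousLinearMap.comp_add, ContinuousLinearMap.sub_comp, ContinuousLinearMap.comp_sub,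
      ContinuousLinearMap.comp_assoc]
    abel)

theorem exists_gBracket_clm : ∃ T : TraceClassOp (HilbertSub K) × RestrictedLie K →L[ℂ]
    TraceClassOp (HilbertSub K) × RestrictedLie K →L[ℂ]
    TraceClassOp (HilbertSub K) × RestrictedLie K, ∀ ξ η, T ξ η = gBracket ξ η := by
  obtain ⟨N, hN⟩ := exists_nBracket_clm (K := K)
  obtain ⟨Φ, hΦ⟩ := exists_phi_clm (K := K)
  obtain ⟨Ω, hΩ⟩ := exists_omega_clm (K := K)
  obtain ⟨T, hT⟩ := RestrictedLie.exists_bracket_clm (K := K)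
  have e : ∀ ξ η : TraceClassOp (HilbertSub K) × RestrictedLie K, gBracket ξ η =
      (N ξ.1 η.1 + Φ ξ.2 η.1 - Φ η.2 ξ.1 + Ω ξ.2 η.2, T ξ.2 η.2) := fun ξ η => by
    rw [gBracket, hN, hΦ, hΦ, hΩ, hT]
  refine exists_clm_bilinear _ (fun x x' y => ?_) (fun c x y => ?_) (fun x y y' => ?_)
    (fun c x y => ?_) (‖N‖ + ‖Φ‖ + ‖Φ‖ + ‖Ω‖ + ‖T‖) fun x y => ?_
  · simp only [e, Prod.fst_add, Prod.snd_add, map_add, _root_.add_apply, Prod.mk_add_mk]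
    congr 1; abel
  · simp only [e, Prod.smul_fst, Prod.smul_snd, map_smul, _root_.smul_apply, Prod.smul_mk,
      smul_add, smul_sub]
  · simp only [e, Prod.fst_add, Prod.snd_add, map_add, _root_.add_apply, Prod.mk_add_mk]
    congr 1; abel
  · simp only [e, Prod.smul_fst, Prod.smul_snd, map_smul, _root_.smul_apply, Prod.smul_mk,
      smul_add, smul_sub]
  -- Each of the five terms of the bracket is bounded by its operator norm times `‖x‖ ‖y‖`, as
  -- components are dominated by the maximum norm.
  · have hb : ∀ {a b : ℝ} {t : ℝ}, 0 ≤ t → 0 ≤ b → a ≤ ‖x‖ → b ≤ ‖y‖ →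
        t * a * b ≤ t * ‖x‖ * ‖y‖ := fun {a b t} ht hb h1 h2 => by gcongr
    have h1 := (N.le_opNorm₂ x.1 y.1).trans
      (hb N.opNorm_nonneg (norm_nonneg _) (norm_fst_le x) (norm_fst_le y))
    have h2 := (Φ.le_opNorm₂ x.2 y.1).trans
      (hb Φ.opNorm_nonneg (norm_nonneg _) (norm_snd_le x) (norm_fst_le y))
    have h3 : ‖Φ y.2 x.1‖ ≤ ‖Φ‖ * ‖x‖ * ‖y‖ := by
      refine (Φ.le_opNorm₂ y.2 x.1).trans ?_
      rw [mul_right_comm]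
      exact hb Φ.opNorm_nonneg (norm_nonneg _) (norm_fst_le x) (norm_snd_le y)
    have h4 := (Ω.le_opNorm₂ x.2 y.2).trans
      (hb Ω.opNorm_nonneg (norm_nonneg _) (norm_snd_le x) (norm_snd_le y))
    have h5 := (T.le_opNorm₂ x.2 y.2).trans
      (hb T.opNorm_nonneg (norm_nonneg _) (norm_snd_le x) (norm_snd_le y))
    have n1 := norm_nonneg (N x.1 y.1)
    have n2 := norm_nonneg (Φ x.2 y.1)
    have n3 := norm_nonneg (Φ y.2 x.1)
    have n4 := norm_nonneg (Ω x.2 y.2)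
    have n5 := norm_nonneg (T x.2 y.2)
    rw [e]
    refine max_le ?_ (by linarith)
    have := norm_add₃_le (a := N x.1 y.1) (b := Φ x.2 y.1) (c := -Φ y.2 x.1)
    rw [norm_neg, ← sub_eq_add_neg] at this
    linarith [norm_add_le (N x.1 y.1 + Φ x.2 y.1 - Φ y.2 x.1) (Ω x.2 y.2)]

/-- Conceptually, `(ρ, X) ↦ (X₊ - ρ, X)` is injective and turns this bracket into componentwise
commutators. The Jacobi identity is checked directly, by expansion into blocks. -/
theorem isBanachLieAlgebra_gBracket : IsBanachLieAlgebra (gBracket (K := K)) where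
  complete := inferInstance
  continuous_bilinear := exists_gBracket_clm
  alternating ξ := Prod.ext (TraceClassOp.op_injective (by
      simp [gBracket, op_nBracket, op_omega]))
    (RestrictedLie.isBanachLieAlgebra.alternating ξ.2)
  jacobi ξ η ζ := Prod.ext (TraceClassOp.op_injective (by
      simp only [gBracket, Prod.fst_add, Prod.fst_zero, op_omega, op_phi, op_nBracket,
        RestrictedLie.op_bracket, map_add, map_sub,
        map_zero, block_sub, block_mul _ _ K, ContinuousLinearMap.add_comp,
        ContinuousLinearMap.comp_add, ContinuousLinearMap.sub_comp, ContinuousLinearMap.comp_sub,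
        ContinuousLinearMap.neg_comp, ContinuousLinearMap.comp_neg,
        ContinuousLinearMap.comp_assoc]
      abel))
    (RestrictedLie.isBanachLieAlgebra.jacobi ξ.2 η.2 ζ.2)

theorem isBanachLieExtension_gBracket :
    IsBanachLieExtension (nBracket (K := K)) gBracket RestrictedLie.bracket
      (ContinuousLinearMap.inl ℂ (TraceClassOp (HilbertSub K)) (RestrictedLie K))
      (ContinuousLinearMap.snd ℂ (TraceClassOp (HilbertSub K)) (RestrictedLie K)) where
  lie₁ := isBanachLieAlgebra_nBracket
  lie := isBanachLieAlgebra_gBracket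
  lie₂ := RestrictedLie.isBanachLieAlgebra
  shortExact :=
    { injective := fun x y h => congrArg Prod.fst h
      exact := fun x => ⟨fun h => ⟨x.1, Prod.ext rfl h.symm⟩, by rintro ⟨y, rfl⟩; rfl⟩
      surjective := fun y => ⟨(0, y), rfl⟩ }
  map_i ρ ρ' := Prod.ext (TraceClassOp.op_injective (by
      simp [gBracket, op_nBracket, op_omega, op_phi, block_zero]))
    (RestrictedLie.isBanachLieAlgebra.alternating 0).symm
  map_p ξ η := rfl

end LieAlgebras

/-! ### Bilinearity of a predual pairing, read off from the isomorphism onto the dual. -/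

section PredualLinearity

variable {B : Type*} [NormedAddCommGroup B] [NormedSpace ℂ B]
variable {L : Type*} [NormedAddCommGroup L] [NormedSpace ℂ L] {pair : B → L → ℂ}

theorem IsPredual.add_left (h : IsPredual pair) (x y : B) (ξ : L) :
    pair (x + y) ξ = pair x ξ + pair y ξ := by
  obtain ⟨e, he⟩ := h
  simp only [← he, map_add]

theorem IsPredual.sub_left (h : IsPredual pair) (x y : B) (ξ : L) :
    pair (x - y) ξ = pair x ξ - pair y ξ := by
  obtain ⟨e, he⟩ := h
  simp only [← he, map_sub]

theorem IsPredual.add_right (h : IsPredual pair) (x : B) (ξ η : L) :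
    pair x (ξ + η) = pair x ξ + pair x η := by
  obtain ⟨e, he⟩ := h
  simp only [← he, map_add, _root_.add_apply]

theorem IsPredual.sub_right (h : IsPredual pair) (x : B) (ξ η : L) :
    pair x (ξ - η) = pair x ξ - pair x η := by
  obtain ⟨e, he⟩ := h
  simp only [← he, map_sub, _root_.sub_apply]

theorem IsPredual.neg_right (h : IsPredual pair) (x : B) (ξ : L) :
    pair x (-ξ) = -pair x ξ := by
  obtain ⟨e, he⟩ := h
  simp only [← he, map_neg, _root_.neg_apply]

theorem IsPredual.zero_left (h : IsPredual pair) (ξ : L) : pair 0 ξ = 0 := by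
  obtain ⟨e, he⟩ := h
  simp only [← he, map_zero]

theorem IsPredual.zero_right (h : IsPredual pair) (x : B) : pair x 0 = 0 := by
  obtain ⟨e, he⟩ := h
  simp only [← he, map_zero, _root_.zero_apply]

end PredualLinearity

/-! ### The coadjoint action of `𝔤` and the Poisson bracket on `𝔠 ⊕ 𝔞`. -/

section Coadjoint

variable {H : Type*} [NormedAddCommGroup H] [InnerProductSpace ℂ H] [CompleteSpace H]
variable {K : Submodule ℂ H} [CompleteSpace K]

/-- The commutator of a compact with a bounded operator. -/
def CompactOp.commutator {E : Type*} [NormedAddCommGroup E] [InnerProductSpace ℂ E]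
    [CompleteSpace E] (ϰ : CompactOp E) (a : E →L[ℂ] E) : CompactOp E :=
  .mk (ϰ.op ∘L a - a ∘L ϰ.op)
    ((ϰ.isCompactOperator.comp_clm a).sub (ϰ.isCompactOperator.clm_comp a))

theorem CompactOp.op_commutator {E : Type*} [NormedAddCommGroup E] [InnerProductSpace ℂ E]
    [CompleteSpace E] (ϰ : CompactOp E) (a : E →L[ℂ] E) :
    (ϰ.commutator a).op = ϰ.op ∘L a - a ∘L ϰ.op := rfl

/-- The commutator `[ρ, ϰ]` of a trace class with a compact operator. -/
def TraceClassOp.commutator {E : Type*} [NormedAddCommGroup E] [InnerProductSpace ℂ E]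
    [CompleteSpace E] (ρ : TraceClassOp E) (ϰ : CompactOp E) : TraceClassOp E :=
  .mk (ρ.op ∘L ϰ.op - ϰ.op ∘L ρ.op)
    ((ρ.isTraceClass.comp_clm _).sub (ρ.isTraceClass.clm_comp _))

/-- Only the term `ϰρa` has to be rotated, and it is the trace class operator `ϰρ` times the bounded
operator `a`. -/
theorem opTrace_comp_commutator {E : Type*} [NormedAddCommGroup E] [InnerProductSpace ℂ E]
    [CompleteSpace E] (ϰ : CompactOp E) (a : E →L[ℂ] E) (ρ : TraceClassOp E) :
    opTrace (ϰ.op ∘L (a ∘L ρ.op - ρ.op ∘L a)) = opTrace ((ϰ.commutator a).op ∘L ρ.op) := by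
  have hρ := ρ.isTraceClass
  rw [CompactOp.op_commutator, ContinuousLinearMap.comp_sub, ContinuousLinearMap.sub_comp,
    opTrace_sub ((hρ.clm_comp _).clm_comp _) ((hρ.comp_clm _).clm_comp _),
    opTrace_sub (hρ.clm_comp _) (hρ.clm_comp _), ← ContinuousLinearMap.comp_assoc ϰ.op ρ.op,
    opTrace_comp_comm (hρ.clm_comp ϰ.op)]
  rfl

/-- `φ(X)^*` preserves `𝒦(H₊)`. -/
theorem pairC_phi (ϰ : CompactOp (HilbertSub K)) (X : RestrictedLie K)
    (ρ : TraceClassOp (HilbertSub K)) :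
    pairC ϰ (phi X ρ) = pairC (ϰ.commutator (block K K X.op)) ρ :=
  opTrace_comp_commutator ϰ _ ρ

/-- The negative commutator of `ρ` and `ρ'` is `ρ'ρ - ρρ'`, the case `a = ρ'` of the preceding trace
identity. -/
theorem pairC_nBracket (ϰ : CompactOp (HilbertSub K)) (ρ ρ' : TraceClassOp (HilbertSub K)) :
    pairC ϰ (nBracket ρ ρ') = pairC (ϰ.commutator ρ'.op) ρ := by
  rw [pairC, op_nBracket, neg_sub]
  exact opTrace_comp_commutator ϰ _ ρ

theorem pairA_ofBlocks (a : TraceClassOp (HilbertSub K)) (d : TraceClassOp (HilbertSub Kᗮ))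
    (b : HilbertSchmidtOp (HilbertSub Kᗮ) (HilbertSub K))
    (c : HilbertSchmidtOp (HilbertSub K) (HilbertSub Kᗮ)) (X : RestrictedLie K) :
    pairA (.ofBlocks a d b c) X = opTrace (a.op ∘L block K K X.op) +
      opTrace (d.op ∘L block Kᗮ Kᗮ X.op) + opTrace (b.op ∘L block Kᗮ K X.op) +
      opTrace (c.op ∘L block K Kᗮ X.op) := by
  rw [pairA, RestrictedPredual.op_ofBlocks, block_pp_ofBlocks, block_mm_ofBlocks,
    block_pm_ofBlocks, block_mp_ofBlocks]

/-- `(φ(·)ρ)^*` maps `𝒦(H₊)` to `L¹(H, H₊)`. -/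
theorem pairC_phi_eq_pairA (ϰ : CompactOp (HilbertSub K)) (X : RestrictedLie K)
    (ρ : TraceClassOp (HilbertSub K)) :
    pairC ϰ (phi X ρ) = pairA (.ofBlocks (ρ.commutator ϰ) 0 0 0) X := by
  have hρ := ρ.isTraceClass
  simp only [pairA_ofBlocks, map_zero, ContinuousLinearMap.zero_comp, opTrace_zero, add_zero]
  rw [pairC, op_phi, TraceClassOp.commutator, TraceClassOp.op_mk, ContinuousLinearMap.comp_sub,
    ContinuousLinearMap.sub_comp,
    opTrace_sub ((hρ.clm_comp _).clm_comp _) ((hρ.comp_clm _).clm_comp _),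
    opTrace_sub ((hρ.comp_clm _).comp_clm _) ((hρ.clm_comp _).comp_clm _),
    ← ContinuousLinearMap.comp_assoc ϰ.op (block K K X.op), ← opTrace_comp_comm hρ]
  rfl

/-- `ω(·, X')^*` maps `𝒦(H₊)` to `L¹(H, H₊)`. -/
theorem pairC_omega (ϰ : CompactOp (HilbertSub K)) (X X' : RestrictedLie K) :
    pairC ϰ (omega X X') = pairA (.ofBlocks 0 0 (-.mk _ (X'.hs_pm.clm_comp ϰ.op))
      (.mk _ (X'.hs_mp.comp_clm ϰ.op))) X := by
  simp only [pairA_ofBlocks, map_zero, map_neg, ContinuousLinearMap.zero_comp, opTrace_zero,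
    zero_add, HilbertSchmidtOp.op_mk, ContinuousLinearMap.neg_comp, opTrace_neg]
  -- Cyclicity turns `tr(ϰ X₊₋ X'₋₊)` into `tr(X'₋₊ ϰ X₊₋)`, which accounts for the lower left
  -- block; the term `-tr(ϰ X'₊₋ X₋₊)` is already in the required order.
  rw [pairC, op_omega, ContinuousLinearMap.comp_sub,
    opTrace_sub ((X.hs_pm.comp X'.hs_mp).clm_comp _) ((X'.hs_pm.comp X.hs_mp).clm_comp _),
    ← ContinuousLinearMap.comp_assoc ϰ.op (block K Kᗮ X.op),
    opTrace_hs_comp_comm (X.hs_pm.clm_comp _) X'.hs_mp]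
  exact sub_eq_neg_add _ _

namespace RestrictedPredual

/-- The product `σX` of `σ ∈ L¹(H, H₊)` and `X ∈ L^∞(H, H₊)`. -/
def mulRight (σ : RestrictedPredual K) (X : RestrictedLie K) : RestrictedPredual K :=
  ⟨σ.op * X.op, by
    refine ⟨?_, ?_, ?_, ?_⟩ <;> rw [block_mul _ _ K]
    · exact (σ.tc_pp.comp_clm _).add (σ.hs_pm.comp X.hs_mp)
    · exact (σ.hs_mp.comp X.hs_pm).add (σ.tc_mm.comp_clm _)
    · exact (X.hs_pm.clm_comp _).add (σ.hs_pm.comp_clm _)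
    · exact (σ.hs_mp.comp_clm _).add (X.hs_mp.clm_comp _)⟩

/-- The product `Xσ` of `σ ∈ L¹(H, H₊)` and `X ∈ L^∞(H, H₊)`. -/
def mulLeft (X : RestrictedLie K) (σ : RestrictedPredual K) : RestrictedPredual K :=
  ⟨X.op * σ.op, by
    refine ⟨?_, ?_, ?_, ?_⟩ <;> rw [block_mul _ _ K]
    · exact (σ.tc_pp.clm_comp _).add (X.hs_pm.comp σ.hs_mp)
    · exact (X.hs_mp.comp σ.hs_pm).add (σ.tc_mm.clm_comp _)
    · exact (σ.hs_pm.clm_comp _).add (X.hs_pm.comp_clm _)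
    · exact (X.hs_mp.comp_clm _).add (σ.hs_mp.clm_comp _)⟩

theorem op_mulRight (σ : RestrictedPredual K) (X : RestrictedLie K) :
    (σ.mulRight X).op = σ.op * X.op := rfl

theorem op_mulLeft (X : RestrictedLie K) (σ : RestrictedPredual K) :
    (mulLeft X σ).op = X.op * σ.op := rfl

/-- The pairing is the sum of the traces of the two diagonal blocks of `σX`, so this is
associativity of block multiplication; cyclicity is not needed. -/
theorem pairA_mul (σ : RestrictedPredual K) (X Y : RestrictedLie K) :
    pairA σ (X.mul Y) = pairA (σ.mulRight X) Y := by
  simp only [pairA, op_mulRight, RestrictedLie.op_mul, block_mul _ _ K,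
    ContinuousLinearMap.comp_add, ContinuousLinearMap.add_comp]
  rw [opTrace_add (σ.tc_pp.comp_clm _) (σ.tc_pp.comp_clm _),
    opTrace_add (σ.tc_mm.comp_clm _) (σ.tc_mm.comp_clm _),
    opTrace_add (σ.hs_pm.comp (X.hs_mp.comp_clm _)) (σ.hs_pm.comp (Y.hs_mp.clm_comp _)),
    opTrace_add (σ.hs_mp.comp (Y.hs_pm.clm_comp _)) (σ.hs_mp.comp (X.hs_pm.comp_clm _)),
    opTrace_add ((σ.tc_pp.comp_clm _).comp_clm _) ((σ.hs_pm.comp X.hs_mp).comp_clm _),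
    opTrace_add ((σ.hs_mp.comp X.hs_pm).comp_clm _) ((σ.tc_mm.comp_clm _).comp_clm _),
    opTrace_add ((X.hs_pm.clm_comp _).comp Y.hs_mp) ((σ.hs_pm.comp_clm _).comp Y.hs_mp),
    opTrace_add ((σ.hs_mp.comp_clm _).comp Y.hs_pm) ((X.hs_mp.clm_comp _).comp Y.hs_pm)]
  simp only [ContinuousLinearMap.comp_assoc]
  ring

/-- Cyclicity of the trace block by block, needed to move a right factor of `𝔥` to the left of `σ`.
-/
theorem pairA_comm (σ : RestrictedPredual K) (X : RestrictedLie K) :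
    pairA σ X = opTrace (block K K X.op ∘L block K K σ.op) +
      opTrace (block Kᗮ Kᗮ X.op ∘L block Kᗮ Kᗮ σ.op) +
      opTrace (block Kᗮ K X.op ∘L block K Kᗮ σ.op) +
      opTrace (block K Kᗮ X.op ∘L block Kᗮ K σ.op) := by
  rw [pairA, opTrace_comp_comm σ.tc_pp, opTrace_comp_comm σ.tc_mm,
    opTrace_hs_comp_comm σ.hs_pm X.hs_mp, opTrace_hs_comp_comm σ.hs_mp X.hs_pm]

theorem pairA_mul' (σ : RestrictedPredual K) (X Y : RestrictedLie K) :
    pairA σ (X.mul Y) = pairA (mulLeft Y σ) X := by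
  simp only [pairA_comm, op_mulLeft, RestrictedLie.op_mul, block_mul _ _ K,
    ContinuousLinearMap.comp_add, ContinuousLinearMap.add_comp]
  rw [opTrace_add (σ.tc_pp.clm_comp _) (σ.tc_pp.clm_comp _),
    opTrace_add (σ.tc_mm.clm_comp _) (σ.tc_mm.clm_comp _),
    opTrace_add ((X.hs_mp.comp_clm _).comp σ.hs_pm) ((Y.hs_mp.clm_comp _).comp σ.hs_pm),
    opTrace_add ((Y.hs_pm.clm_comp _).comp σ.hs_mp) ((X.hs_pm.comp_clm _).comp σ.hs_mp),
    opTrace_add ((σ.tc_pp.clm_comp _).clm_comp _) ((Y.hs_pm.comp σ.hs_mp).clm_comp _),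
    opTrace_add ((Y.hs_mp.comp σ.hs_pm).clm_comp _) ((σ.tc_mm.clm_comp _).clm_comp _),
    opTrace_add (X.hs_mp.comp (σ.hs_pm.clm_comp _)) (X.hs_mp.comp (Y.hs_pm.comp_clm _)),
    opTrace_add (X.hs_pm.comp (Y.hs_mp.comp_clm _)) (X.hs_pm.comp (σ.hs_mp.clm_comp _))]
  simp only [ContinuousLinearMap.comp_assoc]
  ring

/-- The coadjoint action of `L^∞(H, H₊)` on `L¹(H, H₊)`. -/
theorem pairA_bracket (σ : RestrictedPredual K) (X Y : RestrictedLie K) :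
    pairA σ (X.bracket Y) = pairA (mulLeft Y σ - σ.mulRight Y) X := by
  rw [RestrictedLie.bracket_eq, isPredual_pairA.sub_right, isPredual_pairA.sub_left,
    pairA_mul', pairA_mul]

end RestrictedPredual

/-- The pairing between `𝒦(H₊) ⊕ L¹(H, H₊)` and `L¹(H₊) ⊕ L^∞(H, H₊)`. -/
def pairG (p : CompactOp (HilbertSub K) × RestrictedPredual K)
    (ξ : TraceClassOp (HilbertSub K) × RestrictedLie K) : ℂ :=
  pairC p.1 ξ.1 + pairA p.2 ξ.2

theorem isPredual_pairG : IsPredual (pairG (K := K)) := isPredual_pairC.prod isPredual_pairA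

/-- The coadjoint action of `L¹(H₊) ⊕ L^∞(H, H₊)` on `𝒦(H₊) ⊕ L¹(H, H₊)`. -/
def coadG (p : CompactOp (HilbertSub K) × RestrictedPredual K)
    (ξ : TraceClassOp (HilbertSub K) × RestrictedLie K) :
    CompactOp (HilbertSub K) × RestrictedPredual K :=
  (p.1.commutator ξ.1.op - p.1.commutator (block K K ξ.2.op),
    .ofBlocks (ξ.1.commutator p.1) 0 0 0 +
    .ofBlocks 0 0 (-.mk _ (ξ.2.hs_pm.clm_comp p.1.op)) (.mk _ (ξ.2.hs_mp.comp_clm p.1.op)) +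
    (.mulLeft ξ.2 p.2 - p.2.mulRight ξ.2))

/-- Here the abstract theory meets the concrete spaces: the adjoints of `ρ ↦ [ρ, ρ']`, `φ(X)`,
`φ(·)ρ`, `ω(·, X)` and `ad X` all land in `𝔠` or `𝔞`. -/
theorem pairG_gBracket (p : CompactOp (HilbertSub K) × RestrictedPredual K)
    (ξ η : TraceClassOp (HilbertSub K) × RestrictedLie K) :
    pairG p (gBracket η ξ) = pairG (coadG p ξ) η := by
  simp only [pairG, coadG, gBracket, isPredual_pairC.add_right, isPredual_pairC.sub_right,
    isPredual_pairC.sub_left, isPredual_pairA.add_left (_ + _), isPredual_pairA.add_left (.ofBlocks _ _ _ _)]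
  rw [← pairC_nBracket, ← pairC_phi, ← pairC_phi_eq_pairA, ← pairC_omega,
    ← RestrictedPredual.pairA_bracket]
  ring

theorem fst_coadG_op (p : CompactOp (HilbertSub K) × RestrictedPredual K)
    (ξ : TraceClassOp (HilbertSub K) × RestrictedLie K) :
    (coadG p ξ).1.op = -(-(p.1.op ∘L ξ.1.op - ξ.1.op ∘L p.1.op) +
      (p.1.op ∘L block K K ξ.2.op - block K K ξ.2.op ∘L p.1.op)) := by
  simp only [coadG, map_sub, CompactOp.op_commutator]
  abel

theorem snd_coadG_op (p : CompactOp (HilbertSub K) × RestrictedPredual K)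
    (ξ : TraceClassOp (HilbertSub K) × RestrictedLie K) :
    (coadG p ξ).2.op = -((embBlock K Kᗮ (p.1.op ∘L block K Kᗮ ξ.2.op) -
        embBlock Kᗮ K (block Kᗮ K ξ.2.op ∘L p.1.op)) -
      embBlock K K (ξ.1.op ∘L p.1.op - p.1.op ∘L ξ.1.op) +
      (p.2.op * ξ.2.op - ξ.2.op * p.2.op)) := by
  simp only [coadG, map_add, map_sub, map_neg, map_zero, RestrictedPredual.op_ofBlocks,
    RestrictedPredual.op_mulLeft, RestrictedPredual.op_mulRight, ofBlocks, embBlock,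
    TraceClassOp.commutator, TraceClassOp.op_mk, HilbertSchmidtOp.op_mk,
    ContinuousLinearMap.zero_comp, ContinuousLinearMap.comp_zero, ContinuousLinearMap.neg_comp,
    ContinuousLinearMap.comp_neg]
  abel

/-- The chain rule for the two slices through `p`. Differentiability matters, since partial
derivatives may exist without a total one; this is why the two brackets are compared only on smooth
functions. -/
theorem funcDeriv_pairG {f : CompactOp (HilbertSub K) × RestrictedPredual K → ℂ}
    (hf : ContDiff ℂ ∞ f) (p : CompactOp (HilbertSub K) × RestrictedPredual K) :
    funcDeriv pairG f p = (derivC f p, derivA f p) := by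
  have hd : HasFDerivAt f (fderiv ℂ f p) (p.1, p.2) := ((hf.differentiable (by simp)) p).hasFDerivAt
  refine funcDeriv_eq_of_forall isPredual_pairG fun y => ?_
  have h1 : fderiv ℂ (fun ϰ => f (ϰ, p.2)) p.1 y.1 = fderiv ℂ f p (y.1, 0) := by
    have hc : HasFDerivAt (fun ϰ => f (ϰ, p.2))
        (fderiv ℂ f p ∘L .inl ℂ (CompactOp (HilbertSub K)) (RestrictedPredual K)) p.1 :=
      hd.comp p.1 (hasFDerivAt_prodMk_left p.1 p.2)
    rw [hc.fderiv]
    rfl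
  have h2 : fderiv ℂ (fun σ => f (p.1, σ)) p.2 y.2 = fderiv ℂ f p (0, y.2) := by
    have hc : HasFDerivAt (fun σ => f (p.1, σ))
        (fderiv ℂ f p ∘L .inr ℂ (CompactOp (HilbertSub K)) (RestrictedPredual K)) p.2 :=
      hd.comp p.2 (hasFDerivAt_prodMk_right p.1 p.2)
    rw [hc.fderiv]
    rfl
  rw [pairG, derivC, derivA, funcDeriv_spec isPredual_pairC, funcDeriv_spec isPredual_pairA, h1,
    h2, ← map_add]
  simp

theorem extBracket_eq_liePoissonBracket
    (f g : CompactOp (HilbertSub K) × RestrictedPredual K → ℂ) (hf : ContDiff ℂ ∞ f)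
    (hg : ContDiff ℂ ∞ g) : extBracket f g = liePoissonBracket pairG gBracket f g := by
  funext p
  rw [extBracket, liePoissonBracket, funcDeriv_pairG hf, funcDeriv_pairG hg, pairG, add_comm]
  simp only [gBracket]
  rw [sub_add_eq_add_sub]

theorem isBanachLiePoisson_extBracket : IsBanachLiePoisson (extBracket (K := K)) :=
  (isBanachLiePoisson_liePoissonBracket isPredual_pairG isBanachLieAlgebra_gBracket
    pairG_gBracket).congr extBracket_eq_liePoissonBracket

theorem isBanachLiePoissonExtension_extBracket :
    IsBanachLiePoissonExtension (liePoissonBracket (pairA (K := K)) RestrictedLie.bracket)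
      extBracket (liePoissonBracket (pairC (K := K)) nBracket)
      (ContinuousLinearMap.inr ℂ (CompactOp (HilbertSub K)) (RestrictedPredual K))
      (ContinuousLinearMap.fst ℂ (CompactOp (HilbertSub K)) (RestrictedPredual K)) where
  lp₁ := isBanachLiePoisson_liePoissonBracket isPredual_pairA RestrictedLie.isBanachLieAlgebra
    fun σ X Y => RestrictedPredual.pairA_bracket σ Y X
  lp := isBanachLiePoisson_extBracket
  lp₂ := isBanachLiePoisson_liePoissonBracket isPredual_pairC isBanachLieAlgebra_nBracket
    fun ϰ ρ ρ' => pairC_nBracket ϰ ρ' ρ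
  shortExact :=
    { injective := fun x y h => congrArg Prod.snd h
      exact := fun x => ⟨fun h => ⟨x.2, Prod.ext h.symm rfl⟩, by rintro ⟨y, rfl⟩; rfl⟩
      surjective := fun y => ⟨(y, 0), rfl⟩ }
  map_j f g hf hg := by
    funext σ
    -- On the image of `𝔞` one has `ϰ = 0`, which kills the trace term; the slice in `σ` of `f` is
    -- then `f` composed with the inclusion.
    rw [Function.comp_apply, extBracket]
    simp only [ContinuousLinearMap.inr_apply, isPredual_pairC.zero_left, add_zero]
    rfl
  map_p f g hf hg := by
    -- A function pulled back from `𝔠` is constant in `σ`, so only the bracket of `𝔫` survives.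
    have hA : ∀ (f : CompactOp (HilbertSub K) → ℂ)
        (p : CompactOp (HilbertSub K) × RestrictedPredual K),
        derivA (f ∘ ContinuousLinearMap.fst ℂ (CompactOp (HilbertSub K)) (RestrictedPredual K)) p
          = 0 := fun f p => by
      refine funcDeriv_eq_of_forall isPredual_pairA fun y => ?_
      rw [isPredual_pairA.zero_right]
      change fderiv ℂ (fun _ => f p.1) p.2 y = 0
      simp
    have hphi : ∀ ρ : TraceClassOp (HilbertSub K), phi 0 ρ = 0 := fun ρ =>
      TraceClassOp.op_injective (by simp [op_phi, block_zero])
    have homega : omega (0 : RestrictedLie K) 0 = 0 :=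
      TraceClassOp.op_injective (by simp [op_omega])
    funext p
    rw [Function.comp_apply, extBracket, hA, hA, RestrictedLie.isBanachLieAlgebra.alternating,
      isPredual_pairA.zero_right, hphi, hphi, homega, zero_add, sub_zero, add_zero, add_zero]
    rfl

end Coadjoint

end

theorem mainTheorem7 {H : Type*} [NormedAddCommGroup H] [InnerProductSpace ℂ H] [CompleteSpace H]
    [TopologicalSpace.SeparableSpace H] (K : Submodule ℂ H) [CompleteSpace K] :
    -- `𝔫` and `𝔥` are Banach Lie algebras
    IsBanachLieAlgebra (nBracket (K := K)) ∧
    IsBanachLieAlgebra (RestrictedLie.bracket (K := K)) ∧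
    -- `φ` is a continuous linear map into the continuous derivations of `𝔫`
    (∃ Φ : RestrictedLie K →L[ℂ] TraceClassOp (HilbertSub K) →L[ℂ] TraceClassOp (HilbertSub K),
      ∀ X ρ, Φ X ρ = phi X ρ) ∧
    (∀ (X : RestrictedLie K) (ρ ρ' : TraceClassOp (HilbertSub K)),
      phi X (nBracket ρ ρ') = nBracket (phi X ρ) ρ' + nBracket ρ (phi X ρ')) ∧
    -- `ω` is a continuous skew symmetric bilinear map
    (∃ Ω : RestrictedLie K →L[ℂ] RestrictedLie K →L[ℂ] TraceClassOp (HilbertSub K),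
      ∀ X X', Ω X X' = omega X X') ∧
    (∀ X X' : RestrictedLie K, omega X X' = -omega X' X) ∧
    -- the cocycle condition
    (∀ X X' X'' : RestrictedLie K,
      omega (X.bracket X') X'' + omega (X'.bracket X'') X + omega (X''.bracket X) X' -
        phi X (omega X' X'') - phi X' (omega X'' X) - phi X'' (omega X X') = 0) ∧
    -- the representation condition
    (∀ (X X' : RestrictedLie K) (ρ : TraceClassOp (HilbertSub K)),
      nBracket (omega X X') ρ + phi (X.bracket X') ρ -
        (phi X (phi X' ρ) - phi X' (phi X ρ)) = 0) ∧
    -- `𝔤 = 𝔫 ⊕ 𝔥` is a Banach Lie algebra extension of `𝔥` by `𝔫`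
    IsBanachLieExtension (nBracket (K := K)) gBracket RestrictedLie.bracket
      (ContinuousLinearMap.inl ℂ (TraceClassOp (HilbertSub K)) (RestrictedLie K))
      (ContinuousLinearMap.snd ℂ (TraceClassOp (HilbertSub K)) (RestrictedLie K)) ∧
    -- `𝔠 = 𝒦(H₊)` and `𝔞 = L¹(H, H₊)` are preduals of `𝔫` and `𝔥`
    IsPredual (pairC (K := K)) ∧
    IsPredual (pairA (K := K)) ∧
    -- `φ(X)^* 𝔠 ⊂ 𝔠`
    (∀ (X : RestrictedLie K) (ϰ : CompactOp (HilbertSub K)), ∃ ϰ' : CompactOp (HilbertSub K),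
      ∀ ρ, pairC ϰ (phi X ρ) = pairC ϰ' ρ) ∧
    -- `(φ(·)ρ)^* 𝔠 ⊂ 𝔞`
    (∀ (ρ : TraceClassOp (HilbertSub K)) (ϰ : CompactOp (HilbertSub K)), ∃ σ : RestrictedPredual K,
      ∀ X, pairC ϰ (phi X ρ) = pairA σ X) ∧
    -- `ω(X, ·)^* 𝔠 ⊂ 𝔞`
    (∀ (X : RestrictedLie K) (ϰ : CompactOp (HilbertSub K)), ∃ σ : RestrictedPredual K,
      ∀ X', pairC ϰ (omega X X') = pairA σ X') ∧
    -- `𝔠 ⊕ 𝔞` with the explicit bracket is a Banach Lie-Poisson space, and it is an extension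
    -- of `𝔠` by `𝔞`
    IsBanachLiePoisson (extBracket (K := K)) ∧
    IsBanachLiePoissonExtension (liePoissonBracket (pairA (K := K)) RestrictedLie.bracket)
      extBracket (liePoissonBracket (pairC (K := K)) nBracket)
      (ContinuousLinearMap.inr ℂ (CompactOp (HilbertSub K)) (RestrictedPredual K))
      (ContinuousLinearMap.fst ℂ (CompactOp (HilbertSub K)) (RestrictedPredual K)) ∧
    -- the Hamiltonian vector fields
    (∀ h : CompactOp (HilbertSub K) × RestrictedPredual K → ℂ, ContDiff ℂ ∞ h →
      ∃ Xh : CompactOp (HilbertSub K) × RestrictedPredual K → CompactOp (HilbertSub K) × RestrictedPredual K,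
        IsHamiltonianVectorField extBracket h Xh ∧
        ∀ (ϰ : CompactOp (HilbertSub K)) (σ : RestrictedPredual K),
          (Xh (ϰ, σ)).1.op =
            -(-(ϰ.op ∘L (derivC h (ϰ, σ)).op - (derivC h (ϰ, σ)).op ∘L ϰ.op) +
              (ϰ.op ∘L block K K (derivA h (ϰ, σ)).op -
                block K K (derivA h (ϰ, σ)).op ∘L ϰ.op)) ∧
          (Xh (ϰ, σ)).2.op =
            -((embBlock K Kᗮ (ϰ.op ∘L block K Kᗮ (derivA h (ϰ, σ)).op) -
                embBlock Kᗮ K (block Kᗮ K (derivA h (ϰ, σ)).op ∘L ϰ.op)) -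
              embBlock K K ((derivC h (ϰ, σ)).op ∘L ϰ.op - ϰ.op ∘L (derivC h (ϰ, σ)).op) +
              (σ.op * (derivA h (ϰ, σ)).op - (derivA h (ϰ, σ)).op * σ.op))) := by
  refine ⟨isBanachLieAlgebra_nBracket, RestrictedLie.isBanachLieAlgebra, exists_phi_clm,
    phi_nBracket, exists_omega_clm, omega_skew, omega_cocycle, phi_bracket,
    isBanachLieExtension_gBracket, isPredual_pairC, isPredual_pairA,
    fun X ϰ => ⟨_, fun ρ => pairC_phi ϰ X ρ⟩,
    fun ρ ϰ => ⟨_, fun X => pairC_phi_eq_pairA ϰ X ρ⟩,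
    -- The adjoint of `ω(·, X)` with both signs reversed, since `ω(X, ·) = -ω(·, X)`.
    fun X ϰ => ⟨.ofBlocks 0 0 (.mk _ (X.hs_pm.clm_comp ϰ.op)) (-.mk _ (X.hs_mp.comp_clm ϰ.op)),
      fun X' => ?_⟩,
    isBanachLiePoisson_extBracket, isBanachLiePoissonExtension_extBracket, fun h hh =>
      ⟨_, (isHamiltonianVectorField_coad isPredual_pairG isBanachLieAlgebra_gBracket
        pairG_gBracket hh).congr extBracket_eq_liePoissonBracket hh, fun ϰ σ => ?_⟩⟩
  · rw [omega_skew, isPredual_pairC.neg_right, pairC_omega, pairA_ofBlocks, pairA_ofBlocks]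
    simp only [map_zero, map_neg, ContinuousLinearMap.zero_comp, opTrace_zero,
      HilbertSchmidtOp.op_mk, ContinuousLinearMap.neg_comp, opTrace_neg]
    ring
  -- The coadjoint field is built from the total functional derivative; it is now expressed through
  -- the two partial ones.
  · rw [funcDeriv_pairG hh]
    exact ⟨fst_coadG_op _ _, snd_coadG_op _ _⟩
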